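/- For $f:\mathbb R\to\mathbb R$ consider the planar map $q'=p,\ p'=-q+f(p)$. For parameters $A,B,a$ let $f_{A,B}(p)=\dfrac{ap-Bp^2}{Ap^2+Bp+1}$ and $K_{A,B}=p^2-apq+q^2+B(p^2q+pq^2)+Ap^2q^2$ be the symmetric McMillan force and the invariant of the corresponding map. For a planar map $T$ with an integral of motion $K$ whose level curves near the origin are invariant closed curves around it, let $J=\frac1{2\pi}\oint p\,dq$ be the action of a curve (enclosed area over $2\pi$) and $\nu(J)$ the rotation number (modulo $1$; clockwise turns per iteration) on the curve of action $J$. For a map $T$ that need not be integrable, "$\frac{d\nu}{dJ}|_{J=0}=\tau$" means that $\tau$ is its first (Birkhoff) twist coefficient: in suitable smooth area- and orientation-preserving coordinates $(X,Y)$ at the fixed point $0$, $T$ is the clockwise rotation by $2\pi(\nu_0+\tau\frac{X^2+Y^2}{2})$ up to $O(|(X,Y)|^4)$. In (1)–(3), $|a|<2$ and $\nu_0=\frac1{2\pi}\arccos\frac a2$. (1) Cubic Hénon map. Let $a\ne0$ and $f(q)=aq\pm q^3$. The McMillan force with $A=\mp\frac1a$, $B=0$ has the same 3-jet at $0$ as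 $f$. For this McMillan map $\nu(J)$ is defined for all small $J$, with $\nu(0)=\nu_0$ and $$\frac{d\nu}{dJ}\Big|_{J=0}=\mp\frac{3}{8\pi\sin^2(2\pi\nu_0)},$$ and the first twist coefficient of the Hénon map has the same value. (2) Quadratic Hénon map, first order (SX-1). Let $a\ne-1$ and $f(q)=aq+q^2$. The McMillan force with $A=0$, $B=-\frac1{a+1}$ has the same 2-jet as $f$, and for this McMillan map $\nu(J)$ is defined for all small $J$, with $\nu(0)=\nu_0$ and $$\frac{d\nu}{dJ}\Big|_{J=0}=-\frac1{16\pi}\,\frac{9\cos(\pi\nu_0)+\cos(3\pi\nu_0)}{\sin^3(2\pi\nu_0)\,\sin(3\pi\nu_0)}.$$ (3) Quadratic Hénon map, second order (SX-2). Let $a\ne0,-1$ and $f(q)=aq+q^2$. The McMillan force with $A=\frac1{a(a+1)}$, $B=-\frac1{a+1}$ has the same 3-jet as $f$. For this McMillan map $\nu(J)$ is defined for all small $J$, with $\nu(0)=\nu_0$ and $$\frac{d\nu}{dJ}\Big|_{J=0}=-\frac1{16\pi}\,\frac{3\cot(\pi\nu_0)+\cot(3\pi\nu_0)}{\sin^3(2\pi\nu_0)},$$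 and the first twist coefficient of the Hénon map has the same value. (4) Thin lens. Let $\beta>0$, $\alpha,\nu_0\in\mathbb R$, $\Phi=2\pi\nu_0$, $\sin\Phi\neq0$, $a=2\cos\Phi$, and consider the lattice consisting of the linear map $$M=\begin{pmatrix}\cos\Phi+\alpha\sin\Phi&\beta\sin\Phi\\-\frac{1+\alpha^2}{\beta}\sin\Phi&\cos\Phi-\alpha\sin\Phi\end{pmatrix}$$ on $(x,\dot x)$ and one thin lens $(x,\dot x)\mapsto(x,\dot x+F(x))$; the one-turn map is the composition of the two in either order, and the action is taken with respect to $dx\,d\dot x$. With $q=x$ and $p=x'$ (the position one turn later) the one-turn map takes the form $q'=p$, $p'=-q+f(p)$, $f(q)=2q\cos\Phi+\beta\sin\Phi\,F(q)$. – Sextupole, $F(x)=kx^2$, put $b=\beta k\sin\Phi$. First order ($a\neq-1$): for the lens whose $f$ is the McMillan force with $A=0$, $B=-\frac b{a+1}$, which has the 2-jet of $F$, $\nu(J)$ is defined for all small $J$, with $\nu(0)=\nu_0$ and $\frac{d\nu}{dJ}|_{J=0}=-\frac1{16\pi}\frac{9\cos(\pi\nu_0)+\cos(3\pi\nu_0)}{\sin(3\pi\nu_0)}\beta^3k^2$.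 Second order ($a\ne0,-1$): the lens whose $f$ is the McMillan force with $A=\frac{b^2}{a(a+1)}$, $B=-\frac b{a+1}$ has the 3-jet of $F$; for the lattice with this lens $\nu(J)$ is defined for all small $J$, with $\nu(0)=\nu_0$ and $$\frac{d\nu}{dJ}\Big|_{J=0}=-\frac1{16\pi}\big[3\cot(\pi\nu_0)+\cot(3\pi\nu_0)\big]\beta^3k^2,$$ and the first twist coefficient of the lattice with the lens $F$ has the same value. – Octupole, $F(x)=\pm kx^3$ ($a\ne0$): the lens whose $f$ is the McMillan force with $A=\mp\frac{\beta k\sin\Phi}{a}$, $B=0$ has the 3-jet of $F$; for the lattice with this lens $\nu(J)$ is defined for all small $J$, with $\nu(0)=\nu_0$ and $$\frac{d\nu}{dJ}\Big|_{J=0}=\mp\frac3{8\pi}\beta^2k,$$ and the first twist coefficient of the lattice with the lens $F$ has the same value. -/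

import Mathlib

open Filter Topology Set MeasureTheory
open scoped ContDiff

noncomputable section

namespace Twist

/-! ### Planar maps and forces -/

/-- The map `q' = p`, `p' = -q + f p` of the phase plane, on points `(q, p)`. -/
def planarMap (f : ℝ → ℝ) (z : ℝ × ℝ) : ℝ × ℝ := (z.2, -z.1 + f z.2)

/-- The symmetric McMillan force
`f(p) = (a p - B p²) / (A p² + B p + 1)`
(normalised so that the coefficient of `p² + q²` in the invariant is `1`). -/
def mcmForce (A B a : ℝ) (p : ℝ) : ℝ := (a * p - B * p ^ 2) / (A * p ^ 2 + B * p + 1)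

/-- The biquadratic invariant of the symmetric McMillan map,
`A p² q² + B (p² q + p q²) + (p² - a p q + q²)`. -/
def mcmInvariant (A B a : ℝ) (z : ℝ × ℝ) : ℝ :=
  A * (z.2 ^ 2 * z.1 ^ 2) + B * (z.2 ^ 2 * z.1 + z.2 * z.1 ^ 2)
    + (z.2 ^ 2 - a * z.2 * z.1 + z.1 ^ 2)

/-- The coefficient `B` of the McMillan map approximating a force
`f(q) = a q + b q² + c q³ + …`. -/
def mhB (a b : ℝ) : ℝ := -(b / (a + 1))

/-- The coefficient `A` of the second order McMillan map approximating a force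
`f(q) = a q + b q² + c q³ + …`. At first order, `0` is used in its place. -/
def mhA (a b c : ℝ) : ℝ := b ^ 2 / (a * (a + 1)) - c / a

/-! ### Rotation number, action, detuning of an integrable map -/

/-- Clockwise angle in `[0, 2π)` about the origin, from the point `z` to the point `w`. -/
def angleStep (z w : ℝ × ℝ) : ℝ :=
  toIcoMod Real.two_pi_pos 0 (Complex.arg ⟨z.1, z.2⟩ - Complex.arg ⟨w.1, w.2⟩)

/-- The orbit of `z` under `T` has rotation number `r`: the number of clockwise turns about the
origin per iteration has mean `r`. -/
def HasRotationNumber (T : ℝ × ℝ → ℝ × ℝ) (z : ℝ × ℝ) (r : ℝ) : Prop :=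
  Tendsto (fun N : ℕ =>
      (∑ j ∈ Finset.range N, angleStep (T^[j] z) (T^[j + 1] z)) / (2 * Real.pi * N))
    atTop (𝓝 r)

/-- The part of the sublevel set `K ≤ h` that surrounds the origin. -/
def region (K : ℝ × ℝ → ℝ) (h : ℝ) : Set (ℝ × ℝ) := connectedComponentIn {z | K z ≤ h} 0

/-- The invariant curve of energy `h` around the origin. -/
def curve (K : ℝ × ℝ → ℝ) (h : ℝ) : Set (ℝ × ℝ) := {z ∈ region K h | K z = h}

/-- The action `J = (1/2π) ∮ p dq` of the invariant curve of energy `h`: the area that it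
encloses, divided by `2π`. -/
def action (K : ℝ × ℝ → ℝ) (h : ℝ) : ℝ := (volume (region K h)).toReal / (2 * Real.pi)

/-- The planar map `T` with integral of motion `K` has, near the origin, a rotation number that
is a function `ν(J)` of the action, with `ν(0) = ν₀` and `dν/dJ = τ` at `J = 0`: the origin is
surrounded by invariant curves `K = h`, `0 < h ≤ h₀`, their actions fill an interval `(0, J₀]`,
and every orbit on the curve of action `J` has rotation number `ν(J)` (modulo one). -/
def HasDetuning (T : ℝ × ℝ → ℝ × ℝ) (K : ℝ × ℝ → ℝ) (ν₀ τ : ℝ) : Prop :=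
  ∃ (ν : ℝ → ℝ) (h₀ : ℝ), 0 < h₀ ∧
    action K 0 = 0 ∧ StrictMonoOn (action K) (Icc 0 h₀) ∧ ContinuousOn (action K) (Icc 0 h₀) ∧
    (∀ h ∈ Ioc 0 h₀, IsCompact (region K h) ∧ (curve K h).Nonempty ∧
      MapsTo T (curve K h) (curve K h) ∧
      ∀ z ∈ curve K h, HasRotationNumber T z (Int.fract (ν (action K h)))) ∧
    ν 0 = ν₀ ∧ HasDerivWithinAt ν τ (Ici 0) 0

/-! ### First twist coefficient of a general area-preserving map -/

/-- Clockwise rotation of the plane by the angle `θ`. -/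
def cwRot (θ : ℝ) (z : ℝ × ℝ) : ℝ × ℝ :=
  (z.1 * Real.cos θ + z.2 * Real.sin θ, -z.1 * Real.sin θ + z.2 * Real.cos θ)

/-- The first twist coefficient, in the sense of the Birkhoff normal form. In suitable smooth
area- and orientation-preserving coordinates near the fixed point `0`, the map is the clockwise
rotation by `2π (ν₀ + τ J)`, `J = (X² + Y²)/2`, up to an error of fourth order. -/
def HasTwist (T : ℝ × ℝ → ℝ × ℝ) (ν₀ τ : ℝ) : Prop :=
  ∃ Ψ : OpenPartialHomeomorph (ℝ × ℝ) (ℝ × ℝ),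
    0 ∈ Ψ.source ∧ Ψ 0 = 0 ∧
    ContDiffOn ℝ ∞ Ψ Ψ.source ∧ ContDiffOn ℝ ∞ Ψ.symm Ψ.target ∧
    (∀ z ∈ Ψ.source, (fderiv ℝ Ψ z).det = 1) ∧
    (fun z : ℝ × ℝ => Ψ (T (Ψ.symm z))
        - cwRot (2 * Real.pi * (ν₀ + τ * ((z.1 ^ 2 + z.2 ^ 2) / 2))) z)
      =O[𝓝 0] fun z => ‖z‖ ^ 4

/-! ### Linear lattice with one thin lens -/

/-- The linear lattice in the Courant-Snyder form, with phase advance `Φ` and Twiss parameters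
`α`, `β`, `γ = (1 + α²)/β`, on points `(x, x˙)`. -/
def twissMap (Φ α β : ℝ) (z : ℝ × ℝ) : ℝ × ℝ :=
  ((Real.cos Φ + α * Real.sin Φ) * z.1 + β * Real.sin Φ * z.2,
    -((1 + α ^ 2) / β) * Real.sin Φ * z.1 + (Real.cos Φ - α * Real.sin Φ) * z.2)

/-- The thin lens `(x, x˙) ↦ (x, x˙ + F x)`. -/
def thinLens (F : ℝ → ℝ) (z : ℝ × ℝ) : ℝ × ℝ := (z.1, z.2 + F z.1)

/-- The one-turn maps of the lattice: starting just before and just after the lens. -/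
def oneTurnMaps (Φ α β : ℝ) (F : ℝ → ℝ) : Set (ℝ × ℝ → ℝ × ℝ) :=
  {twissMap Φ α β ∘ thinLens F, thinLens F ∘ twissMap Φ α β}

/-- The lens that turns the lattice into a symmetric McMillan map: in the coordinates
`q = x`, `p = x'` (positions on two successive turns) a lattice with lens `F` is the map
`q' = p`, `p' = -q + f p` with `f q = 2 q cos Φ + β sin Φ F q`; here `f = mcmForce A B (2 cos Φ)`. -/
def mcmLens (Φ β A B : ℝ) (x : ℝ) : ℝ :=
  (mcmForce A B (2 * Real.cos Φ) x - 2 * x * Real.cos Φ) / (β * Real.sin Φ)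

/-- The McMillan invariant, with `a = 2 cos Φ`, of a one-turn map `T` in the variables `(x, x˙)`,
through `q = x`, `p = x'`. -/
def lensInvariant (Φ A B : ℝ) (T : ℝ × ℝ → ℝ × ℝ) (z : ℝ × ℝ) : ℝ :=
  mcmInvariant A B (2 * Real.cos Φ) (z.1, (T z).1)

/-! ### The detuning values -/

/-- `(3 cot πν + cot 3πν) / (16π)`. -/
def sx2 (ν : ℝ) : ℝ :=
  (3 * Real.cot (Real.pi * ν) + Real.cot (3 * Real.pi * ν)) / (16 * Real.pi)

/-- `(9 cos πν + cos 3πν) / (16π sin 3πν)`. -/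
def sx1 (ν : ℝ) : ℝ :=
  (9 * Real.cos (Real.pi * ν) + Real.cos (3 * Real.pi * ν))
    / (16 * Real.pi * Real.sin (3 * Real.pi * ν))

end Twist

end

/-! Both kinds of statement depend on the force only through its 3-jet. Let |a| < 2, a = 2 cos Φ,
and let f have the 3-jet of `mcmForce A B a`. An area-preserving polynomial change of variables Ψ,
tangent to the identity, brings q' = p, p' = -q + f(p), up to fourth order, to the linear map
corrected by a rotation of its invariant ellipses through the angle μ sin Φ Q, where Q is `quadInv
a` and μ is `twistRate A B a` (`exists_normalForm`). Removing the quadratic and cubic terms of a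
general force divides by a + 1 and a, which vanish at the third and fourth order resonances. Written
in A and B instead of Taylor coefficients, the solution has only powers of 2 - a and 2 + a in its
denominators.

For `HasTwist` little remains. Linear coordinates that make the ellipses round turn the normal form
into a rotation by Φ + μ sin Φ Q up to fourth order (`ord_ellipseChart_normalMap`), and their scale
m is chosen so that the whole chart has Jacobian 1 (`hasTwist_of_conj`).

`HasDetuning` is about actual orbits. Near the origin the invariant K is a small perturbation of Q,
so its level curves are star-shaped. The map acts on each of them as an orientation-preserving
circle homeomorphism, whose translation number is the rotation number n(h) of all orbits of energy
h. In the coordinates of the normal form every step turns by Φ + μ sin Φ K up to third order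
(`exists_turning_coordinates`), and K is constant along orbits. The turning angles seen in two
charts tangent to each other up to a linear map of positive determinant differ by a bounded
coboundary, so the means agree and 2π n(h) = Φ + μ sin Φ h + O(h^(3/2)) for 0 < Φ < π
(`exists_rotationNumber_estimate`). The enclosed area is asymptotic to that of the ellipse, π h /
sin Φ (`tendsto_volume_disc`), hence J ~ h / (2 sin Φ) and dν/dJ = μ sin² Φ / π. Since J is strictly
increasing, these two asymptotics at h = 0 suffice; no smoothness of n or J is needed.

For the lattice, (x, x˙) ↦ (x, x') is a fibre map of constant Jacobian δ = β sin Φ, which divides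
actions by |δ|. When sin Φ < 0 it reverses orientation, and n is replaced by 1 - n.
`hasDetuning_of_fiberMap` covers all cases. The stated formulas are then μ rewritten in terms of sin
πν₀ and cos πν₀ (`half_angle_identities`). -/

noncomputable section

namespace Twist

/-! ### Orders of vanishing at the origin of the plane -/

/-- `f` vanishes to order `n` at the origin. -/
def Ord {E : Type*} [NormedAddCommGroup E] (n : ℕ) (f : ℝ × ℝ → E) : Prop :=
  f =O[𝓝 0] fun z => ‖z‖ ^ n

namespace Ord

variable {E F : Type*} [NormedAddCommGroup E] [NormedAddCommGroup F] {m n : ℕ}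

theorem mono {f : ℝ × ℝ → E} (h : Ord n f) (hmn : m ≤ n) : Ord m f := by
  refine Asymptotics.IsBigO.trans h (Asymptotics.IsBigO.of_bound 1 ?_)
  filter_upwards [Metric.ball_mem_nhds (0 : ℝ × ℝ) one_pos] with z hz
  rw [mem_ball_zero_iff] at hz
  simpa using pow_le_pow_of_le_one (norm_nonneg z) hz.le hmn

theorem add {f g : ℝ × ℝ → E} (hf : Ord n f) (hg : Ord n g) : Ord n fun z => f z + g z :=
  Asymptotics.IsBigO.add hf hg

theorem sub {f g : ℝ × ℝ → E} (hf : Ord n f) (hg : Ord n g) : Ord n fun z => f z - g z :=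
  Asymptotics.IsBigO.sub hf hg

theorem const_mul {f : ℝ × ℝ → ℝ} (hf : Ord n f) (c : ℝ) : Ord n fun z => c * f z :=
  Asymptotics.IsBigO.const_mul_left hf c

theorem smul [NormedSpace ℝ E] {f : ℝ × ℝ → ℝ} {g : ℝ × ℝ → E} (hf : Ord m f) (hg : Ord n g) :
    Ord (m + n) fun z => f z • g z := by
  have h := Asymptotics.IsBigO.smul hf hg
  refine h.congr_right fun z => ?_
  rw [pow_add, smul_eq_mul]

theorem mul {f g : ℝ × ℝ → ℝ} (hf : Ord m f) (hg : Ord n g) : Ord (m + n) fun z => f z * g z :=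
  hf.smul hg

theorem pow {f : ℝ × ℝ → ℝ} (hf : Ord m f) (k : ℕ) : Ord (m * k) fun z => f z ^ k := by
  have h := Asymptotics.IsBigO.pow hf k
  refine h.congr_right fun z => ?_
  rw [pow_mul]

theorem congr {f g : ℝ × ℝ → E} (hf : Ord n f) (h : ∀ z, f z = g z) : Ord n g := by
  have : f = g := funext h
  exact this ▸ hf

theorem fst : Ord 1 fun z : ℝ × ℝ => z.1 :=
  Asymptotics.IsBigO.of_bound 1 (Eventually.of_forall fun z => by
    simpa using norm_fst_le z)

theorem snd : Ord 1 fun z : ℝ × ℝ => z.2 :=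
  Asymptotics.IsBigO.of_bound 1 (Eventually.of_forall fun z => by
    simpa using norm_snd_le z)

theorem prodMk {f : ℝ × ℝ → E} {g : ℝ × ℝ → F} (hf : Ord n f) (hg : Ord n g) :
    Ord n fun z => (f z, g z) :=
  Asymptotics.IsBigO.prod_left hf hg

theorem fst_comp {f : ℝ × ℝ → E × F} (hf : Ord n f) : Ord n fun z => (f z).1 :=
  (Asymptotics.isBigO_prod_left.1 hf).1

theorem snd_comp {f : ℝ × ℝ → E × F} (hf : Ord n f) : Ord n fun z => (f z).2 :=
  (Asymptotics.isBigO_prod_left.1 hf).2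

theorem tendsto {f : ℝ × ℝ → E} (hf : Ord n f) (hn : n ≠ 0) : Tendsto f (𝓝 0) (𝓝 0) := by
  refine Asymptotics.IsBigO.trans_tendsto hf ?_
  have : Tendsto (fun z : ℝ × ℝ => ‖z‖ ^ n) (𝓝 0) (𝓝 (‖(0 : ℝ × ℝ)‖ ^ n)) :=
    (continuous_norm.pow n).tendsto 0
  simpa [hn] using this

theorem comp {f : ℝ × ℝ → E} {g : ℝ × ℝ → ℝ × ℝ} (hf : Ord n f) (hg : Ord 1 g) :
    Ord n fun z => f (g z) := by
  have h1 := Asymptotics.IsBigO.comp_tendsto hf (hg.tendsto one_ne_zero)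
  refine h1.trans ?_
  have h2 := Asymptotics.IsBigO.pow (Asymptotics.IsBigO.norm_left hg) n
  simpa [Function.comp_def] using h2

theorem comp_real {f : ℝ → ℝ} {g : ℝ × ℝ → ℝ} (hf : f =O[𝓝 0] fun t => t ^ n) (hg : Ord 1 g) :
    Ord n fun z => f (g z) := by
  have h1 := Asymptotics.IsBigO.comp_tendsto hf (hg.tendsto one_ne_zero)
  refine h1.trans ?_
  have h2 := Asymptotics.IsBigO.pow hg n
  simpa [Function.comp_def] using h2

end Ord

/-! ### Jets of order three of functions of two variables -/

/-- A polynomial of degree three in two variables, without constant term. -/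
structure Jet where
  c10 : ℝ
  c01 : ℝ
  c20 : ℝ
  c11 : ℝ
  c02 : ℝ
  c30 : ℝ
  c21 : ℝ
  c12 : ℝ
  c03 : ℝ

namespace Jet

/-- The linear part. -/
def lin (j : Jet) (z : ℝ × ℝ) : ℝ := j.c10 * z.1 + j.c01 * z.2

/-- The quadratic part. -/
def quad (j : Jet) (z : ℝ × ℝ) : ℝ := j.c20 * z.1 ^ 2 + j.c11 * (z.1 * z.2) + j.c02 * z.2 ^ 2

/-- The cubic part. -/
def cub (j : Jet) (z : ℝ × ℝ) : ℝ :=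
  j.c30 * z.1 ^ 3 + j.c21 * (z.1 ^ 2 * z.2) + j.c12 * (z.1 * z.2 ^ 2) + j.c03 * z.2 ^ 3

/-- The polynomial function. -/
def eval (j : Jet) (z : ℝ × ℝ) : ℝ := j.lin z + j.quad z + j.cub z

/-- The coordinate `q`. -/
def q : Jet := ⟨1, 0, 0, 0, 0, 0, 0, 0, 0⟩

/-- The coordinate `p`. -/
def p : Jet := ⟨0, 1, 0, 0, 0, 0, 0, 0, 0⟩

/-- Sum of jets. -/
def add (j k : Jet) : Jet :=
  ⟨j.c10 + k.c10, j.c01 + k.c01, j.c20 + k.c20, j.c11 + k.c11, j.c02 + k.c02,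
    j.c30 + k.c30, j.c21 + k.c21, j.c12 + k.c12, j.c03 + k.c03⟩

/-- Scalar multiple of a jet. -/
def smul (c : ℝ) (k : Jet) : Jet :=
  ⟨c * k.c10, c * k.c01, c * k.c20, c * k.c11, c * k.c02,
    c * k.c30, c * k.c21, c * k.c12, c * k.c03⟩

/-- Truncated product of jets. -/
def mul (j k : Jet) : Jet :=
  ⟨0, 0, j.c10 * k.c10, j.c10 * k.c01 + j.c01 * k.c10, j.c01 * k.c01,
    j.c10 * k.c20 + j.c20 * k.c10,
    j.c10 * k.c11 + j.c01 * k.c20 + j.c20 * k.c01 + j.c11 * k.c10,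
    j.c10 * k.c02 + j.c01 * k.c11 + j.c11 * k.c01 + j.c02 * k.c10,
    j.c01 * k.c02 + j.c02 * k.c01⟩

/-- The polynomial `α j + β j² + γ j³`, truncated. -/
def poly (α β γ : ℝ) (j : Jet) : Jet :=
  ((smul α j).add (smul β (j.mul j))).add (smul γ ((j.mul j).mul j))

/-- Truncated substitution `k (u, v)`. -/
def comp (k u v : Jet) : Jet :=
  (((smul k.c10 u).add (smul k.c01 v)).add
    (((smul k.c20 (u.mul u)).add (smul k.c11 (u.mul v))).add (smul k.c02 (v.mul v)))).add
    ((((smul k.c30 ((u.mul u).mul u)).add (smul k.c21 ((u.mul u).mul v))).add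
      (smul k.c12 ((u.mul v).mul v))).add (smul k.c03 ((v.mul v).mul v)))

theorem ord_lin (j : Jet) : Ord 1 j.lin :=
  (Ord.fst.const_mul _).add (Ord.snd.const_mul _)

theorem ord_quad (j : Jet) : Ord 2 j.quad :=
  (((Ord.fst.pow 2).const_mul _).add ((Ord.fst.mul Ord.snd).const_mul _)).add
    ((Ord.snd.pow 2).const_mul _)

theorem ord_cub (j : Jet) : Ord 3 j.cub :=
  ((((Ord.fst.pow 3).const_mul _).add (((Ord.fst.pow 2).mul Ord.snd).const_mul _)).add
    ((Ord.fst.mul (Ord.snd.pow 2)).const_mul _)).add ((Ord.snd.pow 3).const_mul _)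

theorem ord_eval (j : Jet) : Ord 1 j.eval :=
  ((j.ord_lin).add (j.ord_quad.mono (by norm_num))).add (j.ord_cub.mono (by norm_num))

end Jet

/-- `j` is the Taylor polynomial of order three of `f` at the origin. -/
def HasJet (f : ℝ × ℝ → ℝ) (j : Jet) : Prop := Ord 4 fun z => f z - j.eval z

namespace HasJet

variable {f g : ℝ × ℝ → ℝ} {j k : Jet}

theorem ord (h : HasJet f j) : Ord 1 f :=
  ((Ord.mono h (by norm_num)).add j.ord_eval).congr fun z => by ring

theorem q : HasJet (fun z => z.1) Jet.q :=
  (Asymptotics.isBigO_zero _ _).congr_left fun z => by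
    simp [Jet.q, Jet.eval, Jet.lin, Jet.quad, Jet.cub]

theorem p : HasJet (fun z => z.2) Jet.p :=
  (Asymptotics.isBigO_zero _ _).congr_left fun z => by
    simp [Jet.p, Jet.eval, Jet.lin, Jet.quad, Jet.cub]

theorem add (hf : HasJet f j) (hg : HasJet g k) : HasJet (fun z => f z + g z) (j.add k) :=
  (Ord.add hf hg).congr fun z => by
    simp only [Jet.add, Jet.eval, Jet.lin, Jet.quad, Jet.cub]; ring

theorem const_mul (hf : HasJet f j) (c : ℝ) : HasJet (fun z => c * f z) (j.smul c) :=
  (Ord.const_mul hf c).congr fun z => by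
    simp only [Jet.smul, Jet.eval, Jet.lin, Jet.quad, Jet.cub]; ring

theorem mul (hf : HasJet f j) (hg : HasJet g k) : HasJet (fun z => f z * g z) (j.mul k) := by
  have h1 : Ord 4 fun z => (f z - j.eval z) * g z := (Ord.mul hf hg.ord).mono (by norm_num)
  have h2 : Ord 4 fun z => j.eval z * (g z - k.eval z) :=
    (Ord.mul j.ord_eval hg).mono (by norm_num)
  -- The products that `Jet.mul` discards, grouped by the degree of the left factor.
  have h3 : Ord 4 fun z => j.lin z * k.cub z := j.ord_lin.mul k.ord_cub
  have h4 : Ord 4 fun z => j.quad z * (k.quad z + k.cub z) :=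
    j.ord_quad.mul (k.ord_quad.add (k.ord_cub.mono (by norm_num)))
  have h5 : Ord 4 fun z => j.cub z * k.eval z := j.ord_cub.mul k.ord_eval
  refine ((h1.add h2).add ((h3.add h4).add h5)).congr fun z => ?_
  simp only [Jet.mul, Jet.eval, Jet.lin, Jet.quad, Jet.cub]
  ring

theorem congr (hf : HasJet f j) (h : ∀ z, f z = g z) : HasJet g j :=
  Ord.congr hf fun z => by rw [h]

theorem poly {φ : ℝ → ℝ} {α β γ : ℝ}
    (hφ : (fun t => φ t - (α * t + β * t ^ 2 + γ * t ^ 3)) =O[𝓝 0] fun t => t ^ 4)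
    (hf : HasJet f j) : HasJet (fun z => φ (f z)) (j.poly α β γ) := by
  have h1 := Ord.comp_real hφ hf.ord
  have h2 := ((hf.const_mul α).add ((hf.mul hf).const_mul β)).add
    (((hf.mul hf).mul hf).const_mul γ)
  refine (Ord.add h1 h2).congr fun z => ?_
  simp only [Jet.poly]
  ring

theorem comp {u v : ℝ × ℝ → ℝ} {a b : Jet} (hf : HasJet f j) (hu : HasJet u a)
    (hv : HasJet v b) : HasJet (fun z => f (u z, v z)) (j.comp a b) := by
  have h1 : Ord 4 fun z => f (u z, v z) - j.eval (u z, v z) :=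
    Ord.comp (g := fun z => (u z, v z)) hf (hu.ord.prodMk hv.ord)
  have h2 := (((hu.const_mul j.c10).add (hv.const_mul j.c01)).add
    ((((hu.mul hu).const_mul j.c20).add ((hu.mul hv).const_mul j.c11)).add
      ((hv.mul hv).const_mul j.c02))).add
    (((((((hu.mul hu).mul hu)).const_mul j.c30).add (((hu.mul hu).mul hv).const_mul j.c21)).add
      (((hu.mul hv).mul hv).const_mul j.c12)).add (((hv.mul hv).mul hv).const_mul j.c03))
  refine (Ord.add h1 h2).congr fun z => ?_
  simp only [Jet.comp, Jet.eval, Jet.lin, Jet.quad, Jet.cub]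
  ring

end HasJet

/-! ### Area-preserving polynomial shears -/

/-- The homeomorphism `e` of the plane fixes the origin, is smooth with its inverse, and has
Jacobian determinant `δ` everywhere. -/
structure IsSmoothArea (δ : ℝ) (e : (ℝ × ℝ) ≃ₜ (ℝ × ℝ)) : Prop where
  map_zero : e 0 = 0
  contDiff : ContDiff ℝ ∞ e
  contDiff_symm : ContDiff ℝ ∞ e.symm
  det : ∀ z, (fderiv ℝ e z).det = δ

theorem IsSmoothArea.trans {δ ε : ℝ} {e e' : (ℝ × ℝ) ≃ₜ (ℝ × ℝ)} (h : IsSmoothArea δ e)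
    (h' : IsSmoothArea ε e') : IsSmoothArea (δ * ε) (e.trans e') where
  map_zero := by simp [h.map_zero, h'.map_zero]
  contDiff := h'.contDiff.comp h.contDiff
  contDiff_symm := h.contDiff_symm.comp h'.contDiff_symm
  det z := by
    have h1 : DifferentiableAt ℝ e z := (h.contDiff.differentiable (by simp)) z
    have h2 : DifferentiableAt ℝ e' (e z) := (h'.contDiff.differentiable (by simp)) _
    have h3 : fderiv ℝ (e.trans e') z = (fderiv ℝ e' (e z)).comp (fderiv ℝ e z) :=
      fderiv_comp z h2 h1
    rw [h3]
    have h4 : ((fderiv ℝ e' (e z)).comp (fderiv ℝ e z)).det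
        = (fderiv ℝ e' (e z)).det * (fderiv ℝ e z).det := LinearMap.det_comp _ _
    rw [h4, h.det, h'.det, mul_comm]

theorem det_clm_prod (M : (ℝ × ℝ) →L[ℝ] (ℝ × ℝ)) :
    M.det = (M (1, 0)).1 * (M (0, 1)).2 - (M (0, 1)).1 * (M (1, 0)).2 := by
  change LinearMap.det (M : (ℝ × ℝ) →ₗ[ℝ] (ℝ × ℝ)) = _
  rw [← LinearMap.det_toMatrix (Module.Basis.finTwoProd ℝ), Matrix.det_fin_two]
  simp [LinearMap.toMatrix_apply]

/-- The shear `z ↦ z + g (u q + v p) (-v, u)`. -/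
def shear (u v : ℝ) (g : ℝ → ℝ) (hg : Continuous g) : (ℝ × ℝ) ≃ₜ (ℝ × ℝ) where
  toFun z := (z.1 - v * g (u * z.1 + v * z.2), z.2 + u * g (u * z.1 + v * z.2))
  invFun z := (z.1 + v * g (u * z.1 + v * z.2), z.2 - u * g (u * z.1 + v * z.2))
  left_inv z := by
    have : u * (z.1 - v * g (u * z.1 + v * z.2)) + v * (z.2 + u * g (u * z.1 + v * z.2))
        = u * z.1 + v * z.2 := by ring
    ext <;> simp only [this] <;> ring
  right_inv z := by
    have : u * (z.1 + v * g (u * z.1 + v * z.2)) + v * (z.2 - u * g (u * z.1 + v * z.2))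
        = u * z.1 + v * z.2 := by ring
    ext <;> simp only [this] <;> ring
  continuous_toFun := by fun_prop
  continuous_invFun := by fun_prop

/-- The derivative is the identity plus the rank one map g'(ℓ) ℓ ⊗ (-v, u), where ℓ = u q + v p
vanishes on (-v, u); it is therefore unipotent. -/
theorem isSmoothArea_shear (u v : ℝ) {g : ℝ → ℝ} (hg : ContDiff ℝ ∞ g) (h0 : g 0 = 0) :
    IsSmoothArea 1 (shear u v g hg.continuous) where
  map_zero := by simp [shear, h0]
  contDiff := by
    change ContDiff ℝ ∞ fun z : ℝ × ℝ =>
      (z.1 - v * g (u * z.1 + v * z.2), z.2 + u * g (u * z.1 + v * z.2))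
    fun_prop
  contDiff_symm := by
    change ContDiff ℝ ∞ fun z : ℝ × ℝ =>
      (z.1 + v * g (u * z.1 + v * z.2), z.2 - u * g (u * z.1 + v * z.2))
    fun_prop
  det z := by
    obtain ⟨g', hg'⟩ : ∃ g', HasDerivAt g g' (u * z.1 + v * z.2) :=
      ⟨_, ((hg.differentiable (by simp)) _).hasDerivAt⟩
    have hl : HasFDerivAt (fun z : ℝ × ℝ => u * z.1 + v * z.2)
        (u • ContinuousLinearMap.fst ℝ ℝ ℝ + v • ContinuousLinearMap.snd ℝ ℝ ℝ) z :=
      (hasFDerivAt_fst.const_mul u).add (hasFDerivAt_snd.const_mul v)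
    have hgl := hg'.comp_hasFDerivAt z hl
    have h : HasFDerivAt (shear u v g hg.continuous) _ z :=
      (hasFDerivAt_fst.sub (hgl.const_mul v)).prodMk (hasFDerivAt_snd.add (hgl.const_mul u))
    rw [h.fderiv, det_clm_prod]
    simp
    ring

/-- The polynomial shear with profile `α t² + β t³`. -/
def polyShear (u v α β : ℝ) : (ℝ × ℝ) ≃ₜ (ℝ × ℝ) :=
  shear u v (fun t => α * t ^ 2 + β * t ^ 3) (by fun_prop)

theorem isSmoothArea_polyShear (u v α β : ℝ) : IsSmoothArea 1 (polyShear u v α β) :=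
  isSmoothArea_shear u v (by fun_prop) (by simp)

/-- The Taylor polynomial of a polynomial shear applied to the jets `j`, `k`. -/
def Jet.shear (u v α β : ℝ) (j : Jet × Jet) : Jet × Jet :=
  (j.1.add (((j.1.smul u).add (j.2.smul v)).poly 0 (-v * α) (-v * β)),
    j.2.add (((j.1.smul u).add (j.2.smul v)).poly 0 (u * α) (u * β)))

theorem HasJet.polyShear (u v α β : ℝ) {f : ℝ × ℝ → ℝ × ℝ} {j : Jet × Jet}
    (h1 : HasJet (fun z => (f z).1) j.1) (h2 : HasJet (fun z => (f z).2) j.2) :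
    HasJet (fun z => (Twist.polyShear u v α β (f z)).1) (Jet.shear u v α β j).1 ∧
      HasJet (fun z => (Twist.polyShear u v α β (f z)).2) (Jet.shear u v α β j).2 := by
  have hl := (h1.const_mul u).add (h2.const_mul v)
  have hp : ∀ c : ℝ, (fun t : ℝ => c * (α * t ^ 2 + β * t ^ 3)
      - (0 * t + (c * α) * t ^ 2 + (c * β) * t ^ 3)) =O[𝓝 0] fun t => t ^ 4 := fun c =>
    (Asymptotics.isBigO_zero _ _).congr_left fun t => by ring
  constructor
  · refine (h1.add (HasJet.poly (hp (-v)) hl)).congr fun z => ?_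
    simp only [Twist.polyShear, Twist.shear, Homeomorph.homeomorph_mk_coe, Equiv.coe_fn_mk]
    ring
  · refine (h2.add (HasJet.poly (hp u) hl)).congr fun z => ?_
    simp only [Twist.polyShear, Twist.shear, Homeomorph.homeomorph_mk_coe, Equiv.coe_fn_mk]

/-! ### The normal form of the map `q' = p`, `p' = -q + f p` -/

/-- A composition of five shears. -/
def fiveShears (x₀ x₁ x₂ y₀ y₂ y₃ y₄ : ℝ) : (ℝ × ℝ) ≃ₜ (ℝ × ℝ) :=
  ((((polyShear 1 0 x₀ y₀).trans (polyShear 0 1 x₁ 0)).trans (polyShear 1 (-1) x₂ y₂)).trans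
    (polyShear 1 1 0 y₃)).trans (polyShear 2 1 0 y₄)

theorem isSmoothArea_fiveShears (x₀ x₁ x₂ y₀ y₂ y₃ y₄ : ℝ) :
    IsSmoothArea 1 (fiveShears x₀ x₁ x₂ y₀ y₂ y₃ y₄) := by
  have := ((((isSmoothArea_polyShear 1 0 x₀ y₀).trans (isSmoothArea_polyShear 0 1 x₁ 0)).trans
    (isSmoothArea_polyShear 1 (-1) x₂ y₂)).trans
    (isSmoothArea_polyShear 1 1 0 y₃)).trans (isSmoothArea_polyShear 2 1 0 y₄)
  simpa only [mul_one, fiveShears] using this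

/-- The Taylor polynomial of `fiveShears`. -/
def fiveShearsJet (x₀ x₁ x₂ y₀ y₂ y₃ y₄ : ℝ) : Jet × Jet :=
  (⟨1, 0, x₂, -2 * x₂, x₂ - x₁, -2 * x₀ * x₂ + y₂ - y₃ - 8 * y₄,
      -2 * x₀ * x₁ + 2 * x₀ * x₂ - 3 * y₂ - 3 * y₃ - 12 * y₄,
      -2 * x₁ * x₂ + 3 * y₂ - 3 * y₃ - 6 * y₄, 2 * x₁ * x₂ - y₂ - y₃ - y₄⟩,
    ⟨0, 1, x₀ + x₂, -2 * x₂, x₂, -2 * x₀ * x₂ + y₀ + y₂ + y₃ + 16 * y₄,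
      2 * x₀ * x₂ - 3 * y₂ + 3 * y₃ + 24 * y₄, -2 * x₁ * x₂ + 3 * y₂ + 3 * y₃ + 12 * y₄,
      2 * x₁ * x₂ - y₂ + y₃ + 2 * y₄⟩)

/-- The jets are composed one shear at a time, each intermediate result being put in closed form, so
that the polynomial identities stay small. -/
theorem hasJet_fiveShears (x₀ x₁ x₂ y₀ y₂ y₃ y₄ : ℝ) :
    HasJet (fun z => (fiveShears x₀ x₁ x₂ y₀ y₂ y₃ y₄ z).1)
        (fiveShearsJet x₀ x₁ x₂ y₀ y₂ y₃ y₄).1 ∧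
      HasJet (fun z => (fiveShears x₀ x₁ x₂ y₀ y₂ y₃ y₄ z).2)
        (fiveShearsJet x₀ x₁ x₂ y₀ y₂ y₃ y₄).2 := by
  have h1 := HasJet.polyShear 1 0 x₀ y₀ (f := fun z => z) (j := (Jet.q, Jet.p)) HasJet.q HasJet.p
  have e1 : Jet.shear 1 0 x₀ y₀ (Jet.q, Jet.p) =
      (⟨1, 0, 0, 0, 0, 0, 0, 0, 0⟩, ⟨0, 1, x₀, 0, 0, y₀, 0, 0, 0⟩) := by
    simp only [Jet.shear, Jet.q, Jet.p, Jet.add, Jet.smul, Jet.mul, Jet.poly, Prod.mk.injEq,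
      Jet.mk.injEq]
    refine ⟨?_, ?_⟩ <;> (refine ⟨?_, ?_, ?_, ?_, ?_, ?_, ?_, ?_, ?_⟩ <;> ring)
  rw [e1] at h1
  have h2 := HasJet.polyShear 0 1 x₁ 0 (f := polyShear 1 0 x₀ y₀) h1.1 h1.2
  have e2 : Jet.shear 0 1 x₁ 0
      (⟨1, 0, 0, 0, 0, 0, 0, 0, 0⟩, ⟨0, 1, x₀, 0, 0, y₀, 0, 0, 0⟩) =
      (⟨1, 0, 0, 0, -x₁, 0, -2 * x₀ * x₁, 0, 0⟩, ⟨0, 1, x₀, 0, 0, y₀, 0, 0, 0⟩) := by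
    simp only [Jet.shear, Jet.add, Jet.smul, Jet.mul, Jet.poly, Prod.mk.injEq,
      Jet.mk.injEq]
    refine ⟨?_, ?_⟩ <;> (refine ⟨?_, ?_, ?_, ?_, ?_, ?_, ?_, ?_, ?_⟩ <;> ring)
  rw [e2] at h2
  have h3 := HasJet.polyShear 1 (-1) x₂ y₂
    (f := fun z => polyShear 0 1 x₁ 0 (polyShear 1 0 x₀ y₀ z)) h2.1 h2.2
  have e3 : Jet.shear 1 (-1) x₂ y₂
      (⟨1, 0, 0, 0, -x₁, 0, -2 * x₀ * x₁, 0, 0⟩, ⟨0, 1, x₀, 0, 0, y₀, 0, 0, 0⟩) =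
      fiveShearsJet x₀ x₁ x₂ y₀ y₂ 0 0 := by
    simp only [fiveShearsJet, Jet.shear, Jet.add, Jet.smul, Jet.mul, Jet.poly, Prod.mk.injEq,
      Jet.mk.injEq]
    refine ⟨?_, ?_⟩ <;> (refine ⟨?_, ?_, ?_, ?_, ?_, ?_, ?_, ?_, ?_⟩ <;> ring)
  rw [e3] at h3
  have h4 := HasJet.polyShear 1 1 0 y₃
    (f := fun z => polyShear 1 (-1) x₂ y₂ (polyShear 0 1 x₁ 0 (polyShear 1 0 x₀ y₀ z))) h3.1 h3.2
  have e4 : Jet.shear 1 1 0 y₃ (fiveShearsJet x₀ x₁ x₂ y₀ y₂ 0 0) =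
      fiveShearsJet x₀ x₁ x₂ y₀ y₂ y₃ 0 := by
    simp only [fiveShearsJet, Jet.shear, Jet.add, Jet.smul, Jet.mul, Jet.poly, Prod.mk.injEq,
      Jet.mk.injEq]
    refine ⟨?_, ?_⟩ <;> (refine ⟨?_, ?_, ?_, ?_, ?_, ?_, ?_, ?_, ?_⟩ <;> ring)
  rw [e4] at h4
  have h5 := HasJet.polyShear 2 1 0 y₄
    (f := fun z => polyShear 1 1 0 y₃
      (polyShear 1 (-1) x₂ y₂ (polyShear 0 1 x₁ 0 (polyShear 1 0 x₀ y₀ z)))) h4.1 h4.2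
  have e5 : Jet.shear 2 1 0 y₄ (fiveShearsJet x₀ x₁ x₂ y₀ y₂ y₃ 0) =
      fiveShearsJet x₀ x₁ x₂ y₀ y₂ y₃ y₄ := by
    simp only [fiveShearsJet, Jet.shear, Jet.add, Jet.smul, Jet.mul, Jet.poly, Prod.mk.injEq,
      Jet.mk.injEq]
    refine ⟨?_, ?_⟩ <;> (refine ⟨?_, ?_, ?_, ?_, ?_, ?_, ?_, ?_, ?_⟩ <;> ring)
  rw [e5] at h5
  exact h5

/-- The quadratic form `p² - a p q + q²`. -/
def quadInv (a : ℝ) (z : ℝ × ℝ) : ℝ := z.2 ^ 2 - a * z.2 * z.1 + z.1 ^ 2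

/-- The linear map `q' = p`, `p' = -q + a p`. -/
def linMap (a : ℝ) (z : ℝ × ℝ) : ℝ × ℝ := (z.2, -z.1 + a * z.2)

/-- The linear map `linMap a`, corrected to third order by a rotation of its invariant ellipses
through an angle proportional to `quadInv a`. -/
def normalMap (a μ : ℝ) (z : ℝ × ℝ) : ℝ × ℝ :=
  linMap a z + (μ * quadInv a z) • (linMap a (linMap a z) - (a / 2) • linMap a z)

/-- The rate of the twist of a map whose force has the Taylor polynomial of order three of
`mcmForce A B a`. -/
def twistRate (A B a : ℝ) : ℝ :=
  6 * a * A / (4 - a ^ 2) ^ 2 - 2 * (a + 1) * (a + 8) * B ^ 2 / ((2 - a) ^ 3 * (2 + a) ^ 2)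

/-- `f` has the Taylor polynomial of order three of `mcmForce A B a`. -/
def MatchesForce (A B a : ℝ) (f : ℝ → ℝ) : Prop :=
  (fun t => f t - (a * t + (-(a + 1) * B) * t ^ 2 + ((a + 1) * B ^ 2 - a * A) * t ^ 3))
    =O[𝓝 0] fun t => t ^ 4

theorem hasJet_planarMap {A B a : ℝ} {f : ℝ → ℝ} (hf : MatchesForce A B a f) :
    HasJet (fun z => (planarMap f z).1) Jet.p ∧
      HasJet (fun z => (planarMap f z).2)
        ⟨-1, a, 0, 0, -(a + 1) * B, 0, 0, 0, (a + 1) * B ^ 2 - a * A⟩ := by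
  refine ⟨HasJet.p, ?_⟩
  have := (HasJet.q.const_mul (-1)).add (HasJet.poly hf HasJet.p)
  have e : (Jet.smul (-1) Jet.q).add
      (Jet.p.poly a (-(a + 1) * B) ((a + 1) * B ^ 2 - a * A)) =
      ⟨-1, a, 0, 0, -(a + 1) * B, 0, 0, 0, (a + 1) * B ^ 2 - a * A⟩ := by
    simp only [Jet.q, Jet.p, Jet.add, Jet.smul, Jet.mul, Jet.poly, Jet.mk.injEq]
    refine ⟨?_, ?_, ?_, ?_, ?_, ?_, ?_, ?_, ?_⟩ <;> ring
  rw [e] at this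
  exact this.congr fun z => by simp [planarMap]

/-- The Taylor polynomial of `normalMap` applied to the jets `j`, `k`. -/
def normalJet (a μ : ℝ) (j k : Jet) : Jet × Jet :=
  let K := ((k.mul k).add (Jet.smul (-a) (k.mul j))).add (j.mul j)
  -- M₁ and M₂ are the components of L² - (a/2) L, where L = `linMap a`.
  let M₁ := (Jet.smul (-1) j).add (k.smul (a / 2))
  let M₂ := (Jet.smul (-(a / 2)) j).add (k.smul (a ^ 2 / 2 - 1))
  (k.add ((K.mul M₁).smul μ), ((Jet.smul (-1) j).add (k.smul a)).add ((K.mul M₂).smul μ))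

theorem hasJet_normalMap (a μ : ℝ) {f : ℝ × ℝ → ℝ × ℝ} {j k : Jet}
    (hj : HasJet (fun z => (f z).1) j) (hk : HasJet (fun z => (f z).2) k) :
    HasJet (fun z => (normalMap a μ (f z)).1) (normalJet a μ j k).1 ∧
      HasJet (fun z => (normalMap a μ (f z)).2) (normalJet a μ j k).2 := by
  have hK := ((hk.mul hk).add ((hk.mul hj).const_mul (-a))).add (hj.mul hj)
  have h1 := (hj.const_mul (-1)).add (hk.const_mul (a / 2))
  have h2 := (hj.const_mul (-(a / 2))).add (hk.const_mul (a ^ 2 / 2 - 1))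
  constructor
  · refine (hk.add ((hK.mul h1).const_mul μ)).congr fun z => ?_
    simp [normalMap, linMap, quadInv]
    ring
  · refine (((hj.const_mul (-1)).add (hk.const_mul a)).add ((hK.mul h2).const_mul μ)).congr
      fun z => ?_
    simp [normalMap, linMap, quadInv]
    ring

set_option maxHeartbeats 2000000 in
/-- A map whose force has the Taylor polynomial of order three of a McMillan force is conjugate
to `normalMap`, up to an error of fourth order, by an area-preserving map that is tangent to the
identity. -/
theorem exists_normalForm (A B : ℝ) {a : ℝ} (ha : |a| < 2) :
    ∃ Ψ : (ℝ × ℝ) ≃ₜ (ℝ × ℝ), IsSmoothArea 1 Ψ ∧ Ord 2 (fun z => Ψ z - z) ∧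
      ∀ f, MatchesForce A B a f →
        Ord 4 fun z => Ψ (planarMap f z) - normalMap a (twistRate A B a) (Ψ z) := by
  have hm : (2 - a) ≠ 0 := by have := (abs_lt.1 ha).2; linarith
  have hp : (2 + a) ≠ 0 := by have := (abs_lt.1 ha).1; linarith
  have h4 : (4 - a ^ 2) ≠ 0 := by
    have : 4 - a ^ 2 = (2 - a) * (2 + a) := by ring
    rw [this]; exact mul_ne_zero hm hp
  have hμ : twistRate A B a = (6 * a * A * (2 - a) - 2 * (a + 1) * (a + 8) * B ^ 2)
      / ((2 - a) ^ 3 * (2 + a) ^ 2) := by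
    rw [twistRate, show 4 - a ^ 2 = (2 - a) * (2 + a) by ring]
    field_simp
  clear h4
  -- The coefficients solve the equations `e1`, `e2` below: the quadratic terms determine the x's,
  -- with x₁ = -x₀, after which the cubic terms are linear in the y's and μ. Only 2 - a and 2 + a
  -- have to be inverted, so a = 0 and a = -1 need not be excluded.
  set x₀ := B / (2 - a) with hx₀
  set x₂ := a * B / (2 - a) ^ 2 with hx₂
  set y₀ := B ^ 2 * (-21 + 3 * a + 24 * a ^ 2 + 9 * a ^ 3) / ((2 - a) ^ 3 * (2 + a) ^ 2)
    + A * (-5 + 6 * a + 5 * a ^ 2) / ((2 - a) ^ 2 * (2 + a) ^ 2) with hy₀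
  set y₂ := B ^ 2 * (-1 / 6 - 3 * a + 3 * a ^ 2 + 11 / 2 * a ^ 3 + 5 / 3 * a ^ 4)
      / ((2 - a) ^ 4 * (2 + a) ^ 2)
    + A * (-1 / 6 + 5 / 6 * a + 5 / 3 * a ^ 2 + 2 / 3 * a ^ 3) / ((2 - a) ^ 3 * (2 + a) ^ 2)
    with hy₂
  set y₃ := B ^ 2 * (-7 / 2 + 8 * a + 11 * a ^ 2 + 5 / 2 * a ^ 3) / ((2 - a) ^ 3 * (2 + a) ^ 3)
    + A * (-7 / 2 + a / 2 + 2 * a ^ 2 + a ^ 3) / ((2 - a) ^ 2 * (2 + a) ^ 3) with hy₃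
  set y₄ := B ^ 2 * (1 / 3 - a / 3 - 2 / 3 * a ^ 2 - a ^ 3 / 3) / ((2 - a) ^ 3 * (2 + a) ^ 2)
    + A * (1 / 3 - a ^ 2 / 3) / ((2 - a) ^ 2 * (2 + a) ^ 2) with hy₄
  obtain ⟨hΨ1, hΨ2⟩ := hasJet_fiveShears x₀ (-x₀) x₂ y₀ y₂ y₃ y₄
  refine ⟨fiveShears x₀ (-x₀) x₂ y₀ y₂ y₃ y₄, isSmoothArea_fiveShears .., ?_, ?_⟩
  · set J := fiveShearsJet x₀ (-x₀) x₂ y₀ y₂ y₃ y₄ with hJ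
    refine Ord.prodMk (f := fun z => (fiveShears x₀ (-x₀) x₂ y₀ y₂ y₃ y₄ z - z).1)
      (g := fun z => (fiveShears x₀ (-x₀) x₂ y₀ y₂ y₃ y₄ z - z).2) ?_ ?_
    · refine ((Ord.mono hΨ1 (by norm_num)).add
        (J.1.ord_quad.add (J.1.ord_cub.mono (by norm_num)))).congr fun z => ?_
      simp only [hJ, Jet.eval, Jet.lin, Prod.fst_sub, fiveShearsJet]
      ring
    · refine ((Ord.mono hΨ2 (by norm_num)).add
        (J.2.ord_quad.add (J.2.ord_cub.mono (by norm_num)))).congr fun z => ?_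
      simp only [hJ, Jet.eval, Jet.lin, Prod.snd_sub, fiveShearsJet]
      ring
  · intro f hf
    obtain ⟨hT1, hT2⟩ := hasJet_planarMap hf
    have hl1 := hΨ1.comp hT1 hT2
    have hl2 := hΨ2.comp hT1 hT2
    obtain ⟨hr1, hr2⟩ := hasJet_normalMap a (twistRate A B a) hΨ1 hΨ2
    have e1 : (fiveShearsJet x₀ (-x₀) x₂ y₀ y₂ y₃ y₄).1.comp Jet.p
        ⟨-1, a, 0, 0, -(a + 1) * B, 0, 0, 0, (a + 1) * B ^ 2 - a * A⟩ =
        (normalJet a (twistRate A B a) (fiveShearsJet x₀ (-x₀) x₂ y₀ y₂ y₃ y₄).1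
          (fiveShearsJet x₀ (-x₀) x₂ y₀ y₂ y₃ y₄).2).1 := by
      simp only [fiveShearsJet, Jet.comp, normalJet, Jet.p, Jet.add, Jet.smul, Jet.mul,
        Jet.mk.injEq, hμ, hx₀, hx₂, hy₀, hy₂, hy₃, hy₄]
      refine ⟨?_, ?_, ?_, ?_, ?_, ?_, ?_, ?_, ?_⟩ <;> field_simp <;> ring
    have e2 : (fiveShearsJet x₀ (-x₀) x₂ y₀ y₂ y₃ y₄).2.comp Jet.p
        ⟨-1, a, 0, 0, -(a + 1) * B, 0, 0, 0, (a + 1) * B ^ 2 - a * A⟩ =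
        (normalJet a (twistRate A B a) (fiveShearsJet x₀ (-x₀) x₂ y₀ y₂ y₃ y₄).1
          (fiveShearsJet x₀ (-x₀) x₂ y₀ y₂ y₃ y₄).2).2 := by
      simp only [fiveShearsJet, Jet.comp, normalJet, Jet.p, Jet.add, Jet.smul, Jet.mul,
        Jet.mk.injEq, hμ, hx₀, hx₂, hy₀, hy₂, hy₃, hy₄]
      refine ⟨?_, ?_, ?_, ?_, ?_, ?_, ?_, ?_, ?_⟩ <;> field_simp <;> ring
    rw [e1] at hl1
    rw [e2] at hl2
    refine Ord.congr (Ord.prodMk (Ord.sub hl1 hr1) (Ord.sub hl2 hr2)) fun z => ?_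
    ext <;> simp only [Prod.fst_sub, Prod.snd_sub] <;> ring

/-! ### The first twist coefficient -/

theorem Ord.of_differentiableAt {f : ℝ × ℝ → ℝ × ℝ} (hf : DifferentiableAt ℝ f 0)
    (h0 : f 0 = 0) : Ord 1 f := by
  have := hf.isBigO_sub
  simp only [h0, sub_zero] at this
  refine this.trans (Asymptotics.IsBigO.of_bound 1 (Eventually.of_forall fun z => ?_))
  simp

/-- The linear coordinates `q = m X`, `p = m (X cos Φ + Y sin Φ)`. -/
def ellipseChart (m Φ : ℝ) (hm : m ≠ 0) (hs : Real.sin Φ ≠ 0) : (ℝ × ℝ) ≃ₜ (ℝ × ℝ) where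
  toFun z := (m * z.1, m * (Real.cos Φ * z.1 + Real.sin Φ * z.2))
  invFun w := (m⁻¹ * w.1, m⁻¹ * (Real.sin Φ)⁻¹ * (w.2 - Real.cos Φ * w.1))
  left_inv z := by
    ext
    · simp only; field_simp
    · simp only; field_simp; ring
  right_inv z := by
    ext
    · simp only; field_simp
    · simp only; field_simp; ring
  continuous_toFun := by fun_prop
  continuous_invFun := by fun_prop

theorem ellipseChart_apply {m Φ : ℝ} (hm : m ≠ 0) (hs : Real.sin Φ ≠ 0) (z : ℝ × ℝ) :
    ellipseChart m Φ hm hs z = (m * z.1, m * (Real.cos Φ * z.1 + Real.sin Φ * z.2)) := rfl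

theorem ellipseChart_symm_apply {m Φ : ℝ} (hm : m ≠ 0) (hs : Real.sin Φ ≠ 0) (w : ℝ × ℝ) :
    (ellipseChart m Φ hm hs).symm w =
      (m⁻¹ * w.1, m⁻¹ * (Real.sin Φ)⁻¹ * (w.2 - Real.cos Φ * w.1)) := rfl

theorem isSmoothArea_ellipseChart_symm {m Φ : ℝ} (hm : m ≠ 0) (hs : Real.sin Φ ≠ 0) :
    IsSmoothArea (m ^ 2 * Real.sin Φ)⁻¹ (ellipseChart m Φ hm hs).symm where
  map_zero := by simp [ellipseChart_symm_apply]
  contDiff := by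
    change ContDiff ℝ ∞ fun w : ℝ × ℝ =>
      (m⁻¹ * w.1, m⁻¹ * (Real.sin Φ)⁻¹ * (w.2 - Real.cos Φ * w.1))
    fun_prop
  contDiff_symm := by
    change ContDiff ℝ ∞ fun z : ℝ × ℝ => (m * z.1, m * (Real.cos Φ * z.1 + Real.sin Φ * z.2))
    fun_prop
  det z := by
    have hf : HasFDerivAt (fun w : ℝ × ℝ => w.1) (ContinuousLinearMap.fst ℝ ℝ ℝ) z :=
      hasFDerivAt_fst
    have hg : HasFDerivAt (fun w : ℝ × ℝ => w.2) (ContinuousLinearMap.snd ℝ ℝ ℝ) z :=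
      hasFDerivAt_snd
    have h : HasFDerivAt (fun w : ℝ × ℝ =>
        (m⁻¹ * w.1, m⁻¹ * (Real.sin Φ)⁻¹ * (w.2 - Real.cos Φ * w.1))) _ z :=
      (hf.const_mul m⁻¹).prodMk
        ((hg.sub (hf.const_mul (Real.cos Φ))).const_mul (m⁻¹ * (Real.sin Φ)⁻¹))
    have h' : HasFDerivAt (ellipseChart m Φ hm hs).symm _ z := h
    rw [h'.fderiv, det_clm_prod]
    simp
    ring

/-- In the coordinates `ellipseChart` the normal form is a rotation by an angle that depends on
the radius, up to an error of fourth order. -/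
theorem ord_ellipseChart_normalMap {m Φ a μ τ ν₀ : ℝ} (hm : m ≠ 0) (hs : Real.sin Φ ≠ 0)
    (hΦ : Φ = 2 * Real.pi * ν₀) (ha : a = 2 * Real.cos Φ)
    (hτ : τ = μ * m ^ 2 * Real.sin Φ ^ 3 / Real.pi) :
    Ord 4 fun z => (ellipseChart m Φ hm hs).symm (normalMap a μ (ellipseChart m Φ hm hs z))
      - cwRot (2 * Real.pi * (ν₀ + τ * ((z.1 ^ 2 + z.2 ^ 2) / 2))) z := by
  set c := Real.cos Φ with hc
  set s := Real.sin Φ with hsd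
  have hcs : c ^ 2 + s ^ 2 = 1 := by rw [hc, hsd]; exact Real.cos_sq_add_sin_sq Φ
  set t : ℝ × ℝ → ℝ := fun z => μ * m ^ 2 * s ^ 3 * (z.1 ^ 2 + z.2 ^ 2) with ht
  have hang : ∀ z : ℝ × ℝ, 2 * Real.pi * (ν₀ + τ * ((z.1 ^ 2 + z.2 ^ 2) / 2)) = Φ + t z := by
    intro z
    have := Real.pi_ne_zero
    rw [hτ, hΦ, ht]
    field_simp
  have ht2 : Ord 2 t := (((Ord.fst.pow 2).add (Ord.snd.pow 2)).const_mul _)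
  have ht0 : Tendsto t (𝓝 0) (𝓝 0) := ht2.tendsto (by norm_num)
  -- Crude quadratic bounds for 1 - cos and t - sin suffice, because the angle t itself vanishes to
  -- second order.
  have hcos : Ord 4 fun z => 1 - Real.cos (t z) := by
    have h : (fun x : ℝ => 1 - Real.cos x) =O[𝓝 0] fun x => x ^ 2 := by
      refine Asymptotics.IsBigO.of_bound 1 (Eventually.of_forall fun x => ?_)
      have h1 := Real.one_sub_sq_div_two_le_cos (x := x)
      have h2 := Real.cos_le_one x
      rw [Real.norm_eq_abs, Real.norm_eq_abs, abs_of_nonneg (by linarith),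
        abs_of_nonneg (by positivity)]
      nlinarith [sq_nonneg x]
    exact (h.comp_tendsto ht0).trans (ht2.pow 2)
  have hsin : Ord 4 fun z => t z - Real.sin (t z) := by
    have h : (fun x : ℝ => x - Real.sin x) =O[𝓝 0] fun x => x ^ 2 := by
      refine Asymptotics.IsBigO.of_bound 1 ?_
      filter_upwards [Metric.ball_mem_nhds (0 : ℝ) one_pos] with x hx
      rw [mem_ball_zero_iff, Real.norm_eq_abs] at hx
      have h1 := Real.sin_bound hx.le
      have h2 : |x| ^ 3 ≤ |x| ^ 2 := pow_le_pow_of_le_one (abs_nonneg x) hx.le (by norm_num)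
      have h3 : |x| ^ 5 ≤ |x| ^ 2 := pow_le_pow_of_le_one (abs_nonneg x) hx.le (by norm_num)
      rw [Real.norm_eq_abs, Real.norm_eq_abs, one_mul, abs_pow]
      have h4 : |x - Real.sin x| ≤ |Real.sin x - (x - x ^ 3 / 6)| + |x| ^ 3 / 6 := by
        have : x - Real.sin x = -(Real.sin x - (x - x ^ 3 / 6)) + x ^ 3 / 6 := by ring
        rw [this]
        refine (abs_add_le _ _).trans (le_of_eq ?_)
        rw [abs_neg, abs_div, abs_pow, abs_of_pos (by norm_num : (0 : ℝ) < 6)]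
      have h5 : 0 ≤ |x| ^ 2 := by positivity
      linarith
    exact (h.comp_tendsto ht0).trans (ht2.pow 2)
  have hX := Ord.fst
  have hY := Ord.snd
  have e1 : Ord 1 fun z : ℝ × ℝ => c * z.1 + s * z.2 := (hX.const_mul c).add (hY.const_mul s)
  have e2 : Ord 1 fun z : ℝ × ℝ => c * z.2 - s * z.1 := (hY.const_mul c).sub (hX.const_mul s)
  have r1 : Ord 4 fun z : ℝ × ℝ => (1 - Real.cos (t z)) * (c * z.1 + s * z.2)
      + (t z - Real.sin (t z)) * (c * z.2 - s * z.1) :=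
    ((hcos.mul e1).mono (by norm_num)).add ((hsin.mul e2).mono (by norm_num))
  have r2 : Ord 4 fun z : ℝ × ℝ => (1 - Real.cos (t z)) * (c * z.2 - s * z.1)
      - (t z - Real.sin (t z)) * (c * z.1 + s * z.2) :=
    ((hcos.mul e2).mono (by norm_num)).sub ((hsin.mul e1).mono (by norm_num))
  refine (r1.prodMk r2).congr fun z => ?_
  rw [hang z, cwRot, Real.cos_add, Real.sin_add, ← hc, ← hsd]
  have hK : quadInv a (ellipseChart m Φ hm hs z) = m ^ 2 * s ^ 2 * (z.1 ^ 2 + z.2 ^ 2) := by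
    simp only [quadInv, ellipseChart_apply, ha, ← hc, ← hsd]
    linear_combination - m ^ 2 * z.1 ^ 2 * hcs
  -- In the chart `linMap a` is the rotation R by Φ, and R² - cos Φ R is sin Φ times R followed by a
  -- quarter turn. The normal form is thus R plus t times its quarter turn, the first order
  -- expansion of the rotation by Φ + t.
  have hN : normalMap a μ (ellipseChart m Φ hm hs z) =
      (m * ((c * z.1 + s * z.2) + t z * (c * z.2 - s * z.1)),
        m * (c * ((c * z.1 + s * z.2) + t z * (c * z.2 - s * z.1))
          + s * ((c * z.2 - s * z.1) - t z * (c * z.1 + s * z.2)))) := by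
    have hs2 : s ^ 2 = 1 - c ^ 2 := by linarith
    have hμ : μ * quadInv a (ellipseChart m Φ hm hs z) * s = t z := by rw [hK]; simp only [ht]; ring
    simp only [normalMap]
    set κ := μ * quadInv a (ellipseChart m Φ hm hs z) with hκ
    rw [← hμ]
    ext
    · simp only [linMap, ellipseChart_apply, ha, ← hc, ← hsd, Prod.fst_add, Prod.smul_fst,
        Prod.fst_sub, smul_eq_mul]
      linear_combination (m * κ * z.1) * hcs
    · simp only [linMap, ellipseChart_apply, ha, ← hc, ← hsd, Prod.snd_add, Prod.smul_snd,
        Prod.snd_sub, smul_eq_mul]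
      linear_combination (m * z.1 + 2 * m * κ * c * z.1 + m * κ * s * z.2) * hcs
  rw [hN, ellipseChart_symm_apply, ← hc, ← hsd]
  ext
  · simp only [Prod.fst_sub]
    field_simp
    ring
  · simp only [Prod.snd_sub]
    field_simp
    ring

/-- Twist coefficient of a map that is smoothly conjugate to `planarMap f`. -/
theorem hasTwist_of_conj {A B a Φ ν₀ m τ : ℝ} {f : ℝ → ℝ} {T : ℝ × ℝ → ℝ × ℝ}
    {G : (ℝ × ℝ) ≃ₜ (ℝ × ℝ)} (hm : m ≠ 0) (hs : Real.sin Φ ≠ 0) (hΦ : Φ = 2 * Real.pi * ν₀)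
    (ha : a = 2 * Real.cos Φ) (hf : MatchesForce A B a f)
    (hG : IsSmoothArea (m ^ 2 * Real.sin Φ) G) (hT : ∀ z, G (T z) = planarMap f (G z))
    (hτ : τ = twistRate A B a * m ^ 2 * Real.sin Φ ^ 3 / Real.pi) : HasTwist T ν₀ τ := by
  have ha2 : |a| < 2 := by
    have h1 := Real.cos_sq_add_sin_sq Φ
    have h2 : 0 < Real.sin Φ ^ 2 := by positivity
    exact abs_lt.2 ⟨by nlinarith, by nlinarith⟩
  obtain ⟨Ψ, hΨ, -, hΨN⟩ := exists_normalForm A B ha2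
  have hΨN := hΨN f hf
  set Λ := ellipseChart m Φ hm hs with hΛ
  -- The Jacobians are m² sin Φ, 1 and (m² sin Φ)⁻¹.
  have hC := (hG.trans hΨ).trans (isSmoothArea_ellipseChart_symm hm hs)
  rw [mul_one, mul_inv_cancel₀ (mul_ne_zero (pow_ne_zero 2 hm) hs), ← hΛ] at hC
  set C := (G.trans Ψ).trans Λ.symm with hCdef
  refine ⟨C.toOpenPartialHomeomorph, mem_univ _, hC.map_zero, hC.contDiff.contDiffOn,
    hC.contDiff_symm.contDiffOn, fun z _ => hC.det z, ?_⟩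
  change Ord 4 fun z => C (T (C.symm z)) -
    cwRot (2 * Real.pi * (ν₀ + τ * ((z.1 ^ 2 + z.2 ^ 2) / 2))) z
  have hy : Ord 1 fun z => Ψ.symm (Λ z) := by
    refine Ord.of_differentiableAt ?_ ?_
    · exact ((hΨ.contDiff_symm.comp
        (isSmoothArea_ellipseChart_symm hm hs).contDiff_symm).differentiable (by simp)) 0
    · have h1 : Λ 0 = 0 := by simp [hΛ, ellipseChart_apply]
      have h2 : Ψ.symm 0 = 0 := by rw [Homeomorph.symm_apply_eq, hΨ.map_zero]
      rw [h1, h2]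
  have h1 := hΨN.comp hy
  have h2 := ord_ellipseChart_normalMap hm hs hΦ ha hτ
  have h3 : Ord 4 fun z => Λ.symm (Ψ (planarMap f (Ψ.symm (Λ z)))
      - normalMap a (twistRate A B a) (Ψ (Ψ.symm (Λ z)))) :=
    ((h1.fst_comp).const_mul _).prodMk
      (((h1.snd_comp).sub (h1.fst_comp.const_mul _)).const_mul _)
  refine (h3.add h2).congr fun z => ?_
  have e1 : C (T (C.symm z)) = Λ.symm (Ψ (planarMap f (Ψ.symm (Λ z)))) := by
    simp [hCdef, hT]
  rw [e1, Homeomorph.apply_symm_apply, ← hΛ]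
  ext <;> simp only [hΛ, ellipseChart_symm_apply, Prod.fst_add, Prod.snd_add, Prod.fst_sub,
    Prod.snd_sub] <;> ring

/-! ### Angles -/

/-- The point `(q, p)` of the plane as the complex number `q + i p`. -/
def toC (z : ℝ × ℝ) : ℂ := ⟨z.1, z.2⟩

theorem toC_eq_zero {z : ℝ × ℝ} : toC z = 0 ↔ z = 0 := by
  rw [Complex.ext_iff, Prod.ext_iff]
  rfl

theorem norm_toC_le (z : ℝ × ℝ) : ‖toC z‖ ≤ 2 * ‖z‖ := by
  have h := Complex.norm_le_abs_re_add_abs_im (toC z)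
  have h1 : |(toC z).re| ≤ ‖z‖ := norm_fst_le z
  have h2 : |(toC z).im| ≤ ‖z‖ := norm_snd_le z
  linarith

theorem norm_le_norm_toC (z : ℝ × ℝ) : ‖z‖ ≤ ‖toC z‖ :=
  max_le (Complex.abs_re_le_norm (toC z)) (Complex.abs_im_le_norm (toC z))

theorem continuous_toC : Continuous toC :=
  Complex.equivRealProdCLM.symm.continuous

/-- The argument of a quotient is the difference of the arguments modulo 2π, and `toIcoMod` changes
nothing modulo 2π. -/
theorem angleStep_coe {z w : ℝ × ℝ} (hz : z ≠ 0) (hw : w ≠ 0) :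
    (angleStep z w : Real.Angle) = (-(toC w / toC z).arg : ℝ) := by
  have h1 : (angleStep z w : Real.Angle) = ((toC z).arg - (toC w).arg : ℝ) := by
    rw [angleStep, toIcoMod]
    rw [Real.Angle.angle_eq_iff_two_pi_dvd_sub]
    refine ⟨-toIcoDiv Real.two_pi_pos 0 (Complex.arg ⟨z.1, z.2⟩ - Complex.arg ⟨w.1, w.2⟩), ?_⟩
    simp only [toC, zsmul_eq_mul, Int.cast_neg]
    ring
  rw [h1, Real.Angle.coe_neg,
    Complex.arg_div_coe_angle (mt toC_eq_zero.1 hw) (mt toC_eq_zero.1 hz), Real.Angle.coe_sub]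
  abel

theorem angleStep_mem (z w : ℝ × ℝ) : angleStep z w ∈ Ico 0 (2 * Real.pi) := by
  have := toIcoMod_mem_Ico Real.two_pi_pos 0
    (Complex.arg ⟨z.1, z.2⟩ - Complex.arg ⟨w.1, w.2⟩)
  rwa [zero_add] at this

theorem eq_of_angle_eq {x y : ℝ} (h : (x : Real.Angle) = y) (h1 : |x - y| < 2 * Real.pi) :
    x = y := by
  obtain ⟨k, hk⟩ := Real.Angle.angle_eq_iff_two_pi_dvd_sub.1 h
  have hk0 : k = 0 := by
    by_contra hne
    have h2 : (1 : ℝ) ≤ |(k : ℝ)| := by exact_mod_cast Int.one_le_abs hne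
    rw [hk, abs_mul, abs_of_pos Real.two_pi_pos] at h1
    nlinarith [Real.two_pi_pos]
  rw [hk0] at hk
  simp at hk
  linarith

theorem ne_zero_of_im_div {z w : ℝ × ℝ} (h : (toC w / toC z).im ≠ 0) : z ≠ 0 ∧ w ≠ 0 := by
  constructor
  · rintro rfl
    exact h (by rw [show toC 0 = 0 from toC_eq_zero.2 rfl, div_zero, Complex.zero_im])
  · rintro rfl
    exact h (by rw [show toC 0 = 0 from toC_eq_zero.2 rfl, zero_div, Complex.zero_im])

/-- Here the principal argument lies in (-π, 0), so its negative is already the representative in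
[0, 2π). On the other side of the real axis 2π has to be added. -/
theorem angleStep_of_im_neg {z w : ℝ × ℝ} (h : (toC w / toC z).im < 0) :
    angleStep z w = -(toC w / toC z).arg := by
  obtain ⟨hz, hw⟩ := ne_zero_of_im_div h.ne
  refine eq_of_angle_eq (angleStep_coe hz hw) ?_
  have h1 := angleStep_mem z w
  have h2 := Complex.arg_neg_iff.2 h
  have h3 := Complex.neg_pi_lt_arg (toC w / toC z)
  rw [abs_lt]
  constructor <;> linarith [h1.1, h1.2]

theorem angleStep_of_im_pos {z w : ℝ × ℝ} (h : 0 < (toC w / toC z).im) :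
    angleStep z w = 2 * Real.pi - (toC w / toC z).arg := by
  obtain ⟨hz, hw⟩ := ne_zero_of_im_div h.ne'
  have h2 : 0 < (toC w / toC z).arg := by
    refine lt_of_le_of_ne (Complex.arg_nonneg_iff.2 h.le) fun h0 => ?_
    exact h.ne' (Complex.arg_eq_zero_iff.1 h0.symm).2
  refine eq_of_angle_eq ?_ ?_
  · rw [angleStep_coe hz hw, Real.Angle.coe_sub, Real.Angle.coe_two_pi, zero_sub,
      Real.Angle.coe_neg]
  have h1 := angleStep_mem z w
  have h3 := Complex.arg_le_pi (toC w / toC z)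
  rw [abs_lt]
  constructor <;> linarith [h1.1, h1.2]

/-- If `w`, `w'` stay in a half plane turning with `z`, `z'`, the angles from `z` to `z'` and from
`w` to `w'` differ by a coboundary. -/
theorem arg_div_sub_arg_div {z z' w w' α : ℂ}
    (h : 0 < (w * starRingEnd ℂ (α * z)).re) (h' : 0 < (w' * starRingEnd ℂ (α * z')).re)
    (hs : ((z' / z).im < 0 ∧ (w' / w).im < 0) ∨ (0 < (z' / z).im ∧ 0 < (w' / w).im)) :
    (w' / w).arg - (z' / z).arg =
      (w' * starRingEnd ℂ (α * z')).arg - (w * starRingEnd ℂ (α * z)).arg := by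
  have aux : ∀ {u v : ℂ}, 0 < (u * starRingEnd ℂ (α * v)).re → u ≠ 0 ∧ α ≠ 0 ∧ v ≠ 0 := by
    intro u v huv
    refine ⟨?_, ?_, ?_⟩ <;> (rintro rfl; simp at huv)
  obtain ⟨hw, hα, hz⟩ := aux h
  obtain ⟨hw', -, hz'⟩ := aux h'
  have hc : ∀ {v : ℂ}, v ≠ 0 → starRingEnd ℂ (α * v) ≠ 0 := fun hv =>
    (map_ne_zero _).2 (mul_ne_zero hα hv)
  -- Modulo 2π the argument of α cancels. As real numbers, the right side is below π in absolute
  -- value by the half plane conditions, and the left side is at most π because its two arguments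
  -- lie in the same half circle.
  refine eq_of_angle_eq ?_ ?_
  · rw [Real.Angle.coe_sub, Real.Angle.coe_sub, Complex.arg_div_coe_angle hw' hw,
      Complex.arg_div_coe_angle hz' hz, Complex.arg_mul_coe_angle hw' (hc hz'),
      Complex.arg_mul_coe_angle hw (hc hz), Complex.arg_conj_coe_angle,
      Complex.arg_conj_coe_angle, Complex.arg_mul_coe_angle hα hz,
      Complex.arg_mul_coe_angle hα hz']
    abel
  · have h1 := abs_lt.1 (Complex.abs_arg_lt_pi_div_two_iff.2 (Or.inl h))
    have h2 := abs_lt.1 (Complex.abs_arg_lt_pi_div_two_iff.2 (Or.inl h'))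
    have h3 := Complex.neg_pi_lt_arg (z' / z)
    have h4 := Complex.neg_pi_lt_arg (w' / w)
    have h5 := Complex.arg_le_pi (z' / z)
    have h6 := Complex.arg_le_pi (w' / w)
    rw [abs_lt]
    rcases hs with ⟨hs1, hs2⟩ | ⟨hs1, hs2⟩
    · have h7 := Complex.arg_neg_iff.2 hs1
      have h8 := Complex.arg_neg_iff.2 hs2
      constructor <;> linarith
    · have h7 := Complex.arg_nonneg_iff.2 hs1.le
      have h8 := Complex.arg_nonneg_iff.2 hs2.le
      constructor <;> linarith

/-- The coboundary telescopes to two angles below π/2 in absolute value, whatever N is. After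
division by N the mean turning is therefore the same for both sequences: this makes rotation numbers
independent of the chart. -/
theorem abs_sum_arg_div_sub_le {z w : ℕ → ℂ} {α : ℂ}
    (h : ∀ j, 0 < (w j * starRingEnd ℂ (α * z j)).re)
    (hs : ∀ j, ((z (j + 1) / z j).im < 0 ∧ (w (j + 1) / w j).im < 0) ∨
      (0 < (z (j + 1) / z j).im ∧ 0 < (w (j + 1) / w j).im)) (N : ℕ) :
    |∑ j ∈ Finset.range N, (w (j + 1) / w j).arg
      - ∑ j ∈ Finset.range N, (z (j + 1) / z j).arg| ≤ Real.pi := by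
  rw [← Finset.sum_sub_distrib,
    Finset.sum_congr rfl fun j _ => arg_div_sub_arg_div (h j) (h (j + 1)) (hs j),
    Finset.sum_range_sub fun j => (w j * starRingEnd ℂ (α * z j)).arg]
  have h1 := abs_lt.1 (Complex.abs_arg_lt_pi_div_two_iff.2 (Or.inl (h N)))
  have h2 := abs_lt.1 (Complex.abs_arg_lt_pi_div_two_iff.2 (Or.inl (h 0)))
  rw [abs_le]
  constructor <;> linarith

/-- A map that is tangent at the origin to a linear map of positive determinant does not turn
points by more than a right angle, up to a fixed rotation. -/
theorem exists_half_plane {V : ℝ × ℝ → ℝ × ℝ} {u δ : ℝ} (hδ : 0 < δ)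
    (hV : (fun z => V z - (z.1, u * z.1 + δ * z.2)) =o[𝓝 0] fun z => z) :
    ∃ α : ℂ, ∀ᶠ z in 𝓝 (0 : ℝ × ℝ), z ≠ 0 →
      0 < (toC (V z) * starRingEnd ℂ (α * toC z)).re := by
  -- α is twice the complex-linear part of (q, p) ↦ (q, u q + δ p). For a positive determinant it
  -- dominates the antilinear part, which keeps the image of z within a right angle of α z.
  set α : ℂ := ⟨1 + δ, u⟩ with hα
  have hαpos : 0 < ‖α‖ := norm_pos_iff.2 fun h => by
    have := congrArg Complex.re h
    simp [hα] at this
    linarith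
  refine ⟨α, ?_⟩
  filter_upwards [hV.def (show 0 < δ / (8 * ‖α‖) by positivity)] with z hz hz0
  set e := V z - (z.1, u * z.1 + δ * z.2) with he
  have hVz : toC (V z) = toC (z.1, u * z.1 + δ * z.2) + toC e := by
    apply Complex.ext <;> simp [toC, he]
  have h1 : (toC (z.1, u * z.1 + δ * z.2) * starRingEnd ℂ (α * toC z)).re =
      (1 + δ) * z.1 ^ 2 + (u * z.1 + δ * z.2) ^ 2 + δ * z.2 ^ 2 := by
    simp [toC, hα]
    ring
  have h2 : |(toC e * starRingEnd ℂ (α * toC z)).re| ≤ δ / 2 * ‖z‖ ^ 2 := by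
    refine (Complex.abs_re_le_norm _).trans ?_
    rw [norm_mul, RCLike.norm_conj, norm_mul]
    have h3 : ‖toC e‖ ≤ 2 * (δ / (8 * ‖α‖) * ‖z‖) :=
      (norm_toC_le e).trans (by gcongr)
    calc ‖toC e‖ * (‖α‖ * ‖toC z‖) ≤ (2 * (δ / (8 * ‖α‖) * ‖z‖)) * (‖α‖ * (2 * ‖z‖)) := by
          gcongr
          exact norm_toC_le z
      _ = δ / 2 * ‖z‖ ^ 2 := by field_simp; ring
  have h4 : ‖z‖ ^ 2 ≤ z.1 ^ 2 + z.2 ^ 2 := by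
    rcases max_cases ‖z.1‖ ‖z.2‖ with ⟨h, -⟩ | ⟨h, -⟩
    · rw [Prod.norm_def, h, Real.norm_eq_abs, sq_abs]; nlinarith [sq_nonneg z.2]
    · rw [Prod.norm_def, h, Real.norm_eq_abs, sq_abs]; nlinarith [sq_nonneg z.1]
  have h5 : 0 < ‖z‖ := norm_pos_iff.2 hz0
  rw [hVz, add_mul, Complex.add_re, h1]
  have h6 := (abs_le.1 h2).1
  have h7 : 0 < δ * ‖z‖ ^ 2 := by positivity
  nlinarith [sq_nonneg z.1, sq_nonneg (u * z.1 + δ * z.2)]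

/-! ### The level curves of the McMillan invariant near the origin -/

theorem norm_sq_le (z : ℝ × ℝ) : ‖z‖ ^ 2 ≤ z.1 ^ 2 + z.2 ^ 2 := by
  rcases max_cases ‖z.1‖ ‖z.2‖ with ⟨h, -⟩ | ⟨h, -⟩
  · rw [Prod.norm_def, h, Real.norm_eq_abs, sq_abs]; nlinarith [sq_nonneg z.2]
  · rw [Prod.norm_def, h, Real.norm_eq_abs, sq_abs]; nlinarith [sq_nonneg z.1]

/-- A lower bound for `quadInv a` on the unit circle. -/
def ellipticity (a : ℝ) : ℝ := 1 - |a| / 2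

theorem ellipticity_pos {a : ℝ} (ha : |a| < 2) : 0 < ellipticity a := by
  unfold ellipticity; linarith

theorem le_quadInv {a : ℝ} (ha : |a| < 2) (z : ℝ × ℝ) :
    ellipticity a * ‖z‖ ^ 2 ≤ quadInv a z := by
  have h1 := mul_le_mul_of_nonneg_left (norm_sq_le z) (ellipticity_pos ha).le
  refine h1.trans ?_
  unfold ellipticity quadInv
  have h2 : a * (z.2 * z.1) ≤ |a| * |z.2 * z.1| := by
    rw [← abs_mul]; exact le_abs_self _
  have h3 : |z.2 * z.1| ≤ (z.1 ^ 2 + z.2 ^ 2) / 2 := by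
    rw [abs_le]; constructor <;> nlinarith [sq_nonneg (z.1 + z.2), sq_nonneg (z.1 - z.2)]
  have h4 := mul_le_mul_of_nonneg_left h3 (abs_nonneg a)
  nlinarith

/-- The cubic part of the invariant. -/
def cubInv (B : ℝ) (z : ℝ × ℝ) : ℝ := B * (z.2 ^ 2 * z.1 + z.2 * z.1 ^ 2)

/-- The quartic part of the invariant. -/
def quartInv (A : ℝ) (z : ℝ × ℝ) : ℝ := A * (z.2 ^ 2 * z.1 ^ 2)

theorem mcmInvariant_eq (A B a : ℝ) (z : ℝ × ℝ) :
    mcmInvariant A B a z = quadInv a z + cubInv B z + quartInv A z := by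
  simp [mcmInvariant, quadInv, cubInv, quartInv]; ring

theorem mcmInvariant_smul (A B a t : ℝ) (z : ℝ × ℝ) :
    mcmInvariant A B a (t • z) = t ^ 2 * quadInv a z + t ^ 3 * cubInv B z
      + t ^ 4 * quartInv A z := by
  simp [mcmInvariant, quadInv, cubInv, quartInv]; ring

theorem abs_cubInv_le (B : ℝ) (z : ℝ × ℝ) : |cubInv B z| ≤ 2 * |B| * ‖z‖ ^ 3 := by
  have h1 : |z.1| ≤ ‖z‖ := norm_fst_le z
  have h2 : |z.2| ≤ ‖z‖ := norm_snd_le z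
  rw [cubInv, abs_mul]
  have h3 : |z.2 ^ 2 * z.1 + z.2 * z.1 ^ 2| ≤ 2 * ‖z‖ ^ 3 := by
    refine (abs_add_le _ _).trans ?_
    rw [abs_mul, abs_mul, abs_pow, abs_pow]
    have e1 : |z.2| ^ 2 * |z.1| ≤ ‖z‖ ^ 2 * ‖z‖ := by gcongr
    have e2 : |z.2| * |z.1| ^ 2 ≤ ‖z‖ * ‖z‖ ^ 2 := by gcongr
    nlinarith
  nlinarith [mul_le_mul_of_nonneg_left h3 (abs_nonneg B)]

theorem abs_quartInv_le (A : ℝ) (z : ℝ × ℝ) : |quartInv A z| ≤ |A| * ‖z‖ ^ 4 := by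
  have h1 : |z.1| ≤ ‖z‖ := norm_fst_le z
  have h2 : |z.2| ≤ ‖z‖ := norm_snd_le z
  rw [quartInv, abs_mul]
  gcongr
  rw [abs_mul, abs_pow, abs_pow]
  calc |z.2| ^ 2 * |z.1| ^ 2 ≤ ‖z‖ ^ 2 * ‖z‖ ^ 2 := by gcongr
    _ = ‖z‖ ^ 4 := by ring

theorem continuous_mcmInvariant (A B a : ℝ) : Continuous (mcmInvariant A B a) := by
  unfold mcmInvariant; fun_prop

theorem mcmInvariant_zero (A B a : ℝ) : mcmInvariant A B a 0 = 0 := by simp [mcmInvariant]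

/-- In the disc of radius `r` the McMillan invariant is close to its quadratic part and the
McMillan force has no pole, and the level curves of energy up to `h₀` are far from the boundary
of the disc. -/
structure IsAdapted (A B a r h₀ : ℝ) : Prop where
  abs_lt_two : |a| < 2
  r_pos : 0 < r
  r_le_one : r ≤ 1
  denom : ∀ p, |p| < r → 0 < A * p ^ 2 + B * p + 1
  small : 2 * |B| * r + |A| * r ^ 2 ≤ ellipticity a / 4
  h_pos : 0 < h₀
  h_lt : 2 * h₀ < ellipticity a * r ^ 2
  maps : ∀ z : ℝ × ℝ, ellipticity a * ‖z‖ ^ 2 ≤ 2 * h₀ →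
    ‖planarMap (mcmForce A B a) z‖ < r

theorem IsAdapted.mono {A B a r h₀ h₁ : ℝ} (H : IsAdapted A B a r h₀) (h1 : 0 < h₁)
    (h2 : h₁ ≤ h₀) : IsAdapted A B a r h₁ where
  abs_lt_two := H.abs_lt_two
  r_pos := H.r_pos
  r_le_one := H.r_le_one
  denom := H.denom
  small := H.small
  h_pos := h1
  h_lt := lt_of_le_of_lt (by linarith) H.h_lt
  maps z hz := H.maps z (by linarith)

theorem continuousAt_mcmForce {A B : ℝ} (a : ℝ) {p : ℝ} (hp : A * p ^ 2 + B * p + 1 ≠ 0) :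
    ContinuousAt (mcmForce A B a) p := by
  unfold mcmForce
  exact ContinuousAt.div (by fun_prop) (by fun_prop) hp

theorem continuousAt_planarMap {A B : ℝ} (a : ℝ) {z : ℝ × ℝ}
    (hp : A * z.2 ^ 2 + B * z.2 + 1 ≠ 0) : ContinuousAt (planarMap (mcmForce A B a)) z := by
  have h1 : ContinuousAt (fun w : ℝ × ℝ => mcmForce A B a w.2) z :=
    ContinuousAt.comp (f := fun w : ℝ × ℝ => w.2) (continuousAt_mcmForce a hp) continuousAt_snd
  exact continuousAt_snd.prodMk (continuousAt_fst.neg.add h1)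

theorem mcmForce_zero (A B a : ℝ) : mcmForce A B a 0 = 0 := by simp [mcmForce]

theorem planarMap_zero {f : ℝ → ℝ} (hf : f 0 = 0) : planarMap f 0 = 0 := by
  simp [planarMap, hf]

theorem exists_isAdapted (A B : ℝ) {a ρ : ℝ} (ha : |a| < 2) (hρ : 0 < ρ) :
    ∃ r ≤ ρ, ∃ h₀, IsAdapted A B a r h₀ := by
  have hc := ellipticity_pos ha
  have e1 : ∀ᶠ x in 𝓝 (0 : ℝ), 0 < A * x ^ 2 + B * x + 1 := by
    have : ContinuousAt (fun x : ℝ => A * x ^ 2 + B * x + 1) 0 := by fun_prop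
    exact this.eventually (lt_mem_nhds (by norm_num))
  obtain ⟨d, hd, hd'⟩ := Metric.eventually_nhds_iff_ball.1 e1
  have e2 : ∀ᶠ x in 𝓝[>] (0 : ℝ), 2 * |B| * x + |A| * x ^ 2 < ellipticity a / 4 ∧ x < min d (min ρ 1) ∧
      0 < x := by
    have h1 : ∀ᶠ x in 𝓝 (0 : ℝ), 2 * |B| * x + |A| * x ^ 2 < ellipticity a / 4 := by
      have : ContinuousAt (fun x : ℝ => 2 * |B| * x + |A| * x ^ 2) 0 := by fun_prop
      refine this.eventually (gt_mem_nhds ?_)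
      simp [hc]
    have h2 : ∀ᶠ x in 𝓝 (0 : ℝ), x < min d (min ρ 1) := gt_mem_nhds (by positivity)
    filter_upwards [h1.filter_mono nhdsWithin_le_nhds, h2.filter_mono nhdsWithin_le_nhds,
      self_mem_nhdsWithin] with x h3 h4 h5
    exact ⟨h3, h4, h5⟩
  obtain ⟨r, hr1, hr2, hr3⟩ := e2.exists
  have hrd : r < d := hr2.trans_le (min_le_left _ _)
  have hrρ : r < ρ := hr2.trans_le ((min_le_right _ _).trans (min_le_left _ _))
  have hr1' : r < 1 := hr2.trans_le ((min_le_right _ _).trans (min_le_right _ _))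
  have e3 : ∀ᶠ z in 𝓝 (0 : ℝ × ℝ), ‖planarMap (mcmForce A B a) z‖ < r := by
    have h1 : ContinuousAt (planarMap (mcmForce A B a)) 0 :=
      continuousAt_planarMap a (by simp)
    refine h1.norm.eventually (gt_mem_nhds ?_)
    simpa only [planarMap_zero (mcmForce_zero A B a), norm_zero] using hr3
  obtain ⟨η, hη, hη'⟩ := Metric.eventually_nhds_iff_ball.1 e3
  -- With h₀ = `ellipticity a` · m² / 4 the points in question have norm below m: below r gives
  -- `h_lt`, below η gives `maps`.
  set m := min r η with hm
  have hmpos : 0 < m := lt_min hr3 hη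
  have hsq : m ^ 2 ≤ r ^ 2 := pow_le_pow_left₀ hmpos.le (min_le_left _ _) 2
  refine ⟨r, hrρ.le, ellipticity a * m ^ 2 / 4, ha, hr3, hr1'.le, fun p hp => hd' p ?_, hr1.le,
    by positivity, ?_, fun z hz => hη' z ?_⟩
  · rw [mem_ball_zero_iff, Real.norm_eq_abs]; exact hp.trans hrd
  · have := mul_le_mul_of_nonneg_left hsq hc.le
    have h3 : 0 < ellipticity a * m ^ 2 := by positivity
    linarith
  · rw [mem_ball_zero_iff]
    have h1 : ellipticity a * ‖z‖ ^ 2 < ellipticity a * m ^ 2 := by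
      have h3 : 0 < ellipticity a * m ^ 2 := by positivity
      linarith
    have h2 := lt_of_pow_lt_pow_left₀ 2 hmpos.le (lt_of_mul_lt_mul_left h1 hc.le)
    exact h2.trans_le (min_le_right _ _)

namespace IsAdapted

variable {A B a r h₀ h : ℝ} {z : ℝ × ℝ}

theorem c_pos (H : IsAdapted A B a r h₀) : 0 < ellipticity a := ellipticity_pos H.abs_lt_two

theorem abs_parts_le (H : IsAdapted A B a r h₀) (hz : ‖z‖ ≤ r) :
    |cubInv B z| + |quartInv A z| ≤ ellipticity a / 4 * ‖z‖ ^ 2 := by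
  have h1 := abs_cubInv_le B z
  have h2 := abs_quartInv_le A z
  have h3 : 2 * |B| * ‖z‖ + |A| * ‖z‖ ^ 2 ≤ 2 * |B| * r + |A| * r ^ 2 := by gcongr
  have h4 := mul_le_mul_of_nonneg_right (h3.trans H.small) (sq_nonneg ‖z‖)
  nlinarith

theorem le_mcmInvariant (H : IsAdapted A B a r h₀) (hz : ‖z‖ ≤ r) :
    ellipticity a / 2 * ‖z‖ ^ 2 ≤ mcmInvariant A B a z := by
  have h1 := H.abs_parts_le hz
  have h2 := le_quadInv H.abs_lt_two z
  rw [mcmInvariant_eq]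
  have h3 := neg_abs_le (cubInv B z)
  have h4 := neg_abs_le (quartInv A z)
  have h5 : 0 ≤ ellipticity a * ‖z‖ ^ 2 := mul_nonneg H.c_pos.le (sq_nonneg _)
  linarith

/-- On a ray the invariant is t² Q + t³ X + t⁴ Y. Both 1 - t³ and 1 - t⁴ are at most 2 (1 - t²), and
2 |X| + 2 |Y| < Q in the disc, so the quadratic part decides. -/
theorem star (H : IsAdapted A B a r h₀) (hz : ‖z‖ ≤ r) (hz0 : z ≠ 0) {t : ℝ} (ht : 0 ≤ t)
    (ht1 : t < 1) : mcmInvariant A B a (t • z) < mcmInvariant A B a z := by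
  have h1 := H.abs_parts_le hz
  have h2 := le_quadInv H.abs_lt_two z
  have h5 : 0 < ellipticity a * ‖z‖ ^ 2 :=
    mul_pos H.c_pos (pow_pos (norm_pos_iff.2 hz0) 2)
  rw [mcmInvariant_smul, mcmInvariant_eq]
  set X := cubInv B z
  set Y := quartInv A z
  have e2 : (t ^ 3 - 1) * X ≤ (1 - t ^ 2) * (2 * |X|) := by
    have h6 : (t ^ 3 - 1) * X ≤ (1 - t ^ 3) * |X| := by
      have h7 : t ^ 3 ≤ 1 := pow_le_one₀ ht ht1.le
      nlinarith [neg_abs_le X]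
    have h8 : 1 - t ^ 3 ≤ (1 - t ^ 2) * 2 := by
      nlinarith [mul_nonneg (sub_nonneg.2 ht1.le) (add_nonneg zero_le_one
        (mul_nonneg ht (sub_nonneg.2 ht1.le)))]
    nlinarith [abs_nonneg X]
  have e3 : (t ^ 4 - 1) * Y ≤ (1 - t ^ 2) * (2 * |Y|) := by
    have h6 : (t ^ 4 - 1) * Y ≤ (1 - t ^ 4) * |Y| := by
      have h7 : t ^ 4 ≤ 1 := pow_le_one₀ ht ht1.le
      nlinarith [neg_abs_le Y]
    have h7 : t ^ 2 ≤ 1 := pow_le_one₀ ht ht1.le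
    have h8 : 1 - t ^ 4 ≤ (1 - t ^ 2) * 2 := by nlinarith
    nlinarith [abs_nonneg Y]
  have e4 : 0 < 1 - t ^ 2 := by nlinarith
  have e5 : 0 < (1 - t ^ 2) * (quadInv a z - 2 * |X| - 2 * |Y|) := mul_pos e4 (by linarith)
  linarith

theorem norm_sq_le_of_le (H : IsAdapted A B a r h₀) (hz : ‖z‖ ≤ r)
    (hK : mcmInvariant A B a z ≤ h) : ellipticity a * ‖z‖ ^ 2 ≤ 2 * h := by
  have := H.le_mcmInvariant hz
  linarith

/-- A point of the closed ball of energy at most h₀ is never on the boundary sphere. The sublevel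
sets cut out by the open and by the closed ball thus coincide, which makes them compact and isolates
them from the rest of the sublevel set. -/
theorem norm_lt_of_le (H : IsAdapted A B a r h₀) (hh : h ≤ h₀) (hz : ‖z‖ ≤ r)
    (hK : mcmInvariant A B a z ≤ h) : ‖z‖ < r := by
  have h1 := H.norm_sq_le_of_le hz hK
  have h2 : ellipticity a * ‖z‖ ^ 2 < ellipticity a * r ^ 2 := by linarith [H.h_lt]
  exact lt_of_pow_lt_pow_left₀ 2 H.r_pos.le (lt_of_mul_lt_mul_left h2 H.c_pos.le)

theorem denom' (H : IsAdapted A B a r h₀) (hz : ‖z‖ < r) :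
    0 < A * z.2 ^ 2 + B * z.2 + 1 := H.denom _ ((norm_snd_le z).trans_lt hz)

/-- For fixed p the invariant is a quadratic polynomial in q with leading coefficient A p² + B p +
1. By Vieta `mcmForce A B a p` is the sum of two roots of equal energy, so q ↦ -q + f(p) exchanges
them; the swap of q and p is a symmetry as well. -/
theorem invariant (H : IsAdapted A B a r h₀) (hz : ‖z‖ < r) :
    mcmInvariant A B a (planarMap (mcmForce A B a) z) = mcmInvariant A B a z := by
  have h := (H.denom' hz).ne'
  have hf : (A * z.2 ^ 2 + B * z.2 + 1) * mcmForce A B a z.2 = a * z.2 - B * z.2 ^ 2 := by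
    rw [mcmForce, mul_div_cancel₀ _ h]
  simp only [mcmInvariant, planarMap]
  linear_combination (mcmForce A B a z.2 - 2 * z.1) * hf

theorem norm_map_lt (H : IsAdapted A B a r h₀) (hh : h ≤ h₀) (hz : ‖z‖ < r)
    (hK : mcmInvariant A B a z ≤ h) : ‖planarMap (mcmForce A B a) z‖ < r :=
  H.maps z (by linarith [H.norm_sq_le_of_le hz.le hK])

theorem ne_zero (hh : 0 < h) (hK : mcmInvariant A B a z = h) : z ≠ 0 := by
  rintro rfl
  rw [mcmInvariant_zero] at hK
  exact hh.ne hK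

end IsAdapted

/-- The part of the sublevel set of the McMillan invariant in the disc of radius `r`. -/
def disc (A B a r h : ℝ) : Set (ℝ × ℝ) := {z | ‖z‖ < r ∧ mcmInvariant A B a z ≤ h}

namespace IsAdapted

variable {A B a r h₀ h : ℝ} {z : ℝ × ℝ}

theorem disc_eq (H : IsAdapted A B a r h₀) (hh : h ≤ h₀) :
    disc A B a r h = Metric.closedBall 0 r ∩ {z | mcmInvariant A B a z ≤ h} := by
  ext z
  simp only [disc, mem_ofPred_eq, mem_inter_iff, mem_closedBall_zero_iff]
  exact ⟨fun h => ⟨h.1.le, h.2⟩, fun h => ⟨H.norm_lt_of_le hh h.1 h.2, h.2⟩⟩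

theorem isCompact_disc (H : IsAdapted A B a r h₀) (hh : h ≤ h₀) :
    IsCompact (disc A B a r h) := by
  rw [H.disc_eq hh]
  exact (isCompact_closedBall 0 r).inter_right
    (isClosed_le (continuous_mcmInvariant A B a) continuous_const)

theorem zero_mem_disc (H : IsAdapted A B a r h₀) (hh : 0 ≤ h) : (0 : ℝ × ℝ) ∈ disc A B a r h :=
  ⟨by simpa using H.r_pos, by rwa [mcmInvariant_zero]⟩

theorem isPreconnected_disc (H : IsAdapted A B a r h₀) : IsPreconnected (disc A B a r h) := by
  rcases lt_or_ge h 0 with hh | hh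
  · have : disc A B a r h = ∅ := by
      refine eq_empty_of_forall_notMem fun z hz => ?_
      have h1 := H.le_mcmInvariant hz.1.le
      have h2 := mul_nonneg (half_pos H.c_pos).le (sq_nonneg ‖z‖)
      linarith [hz.2]
    rw [this]
    exact isPreconnected_empty
  · have hs : StarConvex ℝ (0 : ℝ × ℝ) (disc A B a r h) := by
      rw [starConvex_zero_iff]
      intro z hz t ht0 ht1
      rcases eq_or_ne z 0 with rfl | hz0
      · rw [smul_zero]; exact H.zero_mem_disc hh
      rcases ht1.eq_or_lt with rfl | ht1
      · rwa [one_smul]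
      refine ⟨?_, (H.star hz.1.le hz0 ht0 ht1).le.trans hz.2⟩
      rw [norm_smul, Real.norm_of_nonneg ht0]
      exact lt_of_le_of_lt (mul_le_of_le_one_left (norm_nonneg _) ht1.le) hz.1
    exact (hs.isPathConnected (H.zero_mem_disc hh)).isConnected.isPreconnected

end IsAdapted

/-! ### Polar parametrisation of the level curves -/

/-- The point of the unit circle at the clockwise angle `2 π x`. -/
def unitDir (x : ℝ) : ℝ × ℝ := (Real.cos (2 * Real.pi * x), -Real.sin (2 * Real.pi * x))

theorem toC_unitDir (x : ℝ) : toC (unitDir x) = Complex.exp (-(2 * Real.pi * x : ℝ) * Complex.I) := by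
  rw [← Complex.ofReal_neg, Complex.exp_mul_I]
  apply Complex.ext <;> simp [toC, unitDir, ← Complex.ofReal_cos, ← Complex.ofReal_sin,
    -Complex.ofReal_mul, -Complex.ofReal_neg]

theorem continuous_unitDir : Continuous unitDir := by unfold unitDir; fun_prop

theorem unitDir_add_one (x : ℝ) : unitDir (x + 1) = unitDir x := by
  simp [unitDir, mul_add]

theorem unitDir_norm (x : ℝ) : (unitDir x).1 ^ 2 + (unitDir x).2 ^ 2 = 1 := by
  simp [unitDir]

theorem unitDir_ne_zero (x : ℝ) : unitDir x ≠ 0 := fun h => by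
  have := unitDir_norm x
  rw [h] at this
  simp at this

theorem exists_eq_smul_unitDir {z : ℝ × ℝ} (hz : z ≠ 0) :
    ∃ t x : ℝ, 0 < t ∧ z = t • unitDir x := by
  refine ⟨‖toC z‖, -(toC z).arg / (2 * Real.pi), norm_pos_iff.2 (mt toC_eq_zero.1 hz), ?_⟩
  have h1 : 2 * Real.pi * (-(toC z).arg / (2 * Real.pi)) = -(toC z).arg := by
    have := Real.pi_ne_zero
    field_simp
  ext
  · simp only [unitDir, h1, Real.cos_neg, Prod.smul_fst, smul_eq_mul]
    exact (Complex.norm_mul_cos_arg (toC z)).symm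
  · simp only [unitDir, h1, Real.sin_neg, neg_neg, Prod.smul_snd, smul_eq_mul]
    exact (Complex.norm_mul_sin_arg (toC z)).symm

theorem exists_int_of_unitDir_eq {x y t s : ℝ} (ht : 0 < t) (hs : 0 < s)
    (h : t • unitDir x = s • unitDir y) : ∃ n : ℤ, x = y + n := by
  have hts : t = s := by
    have h1 := congrArg (fun z : ℝ × ℝ => z.1 ^ 2 + z.2 ^ 2) h
    simp only [Prod.smul_fst, Prod.smul_snd, smul_eq_mul, mul_pow, ← mul_add, unitDir_norm,
      mul_one] at h1
    exact (sq_eq_sq₀ ht.le hs.le).1 h1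
  subst hts
  have h2 : unitDir x = unitDir y := smul_right_injective _ ht.ne' h
  have h3 := congrArg toC h2
  rw [toC_unitDir, toC_unitDir, Complex.exp_eq_exp_iff_exists_int] at h3
  obtain ⟨n, hn⟩ := h3
  refine ⟨-n, ?_⟩
  have h4 := congrArg Complex.im hn
  simp at h4
  have := Real.pi_pos
  have h5 : 2 * Real.pi * (x - (y - n)) = 0 := by linarith
  rcases mul_eq_zero.1 h5 with h6 | h6
  · linarith
  · push_cast; linarith

namespace IsAdapted

variable {A B a r h₀ h : ℝ} {z : ℝ × ℝ}

theorem mcmInvariant_smul_lt (H : IsAdapted A B a r h₀) {x s t : ℝ} (hs : 0 ≤ s) (hst : s < t)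
    (ht : ‖t • unitDir x‖ ≤ r) :
    mcmInvariant A B a (s • unitDir x) < mcmInvariant A B a (t • unitDir x) := by
  have htp : 0 < t := hs.trans_lt hst
  have := H.star ht (smul_ne_zero htp.ne' (unitDir_ne_zero x)) (t := s / t) (by positivity)
    ((div_lt_one htp).2 hst)
  rwa [smul_smul, div_mul_cancel₀ _ htp.ne'] at this

theorem exists_radius (H : IsAdapted A B a r h₀) (hh0 : 0 < h) (hh : h ≤ h₀) (x : ℝ) :
    ∃ t : ℝ, 0 < t ∧ ‖t • unitDir x‖ < r ∧ mcmInvariant A B a (t • unitDir x) = h := by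
  have hu : 0 < ‖unitDir x‖ := norm_pos_iff.2 (unitDir_ne_zero x)
  set R := r / ‖unitDir x‖ with hR
  have hRpos : 0 < R := div_pos H.r_pos hu
  have hnR : ‖R • unitDir x‖ = r := by
    rw [norm_smul, Real.norm_of_nonneg hRpos.le, hR, div_mul_cancel₀ _ hu.ne']
  have hc : ContinuousOn (fun t : ℝ => mcmInvariant A B a (t • unitDir x)) (Icc 0 R) :=
    ((continuous_mcmInvariant A B a).comp (by fun_prop)).continuousOn
  have h1 := intermediate_value_Icc hRpos.le hc
  have h2 : h ∈ Icc (mcmInvariant A B a ((0 : ℝ) • unitDir x))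
      (mcmInvariant A B a (R • unitDir x)) := by
    constructor
    · rw [zero_smul, mcmInvariant_zero]; exact hh0.le
    · have h3 := H.le_mcmInvariant hnR.le
      rw [hnR] at h3
      linarith [H.h_lt]
  obtain ⟨t, ht, htK⟩ := h1 h2
  simp only at htK
  have hn : ‖t • unitDir x‖ ≤ r := by
    rw [norm_smul, Real.norm_of_nonneg ht.1, ← hnR, norm_smul, Real.norm_of_nonneg hRpos.le]
    exact mul_le_mul_of_nonneg_right ht.2 hu.le
  refine ⟨t, lt_of_le_of_ne ht.1 ?_, H.norm_lt_of_le hh hn htK.le, htK⟩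
  rintro rfl
  rw [zero_smul, mcmInvariant_zero] at htK
  exact hh0.ne htK

theorem radius_unique (H : IsAdapted A B a r h₀) {x s t : ℝ} (hs : 0 < s) (ht : 0 < t)
    (hs' : ‖s • unitDir x‖ < r) (ht' : ‖t • unitDir x‖ < r)
    (hst : mcmInvariant A B a (s • unitDir x) = mcmInvariant A B a (t • unitDir x)) : s = t := by
  rcases lt_trichotomy s t with h1 | h1 | h1
  · exact absurd hst (H.mcmInvariant_smul_lt hs.le h1 ht'.le).ne
  · exact h1
  · exact absurd hst (H.mcmInvariant_smul_lt ht.le h1 hs'.le).ne'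

end IsAdapted

/-! ### Existence of the rotation number -/

theorem im_div_eq (z w : ℝ × ℝ) :
    (toC w / toC z).im = (z.1 * w.2 - z.2 * w.1) / Complex.normSq (toC z) := by
  simp only [Complex.div_im, toC]
  ring

theorem im_div_neg_iff {z : ℝ × ℝ} (hz : z ≠ 0) (w : ℝ × ℝ) :
    (toC w / toC z).im < 0 ↔ z.1 * w.2 - z.2 * w.1 < 0 := by
  have := Complex.normSq_pos.2 (mt toC_eq_zero.1 hz)
  rw [im_div_eq, div_neg_iff]
  constructor
  · rintro (h | h)
    · linarith [h.2]
    · exact h.1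
  · exact fun h => Or.inr ⟨h, this⟩

theorem im_div_pos_iff {z : ℝ × ℝ} (hz : z ≠ 0) (w : ℝ × ℝ) :
    0 < (toC w / toC z).im ↔ 0 < z.1 * w.2 - z.2 * w.1 := by
  have := Complex.normSq_pos.2 (mt toC_eq_zero.1 hz)
  rw [im_div_eq, div_pos_iff_of_pos_right this]

theorem planarMap_injective (f : ℝ → ℝ) : Function.Injective (planarMap f) := by
  intro z w h
  simp only [planarMap, Prod.mk.injEq] at h
  obtain ⟨h1, h2⟩ := h
  rw [h1] at h2
  exact Prod.ext (by linarith) h1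

namespace IsAdapted

variable {A B a r h₀ h : ℝ} {z : ℝ × ℝ}

/-- Multiplied by the positive denominator, the cross product of z and its image is -`quadInv a z`
plus cubic and quartic terms, which `small` bounds by half of the lower bound of `quadInv`. Every
step is thus a clockwise turn by less than π. -/
theorem im_div_neg (H : IsAdapted A B a r h₀) (hz : ‖z‖ < r) (hz0 : z ≠ 0) :
    (toC (planarMap (mcmForce A B a) z) / toC z).im < 0 := by
  rw [im_div_neg_iff hz0]
  have hD := H.denom' hz
  have hf : (A * z.2 ^ 2 + B * z.2 + 1) * mcmForce A B a z.2 = a * z.2 - B * z.2 ^ 2 := by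
    rw [mcmForce, mul_div_cancel₀ _ hD.ne']
  simp only [planarMap]
  set D := A * z.2 ^ 2 + B * z.2 + 1 with hDd
  set f := mcmForce A B a z.2
  have h1 : |z.1| ≤ ‖z‖ := norm_fst_le z
  have h2 : |z.2| ≤ ‖z‖ := norm_snd_le z
  have hq := le_quadInv H.abs_lt_two z
  have hn : 0 < ‖z‖ := norm_pos_iff.2 hz0
  have e1 : |A * z.2 ^ 2 * (z.1 ^ 2 + z.2 ^ 2)| ≤ |A| * (2 * ‖z‖ ^ 4) := by
    rw [mul_assoc, abs_mul]
    gcongr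
    rw [abs_mul, abs_pow, abs_of_nonneg (by positivity : 0 ≤ z.1 ^ 2 + z.2 ^ 2), ← sq_abs z.1,
      ← sq_abs z.2]
    calc |z.2| ^ 2 * (|z.1| ^ 2 + |z.2| ^ 2) ≤ ‖z‖ ^ 2 * (‖z‖ ^ 2 + ‖z‖ ^ 2) := by gcongr
      _ = 2 * ‖z‖ ^ 4 := by ring
  have e2 : |B * (z.2 * (z.1 ^ 2 + z.2 ^ 2) + z.2 ^ 2 * z.1)| ≤ |B| * (3 * ‖z‖ ^ 3) := by
    rw [abs_mul]
    gcongr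
    refine (abs_add_le _ _).trans ?_
    rw [abs_mul, abs_mul, abs_pow, abs_of_nonneg (by positivity : 0 ≤ z.1 ^ 2 + z.2 ^ 2),
      ← sq_abs z.1, ← sq_abs z.2, sq_abs z.2, ← sq_abs z.2]
    calc |z.2| * (|z.1| ^ 2 + |z.2| ^ 2) + |z.2| ^ 2 * |z.1|
        ≤ ‖z‖ * (‖z‖ ^ 2 + ‖z‖ ^ 2) + ‖z‖ ^ 2 * ‖z‖ := by gcongr
      _ = 3 * ‖z‖ ^ 3 := by ring
  have e3 : 2 * |B| * ‖z‖ + |A| * ‖z‖ ^ 2 ≤ 2 * |B| * r + |A| * r ^ 2 := by gcongr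
  have e4 := mul_le_mul_of_nonneg_right (e3.trans H.small) (sq_nonneg ‖z‖)
  have hc := H.c_pos
  have e5 : 0 < ellipticity a * ‖z‖ ^ 2 := by positivity
  have e6 : 0 ≤ |B| * ‖z‖ ^ 3 := by positivity
  have key : D * (z.1 * (-z.1 + f) - z.2 * z.2) = -quadInv a z
      - A * z.2 ^ 2 * (z.1 ^ 2 + z.2 ^ 2) - B * (z.2 * (z.1 ^ 2 + z.2 ^ 2) + z.2 ^ 2 * z.1) := by
    simp only [quadInv]
    linear_combination z.1 * hf - (z.1 ^ 2 + z.2 ^ 2) * hDd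
  have e7 := neg_abs_le (A * z.2 ^ 2 * (z.1 ^ 2 + z.2 ^ 2))
  have e8 := neg_abs_le (B * (z.2 * (z.1 ^ 2 + z.2 ^ 2) + z.2 ^ 2 * z.1))
  have e9 : D * (z.1 * (-z.1 + f) - z.2 * z.2) < 0 := by
    rw [key]
    nlinarith
  by_contra hcon
  exact absurd (mul_nonneg hD.le (not_lt.1 hcon)) (not_le.2 e9)

/-- Strict monotonicity on rays traps the radius: at a value b below (above) ρ x the energy is below
(above) h, this persists for nearby directions, and there it forces ρ to stay above (below) b. -/
theorem continuous_radius (H : IsAdapted A B a r h₀) {ρ : ℝ → ℝ} (hpos : ∀ x, 0 < ρ x)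
    (hr : ∀ x, ‖ρ x • unitDir x‖ < r)
    (hK : ∀ x, mcmInvariant A B a (ρ x • unitDir x) = h) : Continuous ρ := by
  have hcont : ∀ t : ℝ, Continuous fun y => t • unitDir y := fun t => by
    have := continuous_unitDir
    fun_prop
  have hKc : ∀ t : ℝ, Continuous fun y => mcmInvariant A B a (t • unitDir y) := fun t =>
    (continuous_mcmInvariant A B a).comp (hcont t)
  have hmono : ∀ {x s t : ℝ}, 0 ≤ s → s ≤ t → ‖t • unitDir x‖ ≤ r →
      mcmInvariant A B a (s • unitDir x) ≤ mcmInvariant A B a (t • unitDir x) := by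
    intro x s t hs hst ht
    rcases hst.eq_or_lt with rfl | hst
    · exact le_rfl
    · exact (H.mcmInvariant_smul_lt hs hst ht).le
  refine continuous_iff_continuousAt.2 fun x => tendsto_order.2 ⟨fun b hb => ?_, fun b hb => ?_⟩
  · rcases lt_or_ge b 0 with hb0 | hb0
    · exact Eventually.of_forall fun y => hb0.trans (hpos y)
    have hbr : ‖b • unitDir x‖ < r := by
      refine lt_of_le_of_lt ?_ (hr x)
      rw [norm_smul, norm_smul, Real.norm_of_nonneg hb0, Real.norm_of_nonneg (hpos x).le]
      exact mul_le_mul_of_nonneg_right hb.le (norm_nonneg _)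
    have h1 : mcmInvariant A B a (b • unitDir x) < h := by
      rw [← hK x]; exact H.mcmInvariant_smul_lt hb0 hb (hr x).le
    filter_upwards [(hKc b).continuousAt.eventually (gt_mem_nhds h1),
      (hcont b).norm.continuousAt.eventually (gt_mem_nhds hbr)] with y hy1 hy2
    by_contra hcon
    have := hmono (hpos y).le (not_lt.1 hcon) hy2.le
    rw [hK y] at this
    exact absurd hy1 (not_lt.2 this)
  · have h0 : ∀ᶠ b' in 𝓝[>] (ρ x), ‖b' • unitDir x‖ < r ∧ b' < b ∧ ρ x < b' := by
      have c1 : Continuous fun b' : ℝ => ‖b' • unitDir x‖ := by fun_prop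
      filter_upwards [(c1.continuousAt.eventually (gt_mem_nhds (hr x))).filter_mono
        nhdsWithin_le_nhds, (gt_mem_nhds hb).filter_mono nhdsWithin_le_nhds,
        self_mem_nhdsWithin] with b' h1 h2 h3
      exact ⟨h1, h2, h3⟩
    obtain ⟨b', hb1, hb2, hb3⟩ := h0.exists
    have h1 : h < mcmInvariant A B a (b' • unitDir x) := by
      rw [← hK x]; exact H.mcmInvariant_smul_lt (hpos x).le hb3 hb1.le
    filter_upwards [(hKc b').continuousAt.eventually (lt_mem_nhds h1)] with y hy1
    by_contra hcon
    have := hmono ((hpos x).le.trans hb3.le) (hb2.le.trans (not_lt.1 hcon)) (hr y).le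
    rw [hK y] at this
    exact absurd hy1 (not_lt.2 this)

/-- All orbits on a level curve of the McMillan invariant have the same rotation number. -/
theorem exists_rotationNumber (H : IsAdapted A B a r h₀) (hh0 : 0 < h) (hh : h ≤ h₀) :
    ∃ ν : ℝ, ∀ z, ‖z‖ < r → mcmInvariant A B a z = h →
      HasRotationNumber (planarMap (mcmForce A B a)) z ν := by
  set P := planarMap (mcmForce A B a) with hP
  choose ρ hpos hr hK using H.exists_radius hh0 hh
  have hρ := H.continuous_radius hpos hr hK
  set γ : ℝ → ℝ × ℝ := fun x => ρ x • unitDir x with hγ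
  have hγ0 : ∀ x, γ x ≠ 0 := fun x => smul_ne_zero (hpos x).ne' (unitDir_ne_zero x)
  have hγc : Continuous γ := by
    have := continuous_unitDir
    fun_prop
  have hρ1 : ∀ x, ρ (x + 1) = ρ x := by
    intro x
    have h1 := hr (x + 1)
    have h2 := hK (x + 1)
    rw [unitDir_add_one] at h1 h2
    exact H.radius_unique (hpos _) (hpos _) h1 (hr x) (h2.trans (hK x).symm)
  have hγ1 : ∀ x, γ (x + 1) = γ x := fun x => by simp only [hγ, hρ1, unitDir_add_one]
  have him : ∀ x, (toC (P (γ x)) / toC (γ x)).im < 0 := fun x => H.im_div_neg (hr x) (hγ0 x)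
  -- F is the lift of the circle map induced on the clockwise angle, measured in turns.
  set F : ℝ → ℝ := fun x => x + angleStep (γ x) (P (γ x)) / (2 * Real.pi) with hF
  have hF1 : ∀ x, F (x + 1) = F x + 1 := fun x => by simp only [hF, hγ1]; ring
  have hstep : ∀ x, P (γ x) = γ (F x) := by
    intro x
    set R := toC (P (γ x)) / toC (γ x) with hR
    have hγx : toC (γ x) ≠ 0 := mt toC_eq_zero.1 (hγ0 x)
    have hR0 : R ≠ 0 := fun h0 => by
      have := him x
      rw [← hR, h0] at this
      simp at this
    have hγC : toC (γ x) = ρ x * toC (unitDir x) := by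
      apply Complex.ext <;> simp [hγ, toC]
    have e1 : P (γ x) = (‖R‖ * ρ x) • unitDir (F x) := by
      have e2 : toC (P (γ x)) = toC ((‖R‖ * ρ x) • unitDir (F x)) := by
        have e3 : toC ((‖R‖ * ρ x) • unitDir (F x)) = (‖R‖ * ρ x : ℝ) * toC (unitDir (F x)) := by
          apply Complex.ext <;> simp [toC]
        have e4 : toC (P (γ x)) = R * toC (γ x) := by rw [hR, div_mul_cancel₀ _ hγx]
        rw [e3, e4, hγC]
        have hang : 2 * Real.pi * F x = 2 * Real.pi * x - R.arg := by
          have := Real.pi_ne_zero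
          simp only [hF, angleStep_of_im_neg (him x), ← hR]
          field_simp
          ring
        rw [toC_unitDir, toC_unitDir, hang]
        conv_lhs => rw [← Complex.norm_mul_exp_arg_mul_I R]
        have e5 : Complex.exp (-((2 * Real.pi * x - R.arg : ℝ) : ℂ) * Complex.I) =
            Complex.exp (R.arg * Complex.I) *
              Complex.exp (-((2 * Real.pi * x : ℝ) : ℂ) * Complex.I) := by
          rw [← Complex.exp_add]
          congr 1
          push_cast
          ring
        rw [e5]
        push_cast
        ring
      have e6 := congrArg Complex.re e2
      have e7 := congrArg Complex.im e2
      exact Prod.ext e6 e7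
    have hp : 0 < ‖R‖ * ρ x := mul_pos (norm_pos_iff.2 hR0) (hpos x)
    have hr' : ‖P (γ x)‖ < r := H.norm_map_lt hh (hr x) (hK x).le
    have hK' : mcmInvariant A B a (P (γ x)) = h := (H.invariant (hr x)).trans (hK x)
    rw [e1] at hr' hK'
    rw [e1, H.radius_unique hp (hpos _) hr' (hr _) (hK'.trans (hK _).symm)]
  -- Images stay strictly on one side of the real axis relative to the point, so the argument never
  -- meets its cut.
  have hFc : Continuous F := by
    refine continuous_id.add (Continuous.div_const ?_ _)
    have : (fun x => angleStep (γ x) (P (γ x)))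
        = fun x => -(toC (P (γ x)) / toC (γ x)).arg := funext fun x => angleStep_of_im_neg (him x)
    rw [this]
    refine continuous_iff_continuousAt.2 fun x => ContinuousAt.neg ?_
    have h1 : ContinuousAt (fun x => toC (P (γ x)) / toC (γ x)) x := by
      have h2 : ContinuousAt P (γ x) := continuousAt_planarMap a (H.denom' (hr x)).ne'
      have h3 : ContinuousAt (fun x => P (γ x)) x :=
        ContinuousAt.comp (f := γ) h2 hγc.continuousAt
      exact ContinuousAt.div
        (ContinuousAt.comp (f := fun x => P (γ x)) continuous_toC.continuousAt h3)
        (continuous_toC.comp hγc).continuousAt (mt toC_eq_zero.1 (hγ0 x))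
    exact ContinuousAt.comp (f := fun x => toC (P (γ x)) / toC (γ x))
      (Complex.continuousAt_arg (Or.inr (him x).ne)) h1
  have hγinj : ∀ {x y}, γ x = γ y → ∃ n : ℤ, x = y + n := fun {x y} hxy =>
    exists_int_of_unitDir_eq (hpos x) (hpos y) hxy
  have hFn : ∀ (n : ℤ) x, F (x + n) = F x + n := by
    intro n x
    have hper : ∀ m : ℤ, γ (x + m) = γ x := by
      intro m
      have : Function.Periodic γ 1 := hγ1
      simpa using this.int_mul m x
    simp only [hF, hper]
    ring
  have hFinj : Function.Injective F := by
    intro x y hxy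
    have h1 : P (γ x) = P (γ y) := by rw [hstep, hstep, hxy]
    obtain ⟨n, hn⟩ := hγinj (planarMap_injective _ h1)
    rw [hn, hFn] at hxy
    have : (n : ℝ) = 0 := by linarith
    rw [hn, this, add_zero]
  -- A continuous injective function on the line is strictly monotone, and F (x + 1) = F x + 1 rules
  -- out a decreasing one.
  have hFmono : Monotone F := by
    rcases hFc.strictMono_of_inj hFinj with h1 | h1
    · exact h1.monotone
    · have h2 := h1 (show (0 : ℝ) < 0 + 1 by norm_num)
      rw [hF1] at h2
      linarith
  let f : CircleDeg1Lift := ⟨⟨F, hFmono⟩, hF1⟩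
  refine ⟨f.translationNumber, fun z hz hzK => ?_⟩
  obtain ⟨t, x, ht, rfl⟩ := exists_eq_smul_unitDir (ne_zero hh0 hzK)
  have htρ : t = ρ x := H.radius_unique ht (hpos x) hz (hr x) (hzK.trans (hK x).symm)
  have hit : ∀ j, P^[j] (γ x) = γ (F^[j] x) := by
    intro j
    induction j with
    | zero => rfl
    | succ j ih => rw [Function.iterate_succ_apply', ih, hstep, Function.iterate_succ_apply']
  have hlim := f.tendsto_translationNumber x
  rw [HasRotationNumber, htρ]
  refine hlim.congr fun N => ?_
  have hsum : ∀ j, angleStep (P^[j] (γ x)) (P^[j + 1] (γ x)) =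
      2 * Real.pi * F^[j + 1] x - 2 * Real.pi * F^[j] x := by
    intro j
    have h1 : F^[j + 1] x = F (F^[j] x) := Function.iterate_succ_apply' F j x
    have h2 : P^[j + 1] (γ x) = P (P^[j] (γ x)) := Function.iterate_succ_apply' P j (γ x)
    have h3 : ∀ y, angleStep (γ y) (P (γ y)) = 2 * Real.pi * F y - 2 * Real.pi * y := by
      intro y
      have := Real.pi_ne_zero
      simp only [hF]
      field_simp
      ring
    rw [h1, h2, hit, h3]
  change _ = (∑ j ∈ Finset.range N, angleStep (P^[j] (γ x)) (P^[j + 1] (γ x))) / _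
  rw [Finset.sum_congr rfl fun j _ => hsum j,
    Finset.sum_range_sub fun j => 2 * Real.pi * F^[j] x, CircleDeg1Lift.coe_pow]
  change (F^[N] x - x) / N = _
  have := Real.pi_ne_zero
  simp only [Function.iterate_zero, id_eq]
  rw [← mul_sub, mul_div_mul_left _ _ (by positivity)]

end IsAdapted

/-! ### Asymptotics of the rotation number -/

/-- With b and c the coefficients of t² and t³, the remainder is exactly t⁴ times -(B c + A b + A c
t) / (A t² + B t + 1), which is bounded near 0. -/
theorem matchesForce_mcmForce (A B a : ℝ) : MatchesForce A B a (mcmForce A B a) := by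
  set c := (a + 1) * B ^ 2 - a * A with hc
  set b := -(a + 1) * B with hb
  have hD : ∀ᶠ t in 𝓝 (0 : ℝ), A * t ^ 2 + B * t + 1 ≠ 0 := by
    have : ContinuousAt (fun t : ℝ => A * t ^ 2 + B * t + 1) 0 := by fun_prop
    exact this.eventually (isOpen_ne.mem_nhds (by norm_num))
  have hg : (fun t : ℝ => -(B * c + A * b + A * c * t) / (A * t ^ 2 + B * t + 1))
      =O[𝓝 0] fun _ => (1 : ℝ) := by
    have : ContinuousAt
        (fun t : ℝ => -(B * c + A * b + A * c * t) / (A * t ^ 2 + B * t + 1)) 0 :=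
      ContinuousAt.div (by fun_prop) (by fun_prop) (by norm_num)
    exact this.isBigO_one ℝ
  have h := (Asymptotics.isBigO_refl (fun t : ℝ => t ^ 4) (𝓝 0)).mul hg
  simp only [mul_one] at h
  refine h.congr' ?_ EventuallyEq.rfl
  filter_upwards [hD] with t ht
  rw [mcmForce, mul_div_assoc', div_eq_iff ht, sub_mul, div_mul_cancel₀ _ ht, hc, hb]
  ring

theorem toC_cwRot (θ : ℝ) (z : ℝ × ℝ) :
    toC (cwRot θ z) = Complex.exp (-(θ : ℂ) * Complex.I) * toC z := by
  rw [← Complex.ofReal_neg]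
  apply Complex.ext
  · simp only [toC, cwRot, Complex.mul_re, Complex.exp_ofReal_mul_I_re,
      Complex.exp_ofReal_mul_I_im, Real.cos_neg, Real.sin_neg]
    ring
  · simp only [toC, cwRot, Complex.mul_im, Complex.exp_ofReal_mul_I_re,
      Complex.exp_ofReal_mul_I_im, Real.cos_neg, Real.sin_neg]
    ring

theorem Ord.toC {n : ℕ} {f : ℝ × ℝ → ℝ × ℝ} (hf : Ord n f) : Ord n fun z => Twist.toC (f z) := by
  refine Asymptotics.IsBigO.trans (Asymptotics.IsBigO.of_bound 2 (Eventually.of_forall fun z => ?_))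
    hf
  exact norm_toC_le (f z)

theorem norm_exp_sub_exp_le (x y : ℝ) :
    ‖Complex.exp (-(x : ℂ) * Complex.I) - Complex.exp (-(y : ℂ) * Complex.I)‖ ≤ |x - y| := by
  have h : Complex.exp (-(x : ℂ) * Complex.I) - Complex.exp (-(y : ℂ) * Complex.I) =
      Complex.exp (((-y : ℝ) : ℂ) * Complex.I) *
        (Complex.exp (Complex.I * ((y - x : ℝ) : ℂ)) - 1) := by
    rw [mul_sub, ← Complex.exp_add, mul_one]
    congr 2 <;> (push_cast; ring)
  rw [h, norm_mul, Complex.norm_exp_ofReal_mul_I, one_mul, abs_sub_comm]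
  exact Real.norm_exp_I_mul_ofReal_sub_one_le

theorem ord_quadInv_sub {Ψ : ℝ × ℝ → ℝ × ℝ} (a : ℝ) (h : Ord 2 fun z => Ψ z - z) :
    Ord 3 fun z => quadInv a (Ψ z) - quadInv a z := by
  have h1 := h.fst_comp
  have h2 := h.snd_comp
  have e1 := (Ord.snd.mul h2).const_mul 2
  have e2 := (h2.mul h2).mono (show 3 ≤ 2 + 2 by norm_num)
  have e3 := ((Ord.snd.mul h1).add (Ord.fst.mul h2)).const_mul a
  have e4 := ((h1.mul h2).const_mul a).mono (show 3 ≤ 2 + 2 by norm_num)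
  have e5 := (Ord.fst.mul h1).const_mul 2
  have e6 := (h1.mul h1).mono (show 3 ≤ 2 + 2 by norm_num)
  refine ((((e1.add e2).sub e3).sub e4).add (e5.add e6)).congr fun z => ?_
  simp only [quadInv, Prod.fst_sub, Prod.snd_sub]
  ring

theorem ord_mcmInvariant_sub (A B a : ℝ) :
    Ord 3 fun z => mcmInvariant A B a z - quadInv a z := by
  have e1 := (((Ord.snd.pow 2).mul Ord.fst).add (Ord.snd.mul (Ord.fst.pow 2))).const_mul B
  have e2 := (((Ord.snd.pow 2).mul (Ord.fst.pow 2)).const_mul A).mono (show 3 ≤ 4 by norm_num)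
  refine (e1.add e2).congr fun z => ?_
  rw [mcmInvariant_eq]
  simp only [cubInv, quartInv]
  ring

/-- In the coordinates of the normal form the McMillan map turns points near the origin by the
angle `Φ + μ sin Φ K`, up to an error of third order. -/
theorem exists_turning_coordinates (A B : ℝ) {a Φ : ℝ} (ha : a = 2 * Real.cos Φ)
    (h0 : 0 < Φ) (hpi : Φ < Real.pi) :
    ∃ (W : ℝ × ℝ → ℝ × ℝ) (C : ℝ) (α : ℂ), 0 ≤ C ∧ ∀ᶠ z in 𝓝 (0 : ℝ × ℝ), z ≠ 0 →
      0 < (toC (W z) * starRingEnd ℂ (α * toC z)).re ∧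
      (toC (W (planarMap (mcmForce A B a) z)) / toC (W z)).im < 0 ∧
      |(toC (W (planarMap (mcmForce A B a) z)) / toC (W z)).arg
        + (Φ + twistRate A B a * Real.sin Φ * mcmInvariant A B a z)| ≤ C * ‖z‖ ^ 3 := by
  have hs : 0 < Real.sin Φ := Real.sin_pos_of_pos_of_lt_pi h0 hpi
  have ha2 : |a| < 2 := by
    have h1 := Real.cos_sq_add_sin_sq Φ
    have h2 : 0 < Real.sin Φ ^ 2 := by positivity
    exact abs_lt.2 ⟨by nlinarith, by nlinarith⟩
  obtain ⟨Ψ, hΨ, hΨ2, hΨN⟩ := exists_normalForm A B ha2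
  have hN := hΨN _ (matchesForce_mcmForce A B a)
  set P := planarMap (mcmForce A B a) with hP
  set μ := twistRate A B a with hμ
  set E := ellipseChart 1 Φ one_ne_zero hs.ne' with hE
  have hEs : ∀ w, E.symm w =
      ((1 : ℝ)⁻¹ * w.1, (1 : ℝ)⁻¹ * (Real.sin Φ)⁻¹ * (w.2 - Real.cos Φ * w.1)) := fun w =>
    ellipseChart_symm_apply one_ne_zero hs.ne' w
  have hEord : ∀ {n : ℕ} {g : ℝ × ℝ → ℝ × ℝ}, Ord n g → Ord n fun z => E.symm (g z) := by
    intro n g hg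
    refine Ord.congr ((hg.fst_comp.const_mul (1 : ℝ)⁻¹).prodMk
      ((hg.snd_comp.sub (hg.fst_comp.const_mul (Real.cos Φ))).const_mul
        ((1 : ℝ)⁻¹ * (Real.sin Φ)⁻¹))) fun z => (hEs _).symm
  have hEsub : ∀ v w, E.symm v - E.symm w = E.symm (v - w) := by
    intro v w
    ext <;> simp only [hEs, Prod.fst_sub, Prod.snd_sub] <;> ring
  set W : ℝ × ℝ → ℝ × ℝ := fun z => E.symm (Ψ z) with hW
  have hΨ1 : Ord 1 Ψ :=
    Ord.of_differentiableAt ((hΨ.contDiff.differentiable (by simp)) 0) hΨ.map_zero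
  have hW1 : Ord 1 W := hEord hΨ1
  have hWtend : Tendsto W (𝓝 0) (𝓝 0) := hW1.tendsto one_ne_zero
  -- the half plane
  obtain ⟨α, hα⟩ := exists_half_plane (V := W) (u := -(Real.cos Φ / Real.sin Φ))
    (δ := (Real.sin Φ)⁻¹) (inv_pos.2 hs) (by
      have h1 : Ord 2 fun z => E.symm (Ψ z - z) := hEord hΨ2
      have h2 : (fun z : ℝ × ℝ => ‖z‖ ^ 2) =o[𝓝 0] fun z => z := by
        have h3 := (Asymptotics.isLittleO_norm_pow_id (E' := ℝ × ℝ) (one_lt_two))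
        simpa using h3
      refine (h1.trans_isLittleO h2).congr_left fun z => ?_
      rw [← hEsub]
      ext
      · simp [hW, hEs]
      · simp [hW, hEs]; field_simp; ring)
  -- lower bound for `W`
  obtain ⟨c, hc⟩ : ∃ c, ∀ᶠ z in 𝓝 (0 : ℝ × ℝ), ‖z‖ ≤ c * ‖W z‖ := by
    have h1 : Ord 1 fun y => Ψ.symm (E y) := by
      refine Ord.of_differentiableAt ((hΨ.contDiff_symm.comp
        (isSmoothArea_ellipseChart_symm one_ne_zero hs.ne').contDiff_symm).differentiable
          (by simp) 0) ?_
      have h1 : E 0 = 0 := by simp [hE, ellipseChart_apply]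
      rw [h1, Homeomorph.symm_apply_eq, hΨ.map_zero]
    obtain ⟨c, hc⟩ := h1.bound
    refine ⟨c, ?_⟩
    filter_upwards [hWtend.eventually hc] with z hz
    simpa [hW] using hz
  -- the conjugacy
  set θ : ℝ × ℝ → ℝ := fun z => Φ + μ * Real.sin Φ * mcmInvariant A B a z with hθ
  have hconj : Ord 4 fun z => toC (W (P z)) - Complex.exp (-(θ z : ℂ) * Complex.I) * toC (W z) := by
    have h1 : Ord 4 fun z => E.symm (Ψ (P z) - normalMap a μ (Ψ z)) := hEord hN
    have hν : Φ = 2 * Real.pi * (Φ / (2 * Real.pi)) := by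
      have := Real.pi_ne_zero
      field_simp
    have h2 := (ord_ellipseChart_normalMap (μ := μ) (m := 1) one_ne_zero hs.ne' hν ha rfl).comp hW1
    have h3 := (h1.add h2).toC
    set θ' : ℝ × ℝ → ℝ := fun z => 2 * Real.pi * (Φ / (2 * Real.pi) + μ * 1 ^ 2 * Real.sin Φ ^ 3
      / Real.pi * (((W z).1 ^ 2 + (W z).2 ^ 2) / 2)) with hθ'
    -- The normal form turns by an angle depending on `quadInv a (Ψ z)`. This and the invariant both
    -- differ from `quadInv a z` by third order terms; passing to the invariant makes the angle
    -- constant along orbits.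
    have h4 : Ord 3 fun z => θ' z - θ z := by
      refine (((ord_quadInv_sub a hΨ2).sub (ord_mcmInvariant_sub A B a)).const_mul
        (μ * Real.sin Φ)).congr fun z => ?_
      have hq : quadInv a (Ψ z) = Real.sin Φ ^ 2 * ((W z).1 ^ 2 + (W z).2 ^ 2) := by
        have h5 : Ψ z = E (W z) := by simp [hW]
        rw [h5, hE, ellipseChart_apply, quadInv, ha]
        simp only [one_mul]
        linear_combination -(W z).1 ^ 2 * Real.cos_sq_add_sin_sq Φ
      have := Real.pi_ne_zero
      simp only [hθ', hθ, hq]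
      field_simp
      ring
    have h5 : Ord 3 fun z => Complex.exp (-(θ' z : ℂ) * Complex.I)
        - Complex.exp (-(θ z : ℂ) * Complex.I) :=
      Asymptotics.IsBigO.trans (Asymptotics.IsBigO.of_bound 1 (Eventually.of_forall fun z => by
        rw [one_mul, Real.norm_eq_abs]; exact norm_exp_sub_exp_le _ _)) h4
    have h6 : Ord 4 fun z => (Complex.exp (-(θ' z : ℂ) * Complex.I)
        - Complex.exp (-(θ z : ℂ) * Complex.I)) * toC (W z) := by
      have := Asymptotics.IsBigO.mul h5 hW1.toC
      refine this.congr_right fun z => ?_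
      ring
    refine (h3.add h6).congr fun z => ?_
    have h7 : toC (E.symm (Ψ (P z) - normalMap a μ (Ψ z)) + (E.symm (normalMap a μ (E (W z)))
        - cwRot (θ' z) (W z))) = toC (W (P z)) - toC (cwRot (θ' z) (W z)) := by
      have h8 : E (W z) = Ψ z := by simp [hW]
      rw [h8, ← hEsub]
      apply Complex.ext <;> simp [toC, hW]
    rw [h7, toC_cwRot]
    ring
  obtain ⟨c₁, hc₁⟩ := hconj.bound
  -- the logarithm
  set x₀ := Complex.exp (-(Φ : ℂ) * Complex.I) with hx₀
  have hx₀im : x₀.im < 0 := by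
    rw [hx₀, ← Complex.ofReal_neg, Complex.exp_ofReal_mul_I_im, Real.sin_neg]
    linarith
  -- The argument is the imaginary part of the logarithm, which is Lipschitz near exp(-iΦ), a point
  -- off the cut.
  obtain ⟨L, s, hs', hL⟩ := (Complex.hasStrictDerivAt_log
    (Complex.mem_slitPlane_iff.2 (Or.inr hx₀im.ne))).hasStrictFDerivAt.exists_lipschitzOnWith
  have him : {x : ℂ | x.im < 0} ∈ 𝓝 x₀ :=
    (isOpen_lt Complex.continuous_im continuous_const).mem_nhds hx₀im
  obtain ⟨ε, hε, hball⟩ := Metric.mem_nhds_iff.1 (inter_mem hs' him)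
  have hθc : Continuous θ :=
    continuous_const.add (continuous_const.mul (continuous_mcmInvariant A B a))
  have hθ0 : θ 0 = Φ := by simp [hθ, mcmInvariant_zero]
  have hexp : ContinuousAt (fun z => Complex.exp (-(θ z : ℂ) * Complex.I)) 0 := by fun_prop
  have e1 : ∀ᶠ z in 𝓝 (0 : ℝ × ℝ),
      dist (Complex.exp (-(θ z : ℂ) * Complex.I)) x₀ < ε / 2 := by
    have := Metric.tendsto_nhds.1 hexp (ε / 2) (by positivity)
    simpa only [hθ0] using this
  have e2 : ∀ᶠ z in 𝓝 (0 : ℝ × ℝ), |c₁| * |c| * ‖z‖ ^ 3 < ε / 2 := by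
    have : ContinuousAt (fun z : ℝ × ℝ => |c₁| * |c| * ‖z‖ ^ 3) 0 := by fun_prop
    exact this.eventually (gt_mem_nhds (by simpa using half_pos hε))
  have e3 : ∀ᶠ z in 𝓝 (0 : ℝ × ℝ), θ z < Real.pi :=
    hθc.continuousAt.eventually (gt_mem_nhds (by rwa [hθ0]))
  have e4 : ∀ᶠ z in 𝓝 (0 : ℝ × ℝ), 0 < θ z :=
    hθc.continuousAt.eventually (lt_mem_nhds (by rwa [hθ0]))
  refine ⟨W, L * (|c₁| * |c|), α, by positivity, ?_⟩
  filter_upwards [hα, hc, hc₁, e1, e2, e3, e4] with z z1 z2 z3 z4 z5 z6 z7 hz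
  set R := toC (W (P z)) / toC (W z) with hR
  have hzpos : 0 < ‖z‖ := norm_pos_iff.2 hz
  have hWz : W z ≠ 0 := fun h => by
    rw [h, norm_zero, mul_zero] at z2
    exact absurd z2 (not_le.2 hzpos)
  have hWpos : 0 < ‖toC (W z)‖ := norm_pos_iff.2 (mt toC_eq_zero.1 hWz)
  have hcW : ‖z‖ ≤ |c| * ‖toC (W z)‖ := by
    refine z2.trans ?_
    exact mul_le_mul (le_abs_self c) (norm_le_norm_toC _) (norm_nonneg _) (abs_nonneg _)
  -- Division by W costs one order, since ‖W z‖ is at least a constant times ‖z‖.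
  have hRe : ‖R - Complex.exp (-(θ z : ℂ) * Complex.I)‖ ≤ |c₁| * |c| * ‖z‖ ^ 3 := by
    have h1 : R - Complex.exp (-(θ z : ℂ) * Complex.I) =
        (toC (W (P z)) - Complex.exp (-(θ z : ℂ) * Complex.I) * toC (W z)) / toC (W z) := by
      rw [hR, sub_div, mul_div_cancel_right₀ _ (mt toC_eq_zero.1 hWz)]
    rw [h1, norm_div, div_le_iff₀ hWpos]
    rw [Real.norm_of_nonneg (by positivity : 0 ≤ ‖z‖ ^ 4)] at z3
    calc _ ≤ c₁ * ‖z‖ ^ 4 := z3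
      _ ≤ |c₁| * ‖z‖ ^ 4 := by gcongr; exact le_abs_self c₁
      _ = |c₁| * ‖z‖ ^ 3 * ‖z‖ := by ring
      _ ≤ |c₁| * ‖z‖ ^ 3 * (|c| * ‖toC (W z)‖) := by gcongr
      _ = |c₁| * |c| * ‖z‖ ^ 3 * ‖toC (W z)‖ := by ring
  have hRball : R ∈ Metric.ball x₀ ε := by
    rw [Metric.mem_ball]
    have h1 := dist_triangle R (Complex.exp (-(θ z : ℂ) * Complex.I)) x₀
    rw [dist_eq_norm R (Complex.exp (-(θ z : ℂ) * Complex.I))] at h1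
    linarith
  have hxball : Complex.exp (-(θ z : ℂ) * Complex.I) ∈ Metric.ball x₀ ε := by
    rw [Metric.mem_ball]
    linarith
  refine ⟨z1 hz, (hball hRball).2, ?_⟩
  have hlip := hL.dist_le_mul R (hball hRball).1 _ (hball hxball).1
  -- No multiple of 2πi is lost, because 0 < θ z < π.
  have hlog : Complex.log (Complex.exp (-(θ z : ℂ) * Complex.I)) = -(θ z : ℂ) * Complex.I := by
    rw [Complex.log_exp] <;> simp <;> linarith
  rw [hlog, dist_eq_norm, dist_eq_norm] at hlip
  have h2 := (Complex.abs_im_le_norm _).trans hlip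
  have h3 : (Complex.log R - -(θ z : ℂ) * Complex.I).im = R.arg + θ z := by
    simp [Complex.log_im]
  rw [h3] at h2
  refine h2.trans ?_
  rw [mul_assoc (L : ℝ)]
  gcongr

/-- The bounded error C disappears in the mean; the error ε per step survives. -/
theorem abs_sub_le_of_sum {s : ℕ → ℝ} {ν θ ε C : ℝ}
    (h : Tendsto (fun N : ℕ => s N / (2 * Real.pi * N)) atTop (𝓝 ν))
    (hs : ∀ N : ℕ, |s N - N * θ| ≤ N * ε + C) : |2 * Real.pi * ν - θ| ≤ ε := by
  have h1 : Tendsto (fun N : ℕ => |2 * Real.pi * (s N / (2 * Real.pi * N)) - θ|) atTop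
      (𝓝 |2 * Real.pi * ν - θ|) := ((h.const_mul _).sub_const _).abs
  have h2 : Tendsto (fun N : ℕ => ε + C / N) atTop (𝓝 (ε + 0)) :=
    tendsto_const_nhds.add (tendsto_const_div_atTop_nhds_zero_nat C)
  rw [add_zero] at h2
  refine le_of_tendsto_of_tendsto h1 h2 ?_
  filter_upwards [eventually_gt_atTop 0] with N hN
  have hN' : (0 : ℝ) < N := by exact_mod_cast hN
  have h3 : 2 * Real.pi * (s N / (2 * Real.pi * N)) - θ = (s N - N * θ) / N := by
    have := Real.pi_ne_zero
    field_simp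
  rw [h3, abs_div, abs_of_pos hN', div_le_iff₀ hN', add_mul, div_mul_cancel₀ _ hN'.ne']
  linarith [hs N]

theorem IsAdapted.iterate {A B a r h₀ h : ℝ} (H : IsAdapted A B a r h₀) (hh : h ≤ h₀)
    {z : ℝ × ℝ} (hz : ‖z‖ < r) (hK : mcmInvariant A B a z = h) (j : ℕ) :
    ‖(planarMap (mcmForce A B a))^[j] z‖ < r ∧
      mcmInvariant A B a ((planarMap (mcmForce A B a))^[j] z) = h := by
  induction j with
  | zero => exact ⟨hz, hK⟩
  | succ j ih =>
    rw [Function.iterate_succ_apply']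
    exact ⟨H.norm_map_lt hh ih.1 ih.2.le, (H.invariant ih.1).trans ih.2⟩

/-- The rotation number on the level curve of energy `h` is `(Φ + μ sin Φ h) / 2 π`, up to an
error of order `3/2`. -/
theorem exists_rotationNumber_estimate (A B : ℝ) {a Φ : ℝ} (ha : a = 2 * Real.cos Φ)
    (h0 : 0 < Φ) (hpi : Φ < Real.pi) :
    ∃ C ρ : ℝ, 0 < ρ ∧ ∀ r h₀, IsAdapted A B a r h₀ → r ≤ ρ → ∀ h, 0 < h → h ≤ h₀ →
      ∀ z ν, ‖z‖ < r → mcmInvariant A B a z = h →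
        HasRotationNumber (planarMap (mcmForce A B a)) z ν →
        |2 * Real.pi * ν - (Φ + twistRate A B a * Real.sin Φ * h)| ≤ C * √h ^ 3 := by
  obtain ⟨W, C, α, hC, hev⟩ := exists_turning_coordinates A B ha h0 hpi
  obtain ⟨ρ, hρ, hρ'⟩ := Metric.eventually_nhds_iff_ball.1 hev
  refine ⟨C * √(2 / ellipticity a) ^ 3, ρ, hρ, ?_⟩
  intro r h₀ H hrρ h hh0 hh z ν hz hK hν
  set P := planarMap (mcmForce A B a) with hP
  have horb := H.iterate hh hz hK
  have hne : ∀ j, P^[j] z ≠ 0 := fun j => IsAdapted.ne_zero hh0 (horb j).2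
  have hmem := fun j => hρ' (P^[j] z)
    (mem_ball_zero_iff.2 ((horb j).1.trans_le hrρ)) (hne j)
  have hsucc : ∀ j, P^[j + 1] z = P (P^[j] z) := fun j => Function.iterate_succ_apply' P j z
  -- On the level curve ‖z‖ = O(√h), which converts the third order error per step into O(h^(3/2)).
  have hnorm : ∀ j, ‖P^[j] z‖ ≤ √(2 / ellipticity a) * √h := by
    intro j
    rw [← Real.sqrt_mul (div_pos two_pos H.c_pos).le]
    refine Real.le_sqrt_of_sq_le ?_
    have h1 := H.norm_sq_le_of_le (horb j).1.le (horb j).2.le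
    rw [div_mul_eq_mul_div, le_div_iff₀ H.c_pos]
    linarith
  have hneg : ∀ j, (toC (P^[j + 1] z) / toC (P^[j] z)).im < 0 := fun j => by
    rw [hsucc]; exact H.im_div_neg (horb j).1 (hne j)
  refine abs_sub_le_of_sum (C := Real.pi) hν fun N => ?_
  -- The rotation number is measured in (q, p), the turning angle is known in the chart W; the two
  -- totals differ by at most π.
  have hsum := abs_sum_arg_div_sub_le (z := fun j => toC (P^[j] z)) (w := fun j => toC (W (P^[j] z)))
    (α := α) (fun j => (hmem j).1) (fun j => Or.inl ⟨hneg j, by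
      simp only [hsucc]; exact (hmem j).2.1⟩) N
  have hterm : |∑ j ∈ Finset.range N, ((toC (W (P^[j + 1] z)) / toC (W (P^[j] z))).arg
      + (Φ + twistRate A B a * Real.sin Φ * h))| ≤
      N * (C * √(2 / ellipticity a) ^ 3 * √h ^ 3) := by
    refine (Finset.abs_sum_le_sum_abs _ _).trans ?_
    rw [← nsmul_eq_mul]
    refine (Finset.sum_le_card_nsmul _ _ _ fun j _ => ?_).trans (by rw [Finset.card_range])
    have h1 := (hmem j).2.2
    rw [(horb j).2, ← hsucc] at h1
    refine h1.trans ?_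
    rw [mul_assoc, ← mul_pow]
    gcongr
    exact hnorm j
  rw [Finset.sum_add_distrib, Finset.sum_const, Finset.card_range, nsmul_eq_mul] at hterm
  have hs2 : ∑ j ∈ Finset.range N, angleStep (P^[j] z) (P^[j + 1] z) =
      -∑ j ∈ Finset.range N, (toC (P^[j + 1] z) / toC (P^[j] z)).arg := by
    rw [← Finset.sum_neg_distrib]
    exact Finset.sum_congr rfl fun j _ => angleStep_of_im_neg (hneg j)
  rw [hs2]
  rw [abs_le] at hsum hterm ⊢
  constructor <;> linarith [hsum.1, hsum.2, hterm.1, hterm.2]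

/-! ### Areas -/

/-- The map `(x, y) ↦ (x, δ y + g x)`. -/
def fiberMap (δ : ℝ) (g : ℝ → ℝ) (z : ℝ × ℝ) : ℝ × ℝ := (z.1, δ * z.2 + g z.1)

theorem measurable_fiberMap (δ : ℝ) {g : ℝ → ℝ} (hg : Measurable g) :
    Measurable (fiberMap δ g) :=
  measurable_fst.prodMk ((measurable_snd.const_mul δ).add (hg.comp measurable_fst))

/-- On each vertical line the map is affine with slope δ, so Fubini gives the area for a merely
measurable g. A lens with poles is therefore allowed. -/
theorem volume_preimage_fiberMap {δ : ℝ} (hδ : δ ≠ 0) {g : ℝ → ℝ} (hg : Measurable g)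
    {E : Set (ℝ × ℝ)} (hE : MeasurableSet E) :
    volume (fiberMap δ g ⁻¹' E) = ENNReal.ofReal |δ⁻¹| * volume E := by
  rw [Measure.volume_eq_prod, Measure.prod_apply (measurable_fiberMap δ hg hE),
    Measure.prod_apply hE, ← lintegral_const_mul' _ _ ENNReal.ofReal_ne_top]
  refine lintegral_congr fun x => ?_
  have h1 : Prod.mk x ⁻¹' (fiberMap δ g ⁻¹' E) =
      (fun y => δ * y) ⁻¹' ((fun y => y + g x) ⁻¹' (Prod.mk x ⁻¹' E)) := rfl
  rw [h1, Real.volume_preimage_mul_left hδ, measure_preimage_add_right]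

theorem volume_disc (R : ℝ) (hR : 0 ≤ R) :
    volume {z : ℝ × ℝ | z.1 ^ 2 + z.2 ^ 2 ≤ R ^ 2} = ENNReal.ofReal (Real.pi * R ^ 2) := by
  have hm : MeasurableSet {z : ℝ × ℝ | z.1 ^ 2 + z.2 ^ 2 ≤ R ^ 2} :=
    measurableSet_le (by fun_prop) measurable_const
  rw [← Complex.volume_preserving_equiv_real_prod.measure_preimage hm.nullMeasurableSet]
  have h1 : (Complex.measurableEquivRealProd ⁻¹' {z : ℝ × ℝ | z.1 ^ 2 + z.2 ^ 2 ≤ R ^ 2}) =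
      Metric.closedBall (0 : ℂ) R := by
    ext z
    simp only [mem_preimage, mem_ofPred_eq, mem_closedBall_zero_iff,
      Complex.measurableEquivRealProd_apply]
    rw [← sq_le_sq₀ (norm_nonneg z) hR, ← Complex.normSq_eq_norm_sq, Complex.normSq_apply]
    simp only [sq]
  rw [h1, Complex.volume_closedBall, ENNReal.ofReal_mul Real.pi_pos.le, mul_comm,
    ENNReal.ofReal_pow hR]
  congr 1
  rw [← NNReal.coe_real_pi, ENNReal.ofReal_coe_nnreal]

/-- Completing the square, p² - 2 c p q + q² = (p - c q)² + s² q², so a fibre map carries the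
ellipse to a disc of radius √t / s. -/
theorem volume_quadInv_le {a Φ t : ℝ} (ha : a = 2 * Real.cos Φ) (hs : 0 < Real.sin Φ)
    (ht : 0 ≤ t) :
    volume {z | quadInv a z ≤ t} = ENNReal.ofReal (Real.pi * t / Real.sin Φ) := by
  set s := Real.sin Φ with hsd
  set c := Real.cos Φ with hc
  have hcs : c ^ 2 + s ^ 2 = 1 := Real.cos_sq_add_sin_sq Φ
  have h1 : {z | quadInv a z ≤ t} = fiberMap s⁻¹ (fun x => -(c / s) * x) ⁻¹'
      {z : ℝ × ℝ | z.1 ^ 2 + z.2 ^ 2 ≤ (√t / s) ^ 2} := by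
    ext z
    simp only [mem_ofPred_eq, mem_preimage, fiberMap]
    rw [div_pow, Real.sq_sqrt ht, le_div_iff₀ (by positivity)]
    have : (z.1 ^ 2 + (s⁻¹ * z.2 + -(c / s) * z.1) ^ 2) * s ^ 2 = quadInv a z := by
      rw [quadInv, ha]
      field_simp
      linear_combination z.1 ^ 2 * hcs
    rw [this]
  rw [h1, volume_preimage_fiberMap (inv_ne_zero hs.ne') (by fun_prop)
    (measurableSet_le (by fun_prop) measurable_const), volume_disc _ (by positivity),
    ← ENNReal.ofReal_mul (abs_nonneg _), inv_inv, abs_of_pos hs, div_pow, Real.sq_sqrt ht]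
  congr 1
  field_simp

theorem finite_quadratic_roots {α : ℝ} (hα : α ≠ 0) (β γ : ℝ) :
    {x : ℝ | α * x ^ 2 + β * x + γ = 0}.Finite := by
  have hp : (Polynomial.C α * Polynomial.X ^ 2 + Polynomial.C β * Polynomial.X
      + Polynomial.C γ) ≠ 0 := fun h => by
    have h2 := Polynomial.natDegree_quadratic (b := β) (c := γ) hα
    rw [h] at h2
    simp at h2
  refine (Polynomial.finite_setOfPred_isRoot hp).subset fun x hx => ?_
  simpa [Polynomial.IsRoot] using hx

namespace IsAdapted

variable {A B a r h₀ h : ℝ} {z : ℝ × ℝ}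

/-- For each q in range, the level equation is quadratic in p with leading coefficient A q² + B q +
1 ≠ 0, so every slice is finite. -/
theorem volume_level (H : IsAdapted A B a r h₀) (h : ℝ) :
    volume {z : ℝ × ℝ | ‖z‖ < r ∧ mcmInvariant A B a z = h} = 0 := by
  have hm : MeasurableSet {z : ℝ × ℝ | ‖z‖ < r ∧ mcmInvariant A B a z = h} :=
    (measurableSet_lt measurable_norm measurable_const).inter
      (measurableSet_eq_fun (continuous_mcmInvariant A B a).measurable measurable_const)
  rw [Measure.volume_eq_prod, Measure.measure_prod_null hm]
  refine Eventually.of_forall fun q => ?_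
  rcases lt_or_ge |q| r with hq | hq
  · refine ((finite_quadratic_roots (H.denom q hq).ne' (B * q ^ 2 - a * q)
      (q ^ 2 - h)).subset fun p hp => ?_).measure_zero _
    have := hp.2
    simp only [mcmInvariant] at this
    simp only [mem_ofPred_eq]
    linear_combination this
  · have : Prod.mk q ⁻¹' {z : ℝ × ℝ | ‖z‖ < r ∧ mcmInvariant A B a z = h} = ∅ := by
      refine eq_empty_of_forall_notMem fun p hp => ?_
      have h1 : |q| ≤ ‖(q, p)‖ := norm_fst_le (q, p)
      linarith [hp.1]
    simp only [this, measure_empty, Pi.zero_apply]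

theorem measurableSet_disc (A B a r h : ℝ) : MeasurableSet (disc A B a r h) :=
  (measurableSet_lt measurable_norm measurable_const).inter
    (measurableSet_le (continuous_mcmInvariant A B a).measurable measurable_const)

theorem volume_disc_lt_top (A B a r h : ℝ) : volume (disc A B a r h) < ⊤ := by
  refine lt_of_le_of_lt (measure_mono fun z hz => ?_)
    (measure_ball_lt_top (μ := (volume : Measure (ℝ × ℝ))) (x := 0) (r := r))
  exact mem_ball_zero_iff.2 hz.1

theorem volume_disc_zero (H : IsAdapted A B a r h₀) : volume (disc A B a r 0) = 0 := by
  refine measure_mono_null (fun z hz => ?_) (H.volume_level 0)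
  refine ⟨hz.1, le_antisymm hz.2 ?_⟩
  have := H.le_mcmInvariant hz.1.le
  have h2 := mul_nonneg (half_pos H.c_pos).le (sq_nonneg ‖z‖)
  linarith

/-- Dominated convergence: the indicator of K ≤ h', as a function of h', is continuous at h except
where K = h, and this level set is null. -/
theorem continuous_volume_disc (H : IsAdapted A B a r h₀) :
    Continuous fun h => (volume (disc A B a r h)).toReal := by
  have h1 : ∀ h, (volume (disc A B a r h)).toReal =
      ∫ z in Metric.ball (0 : ℝ × ℝ) r, (if mcmInvariant A B a z ≤ h then (1 : ℝ) else 0) := by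
    intro h
    have e1 : (fun z => if mcmInvariant A B a z ≤ h then (1 : ℝ) else 0) =
        {z | mcmInvariant A B a z ≤ h}.indicator 1 := by
      ext z
      simp [indicator_apply]
    have hm : MeasurableSet {z | mcmInvariant A B a z ≤ h} :=
      measurableSet_le (continuous_mcmInvariant A B a).measurable measurable_const
    rw [e1, integral_indicator_one hm, measureReal_restrict_apply hm, Measure.real]
    congr 2
    ext z
    simp only [disc, mem_ofPred_eq, mem_inter_iff, mem_ball_zero_iff]
    exact and_comm
  simp only [h1]
  refine continuous_iff_continuousAt.2 fun h => ?_
  refine continuousAt_of_dominated (bound := fun _ => 1) (Eventually.of_forall fun h' => ?_)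
    (Eventually.of_forall fun h' => Eventually.of_forall fun z => ?_) ?_ ?_
  · refine Measurable.aestronglyMeasurable ?_
    exact Measurable.ite
      (measurableSet_le (continuous_mcmInvariant A B a).measurable measurable_const)
      measurable_const measurable_const
  · split_ifs <;> simp
  · exact integrableOn_const measure_ball_lt_top.ne
  · rw [ae_restrict_iff' measurableSet_ball]
    have h2 : ∀ᵐ z : ℝ × ℝ, ¬(‖z‖ < r ∧ mcmInvariant A B a z = h) :=
      measure_eq_zero_iff_ae_notMem.1 (H.volume_level h)
    filter_upwards [h2] with z hz hzb
    rw [mem_ball_zero_iff] at hzb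
    rcases lt_trichotomy (mcmInvariant A B a z) h with h3 | h3 | h3
    · refine (continuousAt_const (y := (1 : ℝ))).congr ?_
      filter_upwards [lt_mem_nhds h3] with h' h4
      rw [if_pos h4.le]
    · exact absurd ⟨hzb, h3⟩ hz
    · refine (continuousAt_const (y := (0 : ℝ))).congr ?_
      filter_upwards [gt_mem_nhds h3] with h' h4
      rw [if_neg (not_le.2 h4)]

/-- The open shell between two energies is nonempty, hence of positive area. -/
theorem strictMonoOn_volume_disc (H : IsAdapted A B a r h₀) :
    StrictMonoOn (fun h => (volume (disc A B a r h)).toReal) (Icc 0 h₀) := by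
  intro x hx y hy hxy
  refine (ENNReal.toReal_lt_toReal (volume_disc_lt_top ..).ne (volume_disc_lt_top ..).ne).2 ?_
  set U : Set (ℝ × ℝ) := {z | ‖z‖ < r ∧ x < mcmInvariant A B a z ∧ mcmInvariant A B a z < y}
  have hUo : IsOpen U := (isOpen_lt continuous_norm continuous_const).inter
    ((isOpen_lt continuous_const (continuous_mcmInvariant A B a)).inter
      (isOpen_lt (continuous_mcmInvariant A B a) continuous_const))
  have hUn : U.Nonempty := by
    obtain ⟨t, -, h1, h2⟩ := H.exists_radius (h := (x + y) / 2) (by linarith [hx.1])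
      (by linarith [hy.2]) 0
    exact ⟨_, h1, by rw [h2]; linarith, by rw [h2]; linarith⟩
  have hpos := hUo.measure_pos volume hUn
  have hdisj : Disjoint (disc A B a r x) U :=
    disjoint_left.2 fun z hz hzU => absurd hz.2 (not_le.2 hzU.2.1)
  have hsub : disc A B a r x ∪ U ⊆ disc A B a r y := by
    rintro z (hz | hz)
    · exact ⟨hz.1, hz.2.trans hxy.le⟩
    · exact ⟨hz.1, hz.2.2.le⟩
  refine lt_of_lt_of_le ?_ (measure_mono hsub)
  rw [measure_union hdisj hUo.measurableSet]
  exact ENNReal.lt_add_right (volume_disc_lt_top ..).ne hpos.ne'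

/-- The invariant differs from its quadratic part by a small factor. -/
theorem abs_sub_quadInv_le (H : IsAdapted A B a r h₀) (hz : ‖z‖ ≤ r)
    (hzh : ellipticity a * ‖z‖ ^ 2 ≤ 2 * h) :
    |mcmInvariant A B a z - quadInv a z| ≤
      (2 * |B| + |A|) / ellipticity a * √(2 / ellipticity a * h) * quadInv a z := by
  have hc := H.c_pos
  have h1 := abs_cubInv_le B z
  have h2 := abs_quartInv_le A z
  have hz1 : ‖z‖ ≤ 1 := hz.trans H.r_le_one
  have h3 : |A| * ‖z‖ ^ 4 ≤ |A| * ‖z‖ ^ 3 := by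
    gcongr ?_ * ?_
    exact pow_le_pow_of_le_one (norm_nonneg z) hz1 (by norm_num)
  have h4 : ‖z‖ ≤ √(2 / ellipticity a * h) := by
    refine Real.le_sqrt_of_sq_le ?_
    rw [div_mul_eq_mul_div, le_div_iff₀ hc]
    linarith
  have h5 := le_quadInv H.abs_lt_two z
  calc |mcmInvariant A B a z - quadInv a z| = |cubInv B z + quartInv A z| := by
        rw [mcmInvariant_eq]; congr 1; ring
    _ ≤ (2 * |B| + |A|) * ‖z‖ ^ 3 := by
        refine (abs_add_le _ _).trans ?_
        linarith
    _ = (2 * |B| + |A|) / ellipticity a * ‖z‖ * (ellipticity a * ‖z‖ ^ 2) := by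
        field_simp
    _ ≤ _ := by gcongr

/-- At energy h the relative difference of K and Q is at most ε = O(√h), so the disc lies between
the ellipses Q ≤ h / (1 + ε) and Q ≤ h / (1 - ε). -/
theorem tendsto_volume_disc (H : IsAdapted A B a r h₀) {Φ : ℝ} (ha : a = 2 * Real.cos Φ)
    (hs : 0 < Real.sin Φ) :
    Tendsto (fun h => (volume (disc A B a r h)).toReal / h) (𝓝[>] 0)
      (𝓝 (Real.pi / Real.sin Φ)) := by
  set ε : ℝ → ℝ := fun h => (2 * |B| + |A|) / ellipticity a * √(2 / ellipticity a * h) with hε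
  have hεc : Continuous ε := by fun_prop
  have hε0 : ε 0 = 0 := by simp [hε]
  have hεt : Tendsto ε (𝓝[>] 0) (𝓝 0) := by
    have := hεc.tendsto 0
    rw [hε0] at this
    exact this.mono_left nhdsWithin_le_nhds
  have hεn : ∀ h, 0 ≤ ε h := fun h => by
    have := H.c_pos
    positivity
  have l1 : Tendsto (fun h => Real.pi / Real.sin Φ / (1 + ε h)) (𝓝[>] 0)
      (𝓝 (Real.pi / Real.sin Φ)) := by
    have : Tendsto (fun h => Real.pi / Real.sin Φ / (1 + ε h)) (𝓝[>] 0)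
        (𝓝 (Real.pi / Real.sin Φ / (1 + 0))) := tendsto_const_nhds.div
      ((tendsto_const_nhds (x := (1 : ℝ))).add hεt) (by norm_num)
    rwa [add_zero, div_one] at this
  have l2 : Tendsto (fun h => Real.pi / Real.sin Φ / (1 - ε h)) (𝓝[>] 0)
      (𝓝 (Real.pi / Real.sin Φ)) := by
    have : Tendsto (fun h => Real.pi / Real.sin Φ / (1 - ε h)) (𝓝[>] 0)
        (𝓝 (Real.pi / Real.sin Φ / (1 - 0))) := tendsto_const_nhds.div
      ((tendsto_const_nhds (x := (1 : ℝ))).sub hεt) (by norm_num)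
    rwa [sub_zero, div_one] at this
  have hsmall : ∀ᶠ h in 𝓝[>] (0 : ℝ), ε h < 1 ∧ h ≤ h₀ ∧ 0 < h := by
    filter_upwards [hεt.eventually (gt_mem_nhds one_pos),
      (gt_mem_nhds H.h_pos).filter_mono nhdsWithin_le_nhds, self_mem_nhdsWithin] with h h1 h2 h3
    exact ⟨h1, h2.le, h3⟩
  refine tendsto_of_tendsto_of_tendsto_of_le_of_le' l1 l2 ?_ ?_
  · filter_upwards [hsmall] with h ⟨h1, h2, h3⟩
    have hpos : 0 < 1 + ε h := by linarith [hεn h]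
    have hsub : {z | quadInv a z ≤ h / (1 + ε h)} ⊆ disc A B a r h := by
      intro z hz
      have hz' : quadInv a z * (1 + ε h) ≤ h := (le_div_iff₀ hpos).1 hz
      have e0 := le_quadInv H.abs_lt_two z
      have e1 : 0 ≤ quadInv a z := (mul_nonneg H.c_pos.le (sq_nonneg _)).trans e0
      have e2 : quadInv a z ≤ h := by nlinarith [mul_nonneg e1 (hεn h)]
      have e3 : ‖z‖ < r := by
        have h4 : ellipticity a * ‖z‖ ^ 2 < ellipticity a * r ^ 2 := by linarith [H.h_lt, H.h_pos]
        exact lt_of_pow_lt_pow_left₀ 2 H.r_pos.le (lt_of_mul_lt_mul_left h4 H.c_pos.le)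
      have e4 := (abs_le.1 (H.abs_sub_quadInv_le e3.le (h := h) (by linarith))).2
      refine ⟨e3, ?_⟩
      change _ ≤ ε h * quadInv a z at e4
      linarith
    have hle := ENNReal.toReal_mono (volume_disc_lt_top ..).ne (measure_mono hsub)
    rw [volume_quadInv_le ha hs (by positivity), ENNReal.toReal_ofReal (by positivity)] at hle
    rw [le_div_iff₀ h3]
    refine le_trans (le_of_eq ?_) hle
    field_simp
  · filter_upwards [hsmall] with h ⟨h1, h2, h3⟩
    have hpos : 0 < 1 - ε h := by linarith
    have hsub : disc A B a r h ⊆ {z | quadInv a z ≤ h / (1 - ε h)} := by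
      intro z hz
      have e4 := (abs_le.1 (H.abs_sub_quadInv_le hz.1.le (h := h)
        (H.norm_sq_le_of_le hz.1.le hz.2))).1
      change -(ε h * quadInv a z) ≤ _ at e4
      rw [mem_ofPred_eq, le_div_iff₀ hpos]
      linarith [hz.2]
    have hfin := volume_quadInv_le ha hs (t := h / (1 - ε h)) (by positivity)
    have hle := ENNReal.toReal_mono (by rw [hfin]; exact ENNReal.ofReal_ne_top)
      (measure_mono hsub)
    rw [hfin, ENNReal.toReal_ofReal (by positivity)] at hle
    rw [div_le_iff₀ h3]
    refine hle.trans (le_of_eq ?_)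
    field_simp

end IsAdapted

/-! ### Detuning of maps conjugate to a McMillan map -/

/-- E is closed and, being cut out by the open set U, also relatively open in the sublevel set; the
component of 0 cannot leave it. Nothing is required of K away from E, where it may be discontinuous.
-/
theorem region_eq_of_isClosed {K : ℝ × ℝ → ℝ} {h : ℝ} {E U : Set (ℝ × ℝ)}
    (hE : IsClosed E) (hEc : IsPreconnected E) (h0 : (0 : ℝ × ℝ) ∈ E) (hU : IsOpen U)
    (hEU : E = {z | K z ≤ h} ∩ U) : region K h = E := by
  have hES : E ⊆ {z | K z ≤ h} := by rw [hEU]; exact inter_subset_left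
  refine Subset.antisymm ?_ (hEc.subset_connectedComponentIn h0 hES)
  have hC : IsPreconnected (region K h) := isPreconnected_connectedComponentIn
  have hCS : region K h ⊆ {z | K z ≤ h} := connectedComponentIn_subset _ _
  have h0C : (0 : ℝ × ℝ) ∈ region K h := mem_connectedComponentIn (hES h0)
  have hcov : region K h ⊆ U ∪ Eᶜ := by
    intro z hz
    by_cases hzU : z ∈ U
    · exact Or.inl hzU
    · refine Or.inr fun hzE => hzU ?_
      rw [hEU] at hzE
      exact hzE.2
  have hdisj : region K h ∩ (U ∩ Eᶜ) = ∅ := by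
    refine eq_empty_of_forall_notMem fun z hz => hz.2.2 ?_
    rw [hEU]
    exact ⟨hCS hz.1, hz.2.1⟩
  have hCU := (isPreconnected_iff_subset_of_disjoint.1 hC U Eᶜ hU hE.isOpen_compl hcov
    hdisj).resolve_right fun h1 => h1 h0C h0
  intro z hz
  rw [hEU]
  exact ⟨hCS hz, hCU hz⟩

/-- The inverse of `fiberMap δ g`. -/
def fiberInv (δ : ℝ) (g : ℝ → ℝ) (w : ℝ × ℝ) : ℝ × ℝ := (w.1, (w.2 - g w.1) / δ)

theorem fiberInv_fiberMap {δ : ℝ} (hδ : δ ≠ 0) (g : ℝ → ℝ) (z : ℝ × ℝ) :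
    fiberInv δ g (fiberMap δ g z) = z := by
  ext <;> simp [fiberInv, fiberMap, hδ]

theorem fiberMap_fiberInv {δ : ℝ} (hδ : δ ≠ 0) (g : ℝ → ℝ) (w : ℝ × ℝ) :
    fiberMap δ g (fiberInv δ g w) = w := by
  ext
  · rfl
  · simp only [fiberInv, fiberMap]
    field_simp
    ring

theorem continuousAt_fiberMap (δ : ℝ) {g : ℝ → ℝ} {z : ℝ × ℝ} (hg : ContinuousAt g z.1) :
    ContinuousAt (fiberMap δ g) z := by
  have h1 : ContinuousAt (fun w : ℝ × ℝ => g w.1) z :=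
    ContinuousAt.comp (f := fun w : ℝ × ℝ => w.1) hg continuousAt_fst
  exact continuousAt_fst.prodMk ((continuousAt_const.mul continuousAt_snd).add h1)

theorem continuousAt_fiberInv (δ : ℝ) {g : ℝ → ℝ} {z : ℝ × ℝ} (hg : ContinuousAt g z.1) :
    ContinuousAt (fiberInv δ g) z := by
  have h1 : ContinuousAt (fun w : ℝ × ℝ => g w.1) z :=
    ContinuousAt.comp (f := fun w : ℝ × ℝ => w.1) hg continuousAt_fst
  exact continuousAt_fst.prodMk ((continuousAt_snd.sub h1).div_const δ)

theorem fiberMap_zero (δ : ℝ) {g : ℝ → ℝ} (hg : g 0 = 0) : fiberMap δ g 0 = 0 := by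
  simp [fiberMap, hg]

theorem IsAdapted.region_fiberMap {A B a r h₀ h δ : ℝ} {g : ℝ → ℝ} (H : IsAdapted A B a r h₀)
    (hδ : δ ≠ 0) (hg0 : g 0 = 0) (hgc : ∀ x, |x| < r → ContinuousAt g x) (hh0 : 0 ≤ h)
    (hh : h ≤ h₀) :
    IsCompact (fiberMap δ g ⁻¹' disc A B a r h) ∧
      region (fun z => mcmInvariant A B a (fiberMap δ g z)) h =
        fiberMap δ g ⁻¹' disc A B a r h := by
  have him : fiberMap δ g ⁻¹' disc A B a r h = fiberInv δ g '' disc A B a r h := by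
    ext z
    constructor
    · exact fun hz => ⟨_, hz, fiberInv_fiberMap hδ g z⟩
    · rintro ⟨w, hw, rfl⟩
      rw [mem_preimage, fiberMap_fiberInv hδ]
      exact hw
  have hcont : ContinuousOn (fiberInv δ g) (disc A B a r h) := fun w hw =>
    (continuousAt_fiberInv δ (hgc _ ((norm_fst_le w).trans_lt hw.1))).continuousWithinAt
  have hcomp : IsCompact (fiberMap δ g ⁻¹' disc A B a r h) := by
    rw [him]
    exact (H.isCompact_disc hh).image_of_continuousOn hcont
  refine ⟨hcomp, region_eq_of_isClosed (U := fiberMap δ g ⁻¹' Metric.ball 0 r)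
    hcomp.isClosed ?_ ?_ ?_ ?_⟩
  · rw [him]
    exact H.isPreconnected_disc.image _ hcont
  · rw [mem_preimage, fiberMap_zero δ hg0]
    exact H.zero_mem_disc hh0
  · refine isOpen_iff_mem_nhds.2 fun z hz => ?_
    rw [mem_preimage, mem_ball_zero_iff] at hz
    have h1 : |z.1| < r := (norm_fst_le (fiberMap δ g z)).trans_lt hz
    exact (continuousAt_fiberMap δ (hgc _ h1)).preimage_mem_nhds
      (Metric.isOpen_ball.mem_nhds (mem_ball_zero_iff.2 hz))
  · ext z
    simp only [disc, mem_preimage, mem_ofPred_eq, mem_inter_iff, mem_ball_zero_iff]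
    exact and_comm

theorem hasDerivAt_mcmForce (A B a : ℝ) : HasDerivAt (mcmForce A B a) a 0 := by
  have h1 : HasDerivAt (fun p : ℝ => a * p - B * p ^ 2) a 0 := by
    have h : HasDerivAt (fun p : ℝ => a * p - B * p ^ 2) (a * 1 - B * (2 * 0 ^ 1 * 1)) 0 :=
      ((hasDerivAt_id' (0 : ℝ)).const_mul a).sub (((hasDerivAt_id' (0 : ℝ)).fun_pow 2).const_mul B)
    rwa [show a * 1 - B * (2 * 0 ^ 1 * 1) = a by ring] at h
  have h2 : HasDerivAt (fun p : ℝ => A * p ^ 2 + B * p + 1) B 0 := by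
    have h : HasDerivAt (fun p : ℝ => A * p ^ 2 + B * p + 1) (A * (2 * 0 ^ 1 * 1) + B * 1) 0 :=
      ((((hasDerivAt_id' (0 : ℝ)).fun_pow 2).const_mul A).add
        ((hasDerivAt_id' (0 : ℝ)).const_mul B)).add_const 1
    rwa [show A * (2 * 0 ^ 1 * 1) + B * 1 = B by ring] at h
  have h3 := h1.div h2 (by norm_num)
  have h4 : (a * (A * (0 : ℝ) ^ 2 + B * 0 + 1) - (a * 0 - B * 0 ^ 2) * B)
      / (A * 0 ^ 2 + B * 0 + 1) ^ 2 = a := by norm_num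
  rw [h4] at h3
  exact h3

/-- In the coordinates of a map conjugate to a McMillan map by `fiberMap δ g`, orbits turn in the
same direction as for the McMillan map or in the opposite one, according to the sign of `δ`. -/
theorem eventually_turn {A B a u : ℝ} {g : ℝ → ℝ} (ha : |a| < 2)
    (hg : HasDerivAt g u 0) (hg0 : g 0 = 0) :
    ∀ᶠ w in 𝓝 (0 : ℝ × ℝ), w ≠ 0 →
      w.1 * (-w.1 + mcmForce A B a w.2 - g w.2) - (w.2 - g w.1) * w.2 < 0 := by
  have hc := ellipticity_pos ha
  have ef := (hasDerivAt_mcmForce A B a).isLittleO.def (show 0 < ellipticity a / 4 by positivity)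
  have eg := hg.isLittleO.def (show 0 < ellipticity a / 4 by positivity)
  simp only [mcmForce_zero, hg0, sub_zero, smul_eq_mul] at ef eg
  have c1 : Tendsto (fun w : ℝ × ℝ => w.1) (𝓝 0) (𝓝 0) := continuous_fst.tendsto 0
  have c2 : Tendsto (fun w : ℝ × ℝ => w.2) (𝓝 0) (𝓝 0) := continuous_snd.tendsto 0
  filter_upwards [c2.eventually ef, c2.eventually eg, c1.eventually eg] with w h1 h2 h3 hw
  have hn : 0 < ‖w‖ := norm_pos_iff.2 hw
  have n1 : |w.1| ≤ ‖w‖ := norm_fst_le w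
  have n2 : |w.2| ≤ ‖w‖ := norm_snd_le w
  simp only [Real.norm_eq_abs] at h1 h2 h3
  have bound : ∀ {x y t : ℝ}, |x| ≤ ‖w‖ → |y| ≤ ‖w‖ → |t| ≤ ellipticity a / 4 * |y| →
      |x * t| ≤ ellipticity a / 4 * ‖w‖ ^ 2 := by
    intro x y t hx hy ht
    rw [abs_mul]
    calc |x| * |t| ≤ ‖w‖ * (ellipticity a / 4 * ‖w‖) := by
          gcongr
          exact ht.trans (by gcongr)
      _ = ellipticity a / 4 * ‖w‖ ^ 2 := by ring
  have b1 := (abs_le.1 (bound n1 n2 h1)).2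
  have b2 := (abs_le.1 (bound n1 n2 h2)).1
  have b3 := (abs_le.1 (bound n2 n1 h3)).2
  have hq := le_quadInv ha w
  have hp : 0 < ellipticity a * ‖w‖ ^ 2 := by positivity
  -- The linear part u of g contributes -u q p + u p q = 0, so the shear does not affect the leading
  -- term -`quadInv a w`.
  have key : w.1 * (-w.1 + mcmForce A B a w.2 - g w.2) - (w.2 - g w.1) * w.2 =
      -quadInv a w + w.1 * (mcmForce A B a w.2 - w.2 * a) - w.1 * (g w.2 - w.2 * u)
        + w.2 * (g w.1 - w.1 * u) := by
    simp only [quadInv]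
    ring
  rw [key]
  linarith

theorem tendsto_div_of_abs_sub_le {s t : ℕ → ℝ} {ν b e C : ℝ}
    (h : Tendsto (fun N : ℕ => s N / (2 * Real.pi * N)) atTop (𝓝 ν))
    (hst : ∀ N : ℕ, |t N - (2 * Real.pi * N * b + e * s N)| ≤ C) :
    Tendsto (fun N : ℕ => t N / (2 * Real.pi * N)) atTop (𝓝 (b + e * ν)) := by
  have h1 : Tendsto (fun N : ℕ => (t N - (2 * Real.pi * N * b + e * s N)) / (2 * Real.pi * N))
      atTop (𝓝 0) := by
    have h2 : Tendsto (fun N : ℕ => C / (2 * Real.pi) / N) atTop (𝓝 0) :=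
      tendsto_const_div_atTop_nhds_zero_nat _
    refine squeeze_zero_norm (fun N => ?_) h2
    rw [Real.norm_eq_abs, abs_div, div_div,
      abs_of_nonneg (by positivity : 0 ≤ 2 * Real.pi * (N : ℝ))]
    exact div_le_div_of_nonneg_right (hst N) (by positivity)
  have h3 := (h1.add ((h.const_mul e).const_add b))
  rw [zero_add] at h3
  refine h3.congr' ?_
  filter_upwards [eventually_gt_atTop 0] with N hN
  have hN' : (0 : ℝ) < N := by exact_mod_cast hN
  have := Real.pi_pos
  field_simp
  ring

theorem arg_conj_div {z w : ℂ} (h : 0 < (w / z).im) :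
    (starRingEnd ℂ w / starRingEnd ℂ z).arg = -(w / z).arg := by
  rw [← map_div₀, Complex.arg_conj, if_neg]
  intro hpi
  rw [Complex.arg_eq_pi_iff] at hpi
  exact h.ne' hpi.2

/-- The angle of a rotation, reduced to `(0, π)` up to the direction. -/
theorem exists_reduced_angle {Φ ν₀ : ℝ} (hs : Real.sin Φ ≠ 0) (hΦ : Φ = 2 * Real.pi * ν₀) :
    ∃ e b θ : ℝ, ((e = 1 ∧ b = 0) ∨ (e = -1 ∧ b = 1)) ∧ 0 < θ ∧ θ < Real.pi ∧
      Real.cos θ = Real.cos Φ ∧ Real.sin θ = e * Real.sin Φ ∧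
      Int.fract ν₀ = b + e * (θ / (2 * Real.pi)) := by
  have hpi := Real.pi_pos
  set x := 2 * Real.pi * Int.fract ν₀ with hx
  have hx0 : 0 ≤ x := mul_nonneg (by positivity) (Int.fract_nonneg _)
  have hx1 : x < 2 * Real.pi := by
    have := Int.fract_lt_one ν₀
    nlinarith
  have hxΦ : x = Φ - (⌊ν₀⌋ : ℝ) * (2 * Real.pi) := by
    rw [hx, hΦ, Int.fract]
    ring
  have hcos : Real.cos x = Real.cos Φ := by rw [hxΦ, Real.cos_sub_int_mul_two_pi]
  have hsin : Real.sin x = Real.sin Φ := by rw [hxΦ, Real.sin_sub_int_mul_two_pi]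
  have hfr : Int.fract ν₀ = x / (2 * Real.pi) := by rw [hx]; field_simp
  rcases lt_or_ge x Real.pi with h1 | h1
  · refine ⟨1, 0, x, Or.inl ⟨rfl, rfl⟩, lt_of_le_of_ne hx0 ?_, h1, hcos, by rw [hsin, one_mul], ?_⟩
    · intro h
      rw [← h, Real.sin_zero] at hsin
      exact hs hsin.symm
    · rw [hfr]; ring
  -- A clockwise turn by x in (π, 2π) is an anticlockwise one by 2π - x; this is the case e = -1, b
  -- = 1.
  · refine ⟨-1, 1, 2 * Real.pi - x, Or.inr ⟨rfl, rfl⟩, by linarith, ?_, ?_, ?_, ?_⟩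
    · rcases h1.eq_or_lt with h | h
      · rw [← h, Real.sin_pi] at hsin
        exact absurd hsin.symm hs
      · linarith
    · rw [Real.cos_two_pi_sub, hcos]
    · rw [Real.sin_two_pi_sub, hsin]; ring
    · rw [hfr]; field_simp; ring

/-- For δ > 0 the two orbits turn in the same sense and stay in relative half planes, so their total
angles differ by at most π. For δ < 0 this holds after complex conjugation of the orbit of T, and
conjugation turns a step of angle x into 2π - x; hence 1 - ν. -/
theorem hasRotationNumber_of_fiberMap {A B a r h₀ h δ e b ν : ℝ} {g : ℝ → ℝ} {α : ℂ}
    {T : ℝ × ℝ → ℝ × ℝ} (H : IsAdapted A B a r h₀) (hδ : 0 < e * δ)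
    (heb : (e = 1 ∧ b = 0) ∨ (e = -1 ∧ b = 1))
    (hT : ∀ z, fiberMap δ g (T z) = planarMap (mcmForce A B a) (fiberMap δ g z))
    (hcone : ∀ w : ℝ × ℝ, ‖w‖ < r → w ≠ 0 →
      0 < (toC (w.1, e * ((w.2 - g w.1) / δ)) * starRingEnd ℂ (α * toC w)).re)
    (hturn : ∀ w : ℝ × ℝ, ‖w‖ < r → w ≠ 0 →
      w.1 * (-w.1 + mcmForce A B a w.2 - g w.2) - (w.2 - g w.1) * w.2 < 0)
    (hh0 : 0 < h) (hh : h ≤ h₀) {z : ℝ × ℝ} (hz : ‖fiberMap δ g z‖ < r)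
    (hK : mcmInvariant A B a (fiberMap δ g z) = h)
    (hν : HasRotationNumber (planarMap (mcmForce A B a)) (fiberMap δ g z) ν) :
    HasRotationNumber T z (b + e * ν) := by
  set P := planarMap (mcmForce A B a) with hP
  set G := fiberMap δ g with hG
  have hδ0 : δ ≠ 0 := fun h => by rw [h, mul_zero] at hδ; exact hδ.false
  have horb := H.iterate hh hz hK
  have hne : ∀ j, P^[j] (G z) ≠ 0 := fun j => IsAdapted.ne_zero hh0 (horb j).2
  have hGz : ∀ j, G (T^[j] z) = P^[j] (G z) := by
    intro j
    induction j with
    | zero => rfl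
    | succ j ih => rw [Function.iterate_succ_apply', Function.iterate_succ_apply', hT, ih]
  have hz' : ∀ j, T^[j] z = fiberInv δ g (P^[j] (G z)) := fun j => by
    rw [← hGz, hG, fiberInv_fiberMap hδ0]
  have hPs : ∀ j, P^[j + 1] (G z) = P (P^[j] (G z)) := fun j => Function.iterate_succ_apply' P j _
  -- If T^[j] z were 0, its image w would satisfy w.1 = 0 and w.2 = g w.1, and the expression in
  -- `hturn` would vanish.
  have hz1 : ∀ j, T^[j] z ≠ 0 := fun j h0 => by
    have h1 := hGz j
    rw [h0] at h1
    have h2 := hturn _ (horb j).1 (hne j)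
    have h3 := congrArg Prod.fst (hz' j)
    have h4 := congrArg Prod.snd (hz' j)
    rw [h0] at h3 h4
    simp only [fiberInv, Prod.fst_zero, Prod.snd_zero] at h3 h4
    rw [eq_comm, div_eq_zero_iff, or_iff_left hδ0] at h4
    rw [← h3] at h4
    rw [← h3, h4] at h2
    simp at h2
  -- The expression in `hturn` is δ times the cross product of consecutive points pulled back by
  -- `fiberInv`.
  have hcross : ∀ j, δ * ((T^[j] z).1 * (T^[j + 1] z).2 - (T^[j] z).2 * (T^[j + 1] z).1) < 0 := by
    intro j
    have h1 := hturn _ (horb j).1 (hne j)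
    rw [hz' j, hz' (j + 1), hPs j]
    refine lt_of_eq_of_lt ?_ h1
    simp only [fiberInv, hP, planarMap]
    field_simp
  have hwneg : ∀ j, (toC (P^[j + 1] (G z)) / toC (P^[j] (G z))).im < 0 := fun j => by
    rw [hPs]; exact H.im_div_neg (horb j).1 (hne j)
  have hws : ∀ N, ∑ j ∈ Finset.range N, angleStep (P^[j] (G z)) (P^[j + 1] (G z)) =
      -∑ j ∈ Finset.range N, (toC (P^[j + 1] (G z)) / toC (P^[j] (G z))).arg := fun N => by
    rw [← Finset.sum_neg_distrib]
    exact Finset.sum_congr rfl fun j _ => angleStep_of_im_neg (hwneg j)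
  refine tendsto_div_of_abs_sub_le (C := Real.pi) hν fun N => ?_
  rw [hws]
  have hcone' := fun j => hcone _ (horb j).1 (hne j)
  rcases heb with ⟨rfl, rfl⟩ | ⟨rfl, rfl⟩
  · have hneg : ∀ j, (toC (T^[j + 1] z) / toC (T^[j] z)).im < 0 := fun j => by
      rw [im_div_neg_iff (hz1 j)]
      have h1 := hcross j
      rw [one_mul] at hδ
      by_contra hcon
      exact absurd (mul_nonneg hδ.le (not_lt.1 hcon)) (not_le.2 h1)
    have hsum := abs_sum_arg_div_sub_le (z := fun j => toC (P^[j] (G z)))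
      (w := fun j => toC (T^[j] z)) (α := α) (fun j => by
        have h1 := hcone' j
        rw [one_mul] at h1
        rw [hz' j]
        exact h1) (fun j => Or.inl ⟨hwneg j, hneg j⟩) N
    have hts : ∑ j ∈ Finset.range N, angleStep (T^[j] z) (T^[j + 1] z) =
        -∑ j ∈ Finset.range N, (toC (T^[j + 1] z) / toC (T^[j] z)).arg := by
      rw [← Finset.sum_neg_distrib]
      exact Finset.sum_congr rfl fun j _ => angleStep_of_im_neg (hneg j)
    rw [hts]
    rw [abs_le] at hsum ⊢
    constructor <;> linarith [hsum.1, hsum.2]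
  · have hpos : ∀ j, 0 < (toC (T^[j + 1] z) / toC (T^[j] z)).im := fun j => by
      rw [im_div_pos_iff (hz1 j)]
      have h1 := hcross j
      by_contra hcon
      have h2 : 0 ≤ δ * ((T^[j] z).1 * (T^[j + 1] z).2 - (T^[j] z).2 * (T^[j + 1] z).1) :=
        mul_nonneg_of_nonpos_of_nonpos (by linarith) (not_lt.1 hcon)
      exact absurd h2 (not_le.2 h1)
    have hsum := abs_sum_arg_div_sub_le (z := fun j => toC (P^[j] (G z)))
      (w := fun j => starRingEnd ℂ (toC (T^[j] z))) (α := α) (fun j => by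
        have h1 := hcone' j
        have h2 : starRingEnd ℂ (toC (T^[j] z)) = toC ((P^[j] (G z)).1,
            -1 * (((P^[j] (G z)).2 - g (P^[j] (G z)).1) / δ)) := by
          rw [hz' j]
          apply Complex.ext <;> simp [toC, fiberInv]
        rw [h2]
        exact h1) (fun j => Or.inl ⟨hwneg j, by
          rw [← map_div₀, Complex.conj_im]
          linarith [hpos j]⟩) N
    have hts : ∑ j ∈ Finset.range N, angleStep (T^[j] z) (T^[j + 1] z) =
        2 * Real.pi * N + ∑ j ∈ Finset.range N,
          (starRingEnd ℂ (toC (T^[j + 1] z)) / starRingEnd ℂ (toC (T^[j] z))).arg := by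
      have h1 : (2 * Real.pi * N : ℝ) = ∑ _j ∈ Finset.range N, 2 * Real.pi := by
        rw [Finset.sum_const, Finset.card_range, nsmul_eq_mul]
        ring
      rw [h1, ← Finset.sum_add_distrib]
      refine Finset.sum_congr rfl fun j _ => ?_
      rw [angleStep_of_im_pos (hpos j), arg_conj_div (hpos j)]
      ring
    rw [hts]
    rw [abs_le] at hsum ⊢
    constructor <;> linarith [hsum.1, hsum.2]

theorem isLittleO_sqrt_cube : (fun h : ℝ => √h ^ 3) =o[𝓝[>] 0] fun h => h := by
  have h1 : (fun h : ℝ => √h) =o[𝓝[>] 0] fun _ => (1 : ℝ) := by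
    rw [Asymptotics.isLittleO_one_iff]
    have := Real.continuous_sqrt.tendsto 0
    rw [Real.sqrt_zero] at this
    exact this.mono_left nhdsWithin_le_nhds
  have h2 := h1.mul_isBigO (Asymptotics.isBigO_refl (fun h : ℝ => h) (𝓝[>] 0))
  simp only [one_mul] at h2
  refine h2.congr' ?_ EventuallyEq.rfl
  filter_upwards [self_mem_nhdsWithin] with h hh
  have h3 : √h ^ 2 = h := Real.sq_sqrt (le_of_lt hh)
  calc √h * h = √h * √h ^ 2 := by rw [h3]
    _ = √h ^ 3 := by ring

/-- A function of the energy that is differentiable with respect to a strictly increasing action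
extends to a function of the action with that derivative at zero. -/
theorem exists_function_of_action {J n : ℝ → ℝ} {h₀ ν₀ τ κ : ℝ} (h0 : 0 < h₀)
    (hJ0 : J 0 = 0) (hJ : StrictMonoOn J (Icc 0 h₀)) (hκ : 0 < κ)
    (hJκ : Tendsto (fun h => J h / h) (𝓝[>] 0) (𝓝 κ))
    (hn : (fun h => n h - ν₀ - τ * J h) =o[𝓝[>] 0] fun h => h) :
    ∃ ν : ℝ → ℝ, ν 0 = ν₀ ∧ (∀ h ∈ Ioc 0 h₀, ν (J h) = n h) ∧
      HasDerivWithinAt ν τ (Ici 0) 0 := by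
  classical
  have hinj : ∀ h ∈ Ioc 0 h₀, ∀ h' ∈ Ioc 0 h₀, J h' = J h → h' = h := fun h hh h' hh' heq =>
    hJ.injOn (Ioc_subset_Icc_self hh') (Ioc_subset_Icc_self hh) heq
  -- Off the range of J the value is the tangent line, so the derivative needs checking only on the
  -- range.
  let ν : ℝ → ℝ := fun x =>
    if hx : ∃ h ∈ Ioc 0 h₀, J h = x then n hx.choose else ν₀ + τ * x
  have hν1 : ∀ h ∈ Ioc 0 h₀, ν (J h) = n h := by
    intro h hh
    have hx : ∃ h' ∈ Ioc 0 h₀, J h' = J h := ⟨h, hh, rfl⟩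
    have h1 : ν (J h) = n hx.choose := dif_pos hx
    rw [h1, hinj h hh _ hx.choose_spec.1 hx.choose_spec.2]
  have hJpos : ∀ h ∈ Ioc 0 h₀, 0 < J h := fun h hh => by
    rw [← hJ0]
    exact hJ ⟨le_rfl, h0.le⟩ (Ioc_subset_Icc_self hh) hh.1
  have hν0 : ν 0 = ν₀ := by
    have hx : ¬∃ h ∈ Ioc 0 h₀, J h = 0 := fun ⟨h, hh, h1⟩ => (hJpos h hh).ne' h1
    have h1 : ν 0 = ν₀ + τ * 0 := dif_neg hx
    rw [h1, mul_zero, add_zero]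
  refine ⟨ν, hν0, hν1, ?_⟩
  rw [hasDerivWithinAt_iff_isLittleO, Asymptotics.isLittleO_iff]
  intro ε hε
  have e1 := hn.def (show 0 < ε * (κ / 2) by positivity)
  have e2 : ∀ᶠ h in 𝓝[>] (0 : ℝ), κ / 2 < J h / h := hJκ.eventually (lt_mem_nhds (by linarith))
  obtain ⟨η, hη, hη'⟩ := (mem_nhdsGT_iff_exists_Ioo_subset.1 (e1.and e2))
  set m := min (η / 2) h₀ with hm
  have hmpos : 0 < m := lt_min (half_pos hη) h0
  have hmem : m ∈ Ioc 0 h₀ := ⟨hmpos, min_le_right _ _⟩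
  have e3 : ∀ᶠ x in 𝓝[≥] (0 : ℝ), x < J m ∧ 0 ≤ x := by
    filter_upwards [(gt_mem_nhds (hJpos m hmem)).filter_mono nhdsWithin_le_nhds,
      self_mem_nhdsWithin] with x h1 h2
    exact ⟨h1, h2⟩
  filter_upwards [e3] with x hx
  rw [hν0, sub_zero, smul_eq_mul]
  by_cases hex : ∃ h ∈ Ioc 0 h₀, J h = x
  · obtain ⟨h, hh, rfl⟩ := hex
    rw [hν1 h hh]
    have hhm : h < m :=
      (hJ.lt_iff_lt (Ioc_subset_Icc_self hh) (Ioc_subset_Icc_self hmem)).1 hx.1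
    have hhη : h ∈ Ioo 0 η := ⟨hh.1, hhm.trans_le ((min_le_left _ _).trans (by
      have : (0 : ℝ) < η := hη
      linarith))⟩
    obtain ⟨h1, h2⟩ := hη' hhη
    rw [lt_div_iff₀ hh.1] at h2
    rw [Real.norm_of_nonneg hh.1.le] at h1
    rw [mul_comm (J h) τ, Real.norm_of_nonneg hx.2]
    refine h1.trans ?_
    rw [mul_assoc]
    exact mul_le_mul_of_nonneg_left h2.le hε.le
  · have h1 : ν x = ν₀ + τ * x := dif_neg hex
    rw [h1, show ν₀ + τ * x - ν₀ - x * τ = 0 by ring, norm_zero]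
    positivity

/-- Detuning of a map that is conjugate to a McMillan map by `fiberMap δ g`. -/
theorem hasDetuning_of_fiberMap {A B a Φ ν₀ δ u τ : ℝ} {g : ℝ → ℝ} {T : ℝ × ℝ → ℝ × ℝ}
    (hs : Real.sin Φ ≠ 0) (hΦ : Φ = 2 * Real.pi * ν₀) (ha : a = 2 * Real.cos Φ)
    (hδ : 0 < δ * Real.sin Φ) (hg : Measurable g) (hg0 : g 0 = 0)
    (hgc : ∀ᶠ x in 𝓝 0, ContinuousAt g x) (hgu : HasDerivAt g u 0)
    (hT : ∀ z, fiberMap δ g (T z) = planarMap (mcmForce A B a) (fiberMap δ g z))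
    (hτ : τ = twistRate A B a * Real.sin Φ ^ 2 * δ / Real.pi) :
    HasDetuning T (fun z => mcmInvariant A B a (fiberMap δ g z)) ν₀ τ := by
  obtain ⟨e, b, θ, heb, hθ0, hθpi, hcosθ, hsinθ, hfr⟩ := exists_reduced_angle hs hΦ
  have hpi := Real.pi_pos
  have haθ : a = 2 * Real.cos θ := by rw [hcosθ, ha]
  have hsθ : 0 < Real.sin θ := Real.sin_pos_of_pos_of_lt_pi hθ0 hθpi
  have hδ0 : δ ≠ 0 := fun h => by rw [h, zero_mul] at hδ; exact hδ.false
  have he2 : e * e = 1 := by rcases heb with ⟨rfl, -⟩ | ⟨rfl, -⟩ <;> norm_num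
  have heδ : 0 < e * δ := by
    have h1 : 0 < e * δ * Real.sin θ := by
      rw [hsinθ, show e * δ * (e * Real.sin Φ) = (e * e) * (δ * Real.sin Φ) by ring, he2, one_mul]
      exact hδ
    exact pos_of_mul_pos_left h1 hsθ.le
  have habs : |δ| = e * δ := by
    rcases heb with ⟨rfl, -⟩ | ⟨rfl, -⟩
    · rw [one_mul] at heδ ⊢; exact abs_of_pos heδ
    · rw [neg_one_mul] at heδ ⊢; exact abs_of_neg (by linarith)
  have ha2 : |a| < 2 := by
    have h1 := Real.cos_sq_add_sin_sq Φ
    have h2 : 0 < Real.sin Φ ^ 2 := by positivity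
    exact abs_lt.2 ⟨by nlinarith, by nlinarith⟩
  obtain ⟨C, ρ₁, hρ₁, hest⟩ := exists_rotationNumber_estimate A B haθ hθ0 hθpi
  -- The map undoes `fiberMap` and, if e = -1, reflects the second coordinate; its linear part has
  -- determinant e / δ > 0 in both cases.
  obtain ⟨α, hα⟩ := exists_half_plane (V := fun w => (w.1, e * ((w.2 - g w.1) / δ)))
    (u := -(e * u / δ)) (δ := e / δ) (by
      have : e / δ = e * δ / δ ^ 2 := by field_simp
      rw [this]; positivity) (by
      have h1 := hgu.isLittleO
      simp only [hg0, sub_zero, smul_eq_mul] at h1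
      have h2 := (h1.comp_tendsto (continuous_fst.tendsto (0 : ℝ × ℝ))).const_mul_left (-(e / δ))
      have h3 : (fun w : ℝ × ℝ => w.1) =O[𝓝 0] fun w => w :=
        Asymptotics.IsBigO.of_bound 1 (Eventually.of_forall fun w => by
          rw [one_mul]; exact norm_fst_le w)
      have h4 := h2.trans_isBigO h3
      refine (Asymptotics.IsLittleO.prod_left
        (Asymptotics.isLittleO_zero (E' := ℝ) _ _) h4).congr_left fun w => ?_
      ext
      · simp
      · simp only [Function.comp, Prod.snd_sub]
        field_simp
        ring)
  obtain ⟨ρ₂, hρ₂, hcone⟩ := Metric.eventually_nhds_iff_ball.1 hα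
  obtain ⟨ρ₃, hρ₃, hturn⟩ := Metric.eventually_nhds_iff_ball.1
    (eventually_turn (A := A) (B := B) ha2 hgu hg0)
  obtain ⟨ρ₄, hρ₄, hcont⟩ := Metric.eventually_nhds_iff_ball.1 hgc
  obtain ⟨r, hr, h₁, H₁⟩ := exists_isAdapted A B ha2
    (show 0 < min (min ρ₁ ρ₂) (min ρ₃ ρ₄) by positivity)
  have hr1 : r ≤ ρ₁ := hr.trans ((min_le_left _ _).trans (min_le_left _ _))
  have hr2 : r ≤ ρ₂ := hr.trans ((min_le_left _ _).trans (min_le_right _ _))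
  have hr3 : r ≤ ρ₃ := hr.trans ((min_le_right _ _).trans (min_le_left _ _))
  have hr4 : r ≤ ρ₄ := hr.trans ((min_le_right _ _).trans (min_le_right _ _))
  set μ := twistRate A B a with hμ
  -- the rotation number of the McMillan map
  have hex : ∀ h, ∃ ν : ℝ, 0 < h → h ≤ h₁ → ∀ z, ‖z‖ < r → mcmInvariant A B a z = h →
      HasRotationNumber (planarMap (mcmForce A B a)) z ν := by
    intro h
    by_cases hh : 0 < h ∧ h ≤ h₁
    · obtain ⟨ν, hν⟩ := H₁.exists_rotationNumber hh.1 hh.2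
      exact ⟨ν, fun _ _ => hν⟩
    · exact ⟨0, fun h1 h2 => absurd ⟨h1, h2⟩ hh⟩
  choose n hn using hex
  have hnest : ∀ h, 0 < h → h ≤ h₁ →
      |2 * Real.pi * n h - (θ + μ * Real.sin θ * h)| ≤ C * √h ^ 3 := by
    intro h h1 h2
    obtain ⟨t, -, ht1, ht2⟩ := H₁.exists_radius h1 h2 0
    exact hest r h₁ H₁ hr1 h h1 h2 _ _ ht1 ht2 (hn h h1 h2 _ ht1 ht2)
  have hno : (fun h => n h - θ / (2 * Real.pi) - μ * Real.sin θ / (2 * Real.pi) * h)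
      =o[𝓝[>] 0] fun h => h := by
    have h1 : (fun h => n h - θ / (2 * Real.pi) - μ * Real.sin θ / (2 * Real.pi) * h)
        =O[𝓝[>] 0] fun h => √h ^ 3 := by
      refine Asymptotics.IsBigO.of_bound (C / (2 * Real.pi)) ?_
      filter_upwards [(gt_mem_nhds H₁.h_pos).filter_mono nhdsWithin_le_nhds,
        self_mem_nhdsWithin] with h h2 h3
      have h4 := hnest h h3 h2.le
      have h5 : n h - θ / (2 * Real.pi) - μ * Real.sin θ / (2 * Real.pi) * h =
          (2 * Real.pi * n h - (θ + μ * Real.sin θ * h)) / (2 * Real.pi) := by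
        field_simp
        ring
      rw [h5, norm_div, Real.norm_eq_abs, Real.norm_of_nonneg (by positivity : 0 ≤ √h ^ 3),
        Real.norm_of_nonneg (by positivity : 0 ≤ 2 * Real.pi), div_mul_eq_mul_div]
      exact div_le_div_of_nonneg_right h4 (by positivity)
    exact h1.trans_isLittleO isLittleO_sqrt_cube
  have hnlim : Tendsto n (𝓝[>] 0) (𝓝 (θ / (2 * Real.pi))) := by
    have h1 : Tendsto (fun h : ℝ => h) (𝓝[>] 0) (𝓝 0) := nhdsWithin_le_nhds
    have h2 := hno.trans_tendsto h1
    have h3 := (h2.add (h1.const_mul (μ * Real.sin θ / (2 * Real.pi)))).add_const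
      (θ / (2 * Real.pi))
    rw [mul_zero, add_zero, zero_add] at h3
    refine h3.congr fun h => ?_
    ring
  have hθ2 : 0 < θ / (2 * Real.pi) ∧ θ / (2 * Real.pi) < 1 := by
    constructor
    · positivity
    · rw [div_lt_one (by positivity)]; linarith
  -- The energies are restricted so that n h stays in (0, 1]; then b + e n h lies in [0, 1) and is
  -- its own fractional part.
  obtain ⟨h₂, hh₂, hmem₂⟩ := mem_nhdsGT_iff_exists_Ioc_subset.1
    ((hnlim.eventually (lt_mem_nhds hθ2.1)).and (hnlim.eventually (gt_mem_nhds hθ2.2)))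
  set h₀ := min h₁ h₂ with hh₀
  have hh₀pos : 0 < h₀ := lt_min H₁.h_pos hh₂
  have H : IsAdapted A B a r h₀ := H₁.mono hh₀pos (min_le_left _ _)
  -- regions
  have hreg := fun {h : ℝ} (h1 : 0 ≤ h) (h2 : h ≤ h₀) => H.region_fiberMap hδ0 hg0
    (fun x hx => hcont x (mem_ball_zero_iff.2 (hx.trans_le hr4))) h1 h2
  set K : ℝ × ℝ → ℝ := fun z => mcmInvariant A B a (fiberMap δ g z) with hK
  have hact : ∀ h ∈ Icc 0 h₀, action K h =
      |δ⁻¹| / (2 * Real.pi) * (volume (disc A B a r h)).toReal := by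
    intro h hh
    rw [action, (hreg hh.1 hh.2).2, volume_preimage_fiberMap hδ0 hg
      (IsAdapted.measurableSet_disc ..), ENNReal.toReal_mul, ENNReal.toReal_ofReal (abs_nonneg _)]
    ring
  have hcpos : 0 < |δ⁻¹| / (2 * Real.pi) := by positivity
  have hact0 : action K 0 = 0 := by
    rw [hact 0 ⟨le_rfl, hh₀pos.le⟩, H.volume_disc_zero, ENNReal.toReal_zero, mul_zero]
  have hmono : StrictMonoOn (action K) (Icc 0 h₀) := by
    intro x hx y hy hxy
    rw [hact x hx, hact y hy]
    exact mul_lt_mul_of_pos_left (H.strictMonoOn_volume_disc hx hy hxy) hcpos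
  have hcontOn : ContinuousOn (action K) (Icc 0 h₀) :=
    (continuous_const.mul H.continuous_volume_disc).continuousOn.congr hact
  have hlim : Tendsto (fun h => action K h / h) (𝓝[>] 0)
      (𝓝 (|δ⁻¹| / (2 * Real.pi) * (Real.pi / Real.sin θ))) := by
    refine ((H.tendsto_volume_disc haθ hsθ).const_mul _).congr' ?_
    filter_upwards [(gt_mem_nhds hh₀pos).filter_mono nhdsWithin_le_nhds,
      self_mem_nhdsWithin] with h h1 h2
    rw [hact h ⟨le_of_lt h2, h1.le⟩]
    ring
  -- The limit of J / h is 1 / (2 |δ| sin θ), with |δ| = e δ.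
  have hκ : |δ⁻¹| / (2 * Real.pi) * (Real.pi / Real.sin θ) = e / (δ * (2 * Real.sin θ)) := by
    have he0 : e ≠ 0 := fun h => by rw [h, zero_mul] at he2; exact zero_ne_one he2
    rw [abs_inv, habs]
    field_simp
    rw [sq, he2]
  have hκpos : 0 < |δ⁻¹| / (2 * Real.pi) * (Real.pi / Real.sin θ) := by positivity
  -- the rotation number as a function of the action
  have hJo : (fun h => action K h - e / (δ * (2 * Real.sin θ)) * h) =o[𝓝[>] 0] fun h => h := by
    rw [hκ] at hlim
    rw [Asymptotics.isLittleO_iff_tendsto' (by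
      filter_upwards [self_mem_nhdsWithin] with h hh h0 using absurd h0 (ne_of_gt hh))]
    have h1 := hlim.sub_const (e / (δ * (2 * Real.sin θ)))
    rw [sub_self] at h1
    refine h1.congr' ?_
    filter_upwards [self_mem_nhdsWithin] with h hh
    have : h ≠ 0 := ne_of_gt hh
    field_simp
  -- The integer ⌊ν₀⌋ is restored because ν(0) = ν₀ is required exactly, not modulo one.
  obtain ⟨ν, hν0, hν1, hνd⟩ := exists_function_of_action (J := action K)
    (n := fun h => (⌊ν₀⌋ : ℝ) + (b + e * n h)) (ν₀ := ν₀) (τ := τ) hh₀pos hact0 hmono hκpos hlim (by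
      refine ((hno.const_mul_left e).sub (hJo.const_mul_left τ)).congr_left fun h => ?_
      have h1 : ν₀ = ⌊ν₀⌋ + (b + e * (θ / (2 * Real.pi))) := by
        rw [← hfr, Int.floor_add_fract]
      have h2 : e * (μ * Real.sin θ / (2 * Real.pi) * h) =
          τ * (e / (δ * (2 * Real.sin θ)) * h) := by
        have h3 : Real.sin Φ ^ 2 = Real.sin θ ^ 2 := by
          rw [hsinθ, mul_pow, sq e, he2, one_mul]
        rw [hτ, h3]
        field_simp
      linear_combination h1 - h2)
  refine ⟨ν, h₀, hh₀pos, hact0, hmono, hcontOn, fun h hh => ?_, hν0, hνd⟩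
  have hh1 : h ≤ h₁ := hh.2.trans (min_le_left _ _)
  obtain ⟨hcomp, hregh⟩ := hreg hh.1.le hh.2
  have hcurve : ∀ z, z ∈ curve K h ↔ ‖fiberMap δ g z‖ < r ∧
      mcmInvariant A B a (fiberMap δ g z) = h := by
    intro z
    rw [curve, hregh]
    simp only [disc, mem_preimage, mem_ofPred_eq, hK]
    exact ⟨fun h => ⟨h.1.1, h.2⟩, fun h => ⟨⟨h.1, h.2.le⟩, h.2⟩⟩
  refine ⟨by rw [hregh]; exact hcomp, ?_, ?_, ?_⟩
  · obtain ⟨t, -, ht1, ht2⟩ := H.exists_radius hh.1 hh.2 0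
    refine ⟨fiberInv δ g (t • unitDir 0), (hcurve _).2 ?_⟩
    rw [fiberMap_fiberInv hδ0]
    exact ⟨ht1, ht2⟩
  · intro z hz
    obtain ⟨hz1, hz2⟩ := (hcurve z).1 hz
    refine (hcurve _).2 ?_
    rw [hT]
    exact ⟨H.norm_map_lt hh.2 hz1 hz2.le, (H.invariant hz1).trans hz2⟩
  · intro z hz
    obtain ⟨hz1, hz2⟩ := (hcurve z).1 hz
    have hrot := hasRotationNumber_of_fiberMap H heδ heb hT
      (fun w hw hw0 => hcone w (mem_ball_zero_iff.2 (hw.trans_le hr2)) hw0)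
      (fun w hw hw0 => hturn w (mem_ball_zero_iff.2 (hw.trans_le hr3)) hw0)
      hh.1 hh.2 hz1 hz2 (hn h hh.1 hh1 _ hz1 hz2)
    obtain ⟨hb1, hb2⟩ := hmem₂ ⟨hh.1, hh.2.trans (min_le_right _ _)⟩
    have hfrac : Int.fract (ν (action K h)) = b + e * n h := by
      rw [hν1 h hh, Int.fract_intCast_add, Int.fract_eq_self]
      rcases heb with ⟨rfl, rfl⟩ | ⟨rfl, rfl⟩ <;> constructor <;> linarith
    rw [hfrac]
    exact hrot

/-! ### Smooth fibre maps -/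

/-- `fiberMap` as a homeomorphism. -/
def fiberHomeo {δ : ℝ} (hδ : δ ≠ 0) (g : ℝ → ℝ) (hg : Continuous g) :
    (ℝ × ℝ) ≃ₜ (ℝ × ℝ) where
  toFun := fiberMap δ g
  invFun := fiberInv δ g
  left_inv := fiberInv_fiberMap hδ g
  right_inv := fiberMap_fiberInv hδ g
  continuous_toFun := by unfold fiberMap; fun_prop
  continuous_invFun := by unfold fiberInv; fun_prop

theorem isSmoothArea_fiberHomeo {δ : ℝ} (hδ : δ ≠ 0) {g : ℝ → ℝ} (hg : ContDiff ℝ ∞ g)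
    (h0 : g 0 = 0) : IsSmoothArea δ (fiberHomeo hδ g hg.continuous) where
  map_zero := fiberMap_zero δ h0
  contDiff := by
    change ContDiff ℝ ∞ fun z : ℝ × ℝ => (z.1, δ * z.2 + g z.1)
    fun_prop
  contDiff_symm := by
    change ContDiff ℝ ∞ fun z : ℝ × ℝ => (z.1, (z.2 - g z.1) / δ)
    fun_prop
  det z := by
    change (fderiv ℝ (fun z : ℝ × ℝ => (z.1, δ * z.2 + g z.1)) z).det = δ
    have hg' : HasFDerivAt (fun z : ℝ × ℝ => g z.1)
        (deriv g z.1 • ContinuousLinearMap.fst ℝ ℝ ℝ) z :=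
      ((hg.differentiable (by simp)) z.1).hasDerivAt.comp_hasFDerivAt z hasFDerivAt_fst
    have h : HasFDerivAt (fun z : ℝ × ℝ => (z.1, δ * z.2 + g z.1))
        ((ContinuousLinearMap.fst ℝ ℝ ℝ).prod
          (δ • ContinuousLinearMap.snd ℝ ℝ ℝ + deriv g z.1 • ContinuousLinearMap.fst ℝ ℝ ℝ)) z :=
      hasFDerivAt_fst.prodMk ((hasFDerivAt_snd.const_mul δ).add hg')
    rw [h.fderiv, det_clm_prod]
    simp

theorem isSmoothArea_refl : IsSmoothArea 1 (Homeomorph.refl (ℝ × ℝ)) where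
  map_zero := rfl
  contDiff := contDiff_id
  contDiff_symm := contDiff_id
  det z := by
    change (fderiv ℝ (fun z : ℝ × ℝ => z) z).det = 1
    rw [fderiv_fun_id, ContinuousLinearMap.det]
    exact LinearMap.det_id

/-! ### Planar maps -/

theorem cos_sin_of_arccos {a ν₀ : ℝ} (ha : |a| < 2)
    (hν : ν₀ = Real.arccos (a / 2) / (2 * Real.pi)) :
    a = 2 * Real.cos (2 * Real.pi * ν₀) ∧ 0 < Real.sin (2 * Real.pi * ν₀) := by
  obtain ⟨h1, h2⟩ := abs_lt.1 ha
  have hpi := Real.pi_pos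
  have h3 : 2 * Real.pi * ν₀ = Real.arccos (a / 2) := by
    rw [hν]
    field_simp
  rw [h3, Real.cos_arccos (by linarith) (by linarith)]
  refine ⟨by ring, Real.sin_pos_of_pos_of_lt_pi (Real.arccos_pos.2 (by linarith)) ?_⟩
  rcases (Real.arccos_le_pi (a / 2)).lt_or_eq with h | h
  · exact h
  · rw [Real.arccos_eq_pi] at h
    linarith

theorem sin_ne_zero_of_abs_lt {a Φ : ℝ} (ha : a = 2 * Real.cos Φ) (ha2 : |a| < 2) :
    Real.sin Φ ≠ 0 := by
  intro h
  have h1 := Real.cos_sq_add_sin_sq Φ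
  obtain ⟨h2, h3⟩ := abs_lt.1 ha2
  rw [h] at h1
  nlinarith

theorem hasDetuning_planarMap {A B a ν₀ τ : ℝ} (hs : 0 < Real.sin (2 * Real.pi * ν₀))
    (ha : a = 2 * Real.cos (2 * Real.pi * ν₀))
    (hτ : τ = twistRate A B a * Real.sin (2 * Real.pi * ν₀) ^ 2 / Real.pi) :
    HasDetuning (planarMap (mcmForce A B a)) (mcmInvariant A B a) ν₀ τ := by
  have hid : ∀ z, fiberMap 1 (fun _ => 0) z = z := fun z => by simp [fiberMap]
  have h := hasDetuning_of_fiberMap (A := A) (B := B) (δ := 1) (u := 0) (g := fun _ => 0)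
    (τ := τ) (T := planarMap (mcmForce A B a)) hs.ne' rfl ha (by rwa [one_mul]) measurable_const rfl
    (Eventually.of_forall fun x => continuousAt_const) (hasDerivAt_const 0 0)
    (fun z => by rw [hid, hid]) (by rw [mul_one]; exact hτ)
  simp only [hid] at h
  exact h

theorem hasTwist_planarMap {A B a ν₀ τ : ℝ} {f : ℝ → ℝ} (hs : 0 < Real.sin (2 * Real.pi * ν₀))
    (ha : a = 2 * Real.cos (2 * Real.pi * ν₀)) (hf : MatchesForce A B a f)
    (hτ : τ = twistRate A B a * Real.sin (2 * Real.pi * ν₀) ^ 2 / Real.pi) :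
    HasTwist (planarMap f) ν₀ τ := by
  -- The scale m = 1 / √sin Φ makes m² sin Φ = 1, the Jacobian of the identity.
  have hm : (√(Real.sin (2 * Real.pi * ν₀)))⁻¹ ^ 2 = (Real.sin (2 * Real.pi * ν₀))⁻¹ := by
    rw [inv_pow, Real.sq_sqrt hs.le]
  refine hasTwist_of_conj (G := Homeomorph.refl _)
    (inv_ne_zero (Real.sqrt_pos.2 hs).ne') hs.ne' rfl ha hf ?_ (fun z => rfl) ?_
  · rw [hm, inv_mul_cancel₀ hs.ne']
    exact isSmoothArea_refl
  · rw [hτ, hm]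
    field_simp

/-! ### The lattice with one thin lens -/

/-- In both orders x' = (cos Φ + α sin Φ) x + β sin Φ x˙ + e F(x), with e = β sin Φ if the lens acts
first and e = 0 if it acts last. Eliminating x˙, with det M = 1, gives the same second order
recurrence for x. -/
theorem exists_fiberMap_of_mem_oneTurnMaps {Φ α β : ℝ} {F : ℝ → ℝ} {T : ℝ × ℝ → ℝ × ℝ}
    (hβ : β ≠ 0) (hT : T ∈ oneTurnMaps Φ α β F) :
    ∃ e : ℝ, ∀ z,
      (z.1, (T z).1) = fiberMap (β * Real.sin Φ)
        (fun x => (Real.cos Φ + α * Real.sin Φ) * x + e * F x) z ∧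
      fiberMap (β * Real.sin Φ)
        (fun x => (Real.cos Φ + α * Real.sin Φ) * x + e * F x) (T z) =
        planarMap (fun q => 2 * q * Real.cos Φ + β * Real.sin Φ * F q) (fiberMap (β * Real.sin Φ)
          (fun x => (Real.cos Φ + α * Real.sin Φ) * x + e * F x) z) := by
  have hcs := Real.cos_sq_add_sin_sq Φ
  rcases hT with rfl | rfl
  · refine ⟨β * Real.sin Φ, fun z => ?_⟩
    have h1 : (z.1, ((twissMap Φ α β ∘ thinLens F) z).1) = fiberMap (β * Real.sin Φ)
        (fun x => (Real.cos Φ + α * Real.sin Φ) * x + β * Real.sin Φ * F x) z := by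
      ext
      · rfl
      · simp only [Function.comp, twissMap, thinLens, fiberMap]
        ring
    refine ⟨h1, ?_⟩
    rw [← h1]
    ext
    · rfl
    · simp only [fiberMap, planarMap]
      simp only [Function.comp, twissMap, thinLens]
      field_simp
      linear_combination (-z.1) * hcs
  · refine ⟨0, fun z => ?_⟩
    have h1 : (z.1, ((thinLens F ∘ twissMap Φ α β) z).1) = fiberMap (β * Real.sin Φ)
        (fun x => (Real.cos Φ + α * Real.sin Φ) * x + 0 * F x) z := by
      ext
      · rfl
      · simp only [Function.comp, twissMap, thinLens, fiberMap]
        ring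
    refine ⟨h1, ?_⟩
    rw [← h1]
    ext
    · rfl
    · simp only [fiberMap, planarMap]
      simp only [Function.comp, twissMap, thinLens]
      field_simp
      linear_combination (-z.1) * hcs

theorem mul_mcmLens {Φ β : ℝ} (hβ : β ≠ 0) (hs : Real.sin Φ ≠ 0) (A B q : ℝ) :
    2 * q * Real.cos Φ + β * Real.sin Φ * mcmLens Φ β A B q =
      mcmForce A B (2 * Real.cos Φ) q := by
  unfold mcmLens
  field_simp
  ring

theorem hasDetuning_lens {A B a Φ α β ν₀ τ : ℝ} {T : ℝ × ℝ → ℝ × ℝ} (hβ : 0 < β)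
    (hs : Real.sin Φ ≠ 0) (hΦ : Φ = 2 * Real.pi * ν₀) (ha : a = 2 * Real.cos Φ)
    (hT : T ∈ oneTurnMaps Φ α β (mcmLens Φ β A B))
    (hτ : τ = twistRate A B a * Real.sin Φ ^ 3 * β / Real.pi) :
    HasDetuning T (lensInvariant Φ A B T) ν₀ τ := by
  subst ha
  obtain ⟨e, he⟩ := exists_fiberMap_of_mem_oneTurnMaps hβ.ne' hT
  set F := mcmLens Φ β A B with hF
  set g : ℝ → ℝ := fun x => (Real.cos Φ + α * Real.sin Φ) * x + e * F x with hg
  have hK : lensInvariant Φ A B T = fun z =>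
      mcmInvariant A B (2 * Real.cos Φ) (fiberMap (β * Real.sin Φ) g z) :=
    funext fun z => by rw [← (he z).1, lensInvariant]
  -- The value is 0, but only differentiability at 0 is used.
  have hFd : HasDerivAt F
      ((2 * Real.cos Φ - 2 * 1 * Real.cos Φ) / (β * Real.sin Φ)) 0 :=
    ((hasDerivAt_mcmForce A B (2 * Real.cos Φ)).sub
      (((hasDerivAt_id' (0 : ℝ)).const_mul 2).mul_const (Real.cos Φ))).div_const _
  have hF0 : F 0 = 0 := by simp [hF, mcmLens, mcmForce_zero]
  have hD : ∀ᶠ x in 𝓝 (0 : ℝ), A * x ^ 2 + B * x + 1 ≠ 0 := by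
    have : ContinuousAt (fun t : ℝ => A * t ^ 2 + B * t + 1) 0 := by fun_prop
    exact this.eventually (isOpen_ne.mem_nhds (by norm_num))
  rw [hK]
  refine hasDetuning_of_fiberMap hs hΦ rfl ?_ ?_ ?_ ?_
    (((hasDerivAt_id' (0 : ℝ)).const_mul (Real.cos Φ + α * Real.sin Φ)).add (hFd.const_mul e)) ?_ ?_
  · rw [mul_assoc]
    exact mul_pos hβ (mul_self_pos.2 hs)
  · have : Measurable F := by
      unfold F mcmLens mcmForce
      fun_prop
    fun_prop
  · simp [hg, hF0]
  · filter_upwards [hD] with x hx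
    have : ContinuousAt F x :=
      ((continuousAt_mcmForce (2 * Real.cos Φ) hx).sub (by fun_prop)).div_const _
    fun_prop
  · intro z
    rw [(he z).2, show (fun q => 2 * q * Real.cos Φ + β * Real.sin Φ * F q) =
      mcmForce A B (2 * Real.cos Φ) from funext (mul_mcmLens hβ.ne' hs A B)]
  · rw [hτ]
    ring

theorem hasTwist_lens {A B a Φ α β ν₀ τ : ℝ} {F : ℝ → ℝ} {T : ℝ × ℝ → ℝ × ℝ} (hβ : 0 < β)
    (hs : Real.sin Φ ≠ 0) (hΦ : Φ = 2 * Real.pi * ν₀) (ha : a = 2 * Real.cos Φ)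
    (hF : ContDiff ℝ ∞ F) (hF0 : F 0 = 0)
    (hf : MatchesForce A B a fun q => 2 * q * Real.cos Φ + β * Real.sin Φ * F q)
    (hT : T ∈ oneTurnMaps Φ α β F)
    (hτ : τ = twistRate A B a * Real.sin Φ ^ 3 * β / Real.pi) : HasTwist T ν₀ τ := by
  obtain ⟨e, he⟩ := exists_fiberMap_of_mem_oneTurnMaps hβ.ne' hT
  have hg : ContDiff ℝ ∞ fun x => (Real.cos Φ + α * Real.sin Φ) * x + e * F x := by fun_prop
  -- The scale m = √β matches m² sin Φ with the Jacobian β sin Φ of the fibre map.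
  have hm : √β ^ 2 = β := Real.sq_sqrt hβ.le
  refine hasTwist_of_conj (Real.sqrt_pos.2 hβ).ne' hs hΦ ha hf
    (G := fiberHomeo (mul_ne_zero hβ.ne' hs) _ hg.continuous) ?_ (fun z => (he z).2) ?_
  · rw [hm]
    exact isSmoothArea_fiberHomeo _ hg (by simp [hF0])
  · rw [hτ, hm]
    ring

/-! ### Parameters -/

theorem add_one_mul_mhB {a : ℝ} (b : ℝ) (h : a ≠ -1) : -(a + 1) * mhB a b = b := by
  have : a + 1 ≠ 0 := fun h' => h (by linarith)
  unfold mhB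
  field_simp

theorem cubic_coefficient {a : ℝ} (b c : ℝ) (h0 : a ≠ 0) (h : a ≠ -1) :
    (a + 1) * mhB a b ^ 2 - a * mhA a b c = c := by
  have : a + 1 ≠ 0 := fun h' => h (by linarith)
  unfold mhB mhA
  field_simp
  ring

theorem mul_mhA_zero {a : ℝ} (c : ℝ) (h0 : a ≠ 0) : a * mhA a 0 c = -c := by
  unfold mhA
  field_simp
  ring

theorem matchesForce_cubic {a : ℝ} (c : ℝ) (h0 : a ≠ 0) {f : ℝ → ℝ}
    (hf : ∀ q, f q = a * q + c * q ^ 3) : MatchesForce (mhA a 0 c) 0 a f := by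
  refine (Asymptotics.isBigO_zero _ _).congr_left fun q => ?_
  rw [hf]
  linear_combination (-q ^ 3) * mul_mhA_zero c h0

theorem matchesForce_quadratic {a : ℝ} (b : ℝ) (h0 : a ≠ 0) (h : a ≠ -1) {f : ℝ → ℝ}
    (hf : ∀ q, f q = a * q + b * q ^ 2) : MatchesForce (mhA a b 0) (mhB a b) a f := by
  refine (Asymptotics.isBigO_zero _ _).congr_left fun q => ?_
  rw [hf, add_one_mul_mhB b h, cubic_coefficient b 0 h0 h]
  ring

theorem mcmForce_cubic_isBigO {a : ℝ} (c : ℝ) (h0 : a ≠ 0) :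
    (fun q : ℝ => mcmForce (mhA a 0 c) 0 a q - (a * q + c * q ^ 3)) =O[𝓝 0] fun q => q ^ 4 := by
  refine (matchesForce_mcmForce (mhA a 0 c) 0 a).congr_left fun q => ?_
  linear_combination (q ^ 3) * mul_mhA_zero c h0

theorem mcmForce_quadratic_isBigO {a : ℝ} (b : ℝ) (h0 : a ≠ 0) (h : a ≠ -1) :
    (fun q : ℝ => mcmForce (mhA a b 0) (mhB a b) a q - (a * q + b * q ^ 2))
      =O[𝓝 0] fun q => q ^ 4 := by
  refine (matchesForce_mcmForce (mhA a b 0) (mhB a b) a).congr_left fun q => ?_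
  rw [add_one_mul_mhB b h, cubic_coefficient b 0 h0 h]
  ring

/-- With A = 0 the cubic coefficient (a + 1) B² remains, so the agreement is only to second order; a
= 0 is allowed. -/
theorem mcmForce_quadratic_isBigO_cube {a : ℝ} (b : ℝ) (h : a ≠ -1) :
    (fun q : ℝ => mcmForce 0 (mhB a b) a q - (a * q + b * q ^ 2)) =O[𝓝 0] fun q => q ^ 3 := by
  have h1 : (fun q : ℝ => q ^ 4) =O[𝓝 0] fun q => q ^ 3 :=
    (Asymptotics.isLittleO_pow_pow (by norm_num)).isBigO
  have h2 := ((matchesForce_mcmForce 0 (mhB a b) a).trans h1).add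
    ((Asymptotics.isBigO_refl (fun q : ℝ => q ^ 3) (𝓝 0)).const_mul_left ((a + 1) * mhB a b ^ 2))
  refine h2.congr_left fun q => ?_
  rw [add_one_mul_mhB b h]
  ring

theorem mcmLens_isBigO {Φ β A B m c : ℝ} {n k : ℕ} (hβ : β ≠ 0) (hs : Real.sin Φ ≠ 0)
    (h : (fun q : ℝ => mcmForce A B (2 * Real.cos Φ) q - (2 * Real.cos Φ * q + m * q ^ k))
      =O[𝓝 0] fun q => q ^ n) (hm : m = β * Real.sin Φ * c) :
    (fun x : ℝ => mcmLens Φ β A B x - c * x ^ k) =O[𝓝 0] fun x => x ^ n := by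
  refine (h.const_mul_left (β * Real.sin Φ)⁻¹).congr_left fun q => ?_
  rw [hm, mcmLens]
  field_simp
  ring

/-! ### Values of the twist rate -/

theorem four_sub_sq {a Φ : ℝ} (ha : a = 2 * Real.cos Φ) : 4 - a ^ 2 = 4 * Real.sin Φ ^ 2 := by
  rw [ha]
  linear_combination (-4) * Real.cos_sq_add_sin_sq Φ

theorem twistRate_cubic {a Φ : ℝ} (c : ℝ) (h0 : a ≠ 0) (ha : a = 2 * Real.cos Φ)
    (hs : Real.sin Φ ≠ 0) :
    twistRate (mhA a 0 c) 0 a * Real.sin Φ ^ 4 = -(3 / 8) * c := by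
  rw [twistRate, four_sub_sq ha, mul_assoc, mul_mhA_zero c h0]
  field_simp
  ring

/-- Trigonometric functions of multiples of the half angle `x = π ν₀`. -/
theorem half_angle_identities {a ν₀ : ℝ} (ha : a = 2 * Real.cos (2 * Real.pi * ν₀))
    (hs : Real.sin (2 * Real.pi * ν₀) ≠ 0) :
    ∃ S C : ℝ, S ≠ 0 ∧ C ≠ 0 ∧ Real.sin (2 * Real.pi * ν₀) = 2 * S * C ∧
      2 - a = 4 * S ^ 2 ∧ 2 + a = 4 * C ^ 2 ∧ Real.sin (Real.pi * ν₀) = S ∧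
      Real.cos (Real.pi * ν₀) = C ∧ Real.sin (3 * Real.pi * ν₀) = S * (a + 1) ∧
      Real.cos (3 * Real.pi * ν₀) = C * (a - 1) := by
  set x := Real.pi * ν₀ with hx
  rw [show 3 * Real.pi * ν₀ = 3 * x by rw [hx]; ring]
  rw [show 2 * Real.pi * ν₀ = 2 * x by rw [hx]; ring] at ha hs ⊢
  rw [Real.sin_two_mul] at hs ⊢
  rw [Real.cos_two_mul] at ha
  have hcs := Real.cos_sq_add_sin_sq x
  refine ⟨Real.sin x, Real.cos x, fun h => hs (by rw [h]; ring), fun h => hs (by rw [h]; ring),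
    rfl, ?_, ?_, rfl, rfl, ?_, ?_⟩
  · rw [ha]
    linear_combination (-4) * hcs
  · rw [ha]
    ring
  · rw [Real.sin_three_mul, ha]
    linear_combination (-4) * Real.sin x * hcs
  · rw [Real.cos_three_mul, ha]
    ring

/-- The fifth power of the sine serves both uses: the planar map has μ sin² Φ / π with b = 1,
leaving sin³ Φ in the denominator, and the lens has μ sin³ Φ β / π with b² = β² k² sin² Φ, where all
sines cancel. -/
theorem twistRate_quadratic_second {a ν₀ : ℝ} (b : ℝ) (h0 : a ≠ 0) (h : a ≠ -1)
    (ha : a = 2 * Real.cos (2 * Real.pi * ν₀)) (hs : Real.sin (2 * Real.pi * ν₀) ≠ 0) :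
    twistRate (mhA a b 0) (mhB a b) a * Real.sin (2 * Real.pi * ν₀) ^ 5 / Real.pi =
      -(sx2 ν₀ * b ^ 2) := by
  have h1 : a + 1 ≠ 0 := fun h' => h (by linarith)
  have hpi := Real.pi_ne_zero
  obtain ⟨S, C, hS, hC, hsin, h2, h3, h4, h5, h6, h7⟩ := half_angle_identities ha hs
  have h8 : (4 - a ^ 2) ^ 2 = 256 * S ^ 4 * C ^ 4 := by
    rw [show 4 - a ^ 2 = (2 - a) * (2 + a) by ring, h2, h3]
    ring
  rw [twistRate, mhA, mhB, h8, h2, h3, hsin, sx2, Real.cot_eq_cos_div_sin,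
    Real.cot_eq_cos_div_sin, h4, h5, h6, h7]
  field_simp
  linear_combination (-786432 * b ^ 2) * h2

theorem twistRate_quadratic_first {a ν₀ : ℝ} (b : ℝ) (h : a ≠ -1)
    (ha : a = 2 * Real.cos (2 * Real.pi * ν₀)) (hs : Real.sin (2 * Real.pi * ν₀) ≠ 0) :
    twistRate 0 (mhB a b) a * Real.sin (2 * Real.pi * ν₀) ^ 5 / Real.pi =
      -(sx1 ν₀ * b ^ 2) := by
  have h1 : a + 1 ≠ 0 := fun h' => h (by linarith)
  have hpi := Real.pi_ne_zero
  obtain ⟨S, C, hS, hC, hsin, h2, h3, h4, h5, h6, h7⟩ := half_angle_identities ha hs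
  rw [twistRate, mhB, h2, h3, hsin, sx1, h5, h6, h7]
  field_simp
  ring

end Twist

end

/-! ### Assembly of the six cases -/

theorem mainTheorem7 :
    -- cubic Hénon map
    (∀ a σ ν₀ : ℝ, |a| < 2 → a ≠ 0 → (σ = 1 ∨ σ = -1) →
      ν₀ = Real.arccos (a / 2) / (2 * Real.pi) →
      ((fun q : ℝ => Twist.mcmForce (Twist.mhA a 0 σ) 0 a q - (a * q + σ * q ^ 3))
          =O[𝓝 0] fun q => q ^ 4) ∧
      Twist.HasDetuning (Twist.planarMap (Twist.mcmForce (Twist.mhA a 0 σ) 0 a))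
        (Twist.mcmInvariant (Twist.mhA a 0 σ) 0 a) ν₀
        (-σ * (3 / (8 * Real.pi * Real.sin (2 * Real.pi * ν₀) ^ 2))) ∧
      Twist.HasTwist (Twist.planarMap fun q => a * q + σ * q ^ 3) ν₀
        (-σ * (3 / (8 * Real.pi * Real.sin (2 * Real.pi * ν₀) ^ 2)))) ∧
    -- quadratic Hénon map, first order
    (∀ a ν₀ : ℝ, |a| < 2 → a ≠ -1 → ν₀ = Real.arccos (a / 2) / (2 * Real.pi) →
      ((fun q : ℝ => Twist.mcmForce 0 (Twist.mhB a 1) a q - (a * q + q ^ 2))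
          =O[𝓝 0] fun q => q ^ 3) ∧
      Twist.HasDetuning (Twist.planarMap (Twist.mcmForce 0 (Twist.mhB a 1) a))
        (Twist.mcmInvariant 0 (Twist.mhB a 1) a) ν₀
        (-(Twist.sx1 ν₀ / Real.sin (2 * Real.pi * ν₀) ^ 3))) ∧
    -- quadratic Hénon map, second order
    (∀ a ν₀ : ℝ, |a| < 2 → a ≠ 0 → a ≠ -1 → ν₀ = Real.arccos (a / 2) / (2 * Real.pi) →
      ((fun q : ℝ => Twist.mcmForce (Twist.mhA a 1 0) (Twist.mhB a 1) a q - (a * q + q ^ 2))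
          =O[𝓝 0] fun q => q ^ 4) ∧
      Twist.HasDetuning (Twist.planarMap (Twist.mcmForce (Twist.mhA a 1 0) (Twist.mhB a 1) a))
        (Twist.mcmInvariant (Twist.mhA a 1 0) (Twist.mhB a 1) a) ν₀
        (-(Twist.sx2 ν₀ / Real.sin (2 * Real.pi * ν₀) ^ 3)) ∧
      Twist.HasTwist (Twist.planarMap fun q => a * q + q ^ 2) ν₀
        (-(Twist.sx2 ν₀ / Real.sin (2 * Real.pi * ν₀) ^ 3))) ∧
    -- thin sextupole lens, first order
    (∀ ν₀ Φ α β k a b : ℝ, 0 < β → Φ = 2 * Real.pi * ν₀ →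
      a = 2 * Real.cos Φ → b = β * Real.sin Φ * k → |a| < 2 → a ≠ -1 →
      ((fun x : ℝ => Twist.mcmLens Φ β 0 (Twist.mhB a b) x - k * x ^ 2)
          =O[𝓝 0] fun x => x ^ 3) ∧
      ∀ T ∈ Twist.oneTurnMaps Φ α β (Twist.mcmLens Φ β 0 (Twist.mhB a b)),
        Twist.HasDetuning T (Twist.lensInvariant Φ 0 (Twist.mhB a b) T) ν₀
          (-(Twist.sx1 ν₀ * β ^ 3 * k ^ 2))) ∧
    -- thin sextupole lens, second order
    (∀ ν₀ Φ α β k a b : ℝ, 0 < β → Φ = 2 * Real.pi * ν₀ →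
      a = 2 * Real.cos Φ → b = β * Real.sin Φ * k → |a| < 2 → a ≠ 0 → a ≠ -1 →
      ((fun x : ℝ => Twist.mcmLens Φ β (Twist.mhA a b 0) (Twist.mhB a b) x - k * x ^ 2)
          =O[𝓝 0] fun x => x ^ 4) ∧
      (∀ T ∈ Twist.oneTurnMaps Φ α β (Twist.mcmLens Φ β (Twist.mhA a b 0) (Twist.mhB a b)),
        Twist.HasDetuning T (Twist.lensInvariant Φ (Twist.mhA a b 0) (Twist.mhB a b) T) ν₀
          (-(Twist.sx2 ν₀ * β ^ 3 * k ^ 2))) ∧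
      ∀ T ∈ Twist.oneTurnMaps Φ α β (fun x => k * x ^ 2),
        Twist.HasTwist T ν₀ (-(Twist.sx2 ν₀ * β ^ 3 * k ^ 2))) ∧
    -- thin octupole lens
    (∀ ν₀ Φ α β k σ a c : ℝ, 0 < β → Φ = 2 * Real.pi * ν₀ → (σ = 1 ∨ σ = -1) →
      a = 2 * Real.cos Φ → c = β * Real.sin Φ * (σ * k) → |a| < 2 → a ≠ 0 →
      ((fun x : ℝ => Twist.mcmLens Φ β (Twist.mhA a 0 c) 0 x - σ * k * x ^ 3)
          =O[𝓝 0] fun x => x ^ 4) ∧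
      (∀ T ∈ Twist.oneTurnMaps Φ α β (Twist.mcmLens Φ β (Twist.mhA a 0 c) 0),
        Twist.HasDetuning T (Twist.lensInvariant Φ (Twist.mhA a 0 c) 0 T) ν₀
          (-σ * (3 / (8 * Real.pi) * β ^ 2 * k))) ∧
      ∀ T ∈ Twist.oneTurnMaps Φ α β (fun x => σ * k * x ^ 3),
        Twist.HasTwist T ν₀ (-σ * (3 / (8 * Real.pi) * β ^ 2 * k))) := by
  refine ⟨?_, ?_, ?_, ?_, ?_, ?_⟩
  · intro a σ ν₀ ha2 h0 _ hν
    obtain ⟨ha, hs⟩ := Twist.cos_sin_of_arccos ha2 hν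
    have hτ : -σ * (3 / (8 * Real.pi * Real.sin (2 * Real.pi * ν₀) ^ 2)) =
        Twist.twistRate (Twist.mhA a 0 σ) 0 a * Real.sin (2 * Real.pi * ν₀) ^ 2 / Real.pi := by
      have h := Twist.twistRate_cubic σ h0 ha hs.ne'
      generalize Real.sin (2 * Real.pi * ν₀) = S at h hs ⊢
      have hS := hs.ne'
      field_simp
      linear_combination (-8) * h
    exact ⟨Twist.mcmForce_cubic_isBigO σ h0, Twist.hasDetuning_planarMap hs ha hτ,
      Twist.hasTwist_planarMap hs ha (Twist.matchesForce_cubic σ h0 fun q => rfl) hτ⟩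
  · intro a ν₀ ha2 h1 hν
    obtain ⟨ha, hs⟩ := Twist.cos_sin_of_arccos ha2 hν
    have hτ : -(Twist.sx1 ν₀ / Real.sin (2 * Real.pi * ν₀) ^ 3) =
        Twist.twistRate 0 (Twist.mhB a 1) a * Real.sin (2 * Real.pi * ν₀) ^ 2 / Real.pi := by
      have h := Twist.twistRate_quadratic_first 1 h1 ha hs.ne'
      field_simp at h ⊢
      linear_combination -h
    refine ⟨?_, Twist.hasDetuning_planarMap hs ha hτ⟩
    simpa only [one_mul] using Twist.mcmForce_quadratic_isBigO_cube 1 h1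
  · intro a ν₀ ha2 h0 h1 hν
    obtain ⟨ha, hs⟩ := Twist.cos_sin_of_arccos ha2 hν
    have hτ : -(Twist.sx2 ν₀ / Real.sin (2 * Real.pi * ν₀) ^ 3) =
        Twist.twistRate (Twist.mhA a 1 0) (Twist.mhB a 1) a *
          Real.sin (2 * Real.pi * ν₀) ^ 2 / Real.pi := by
      have h := Twist.twistRate_quadratic_second 1 h0 h1 ha hs.ne'
      field_simp at h ⊢
      linear_combination -h
    refine ⟨?_, Twist.hasDetuning_planarMap hs ha hτ, Twist.hasTwist_planarMap hs ha
      (Twist.matchesForce_quadratic 1 h0 h1 fun q => by rw [one_mul]) hτ⟩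
    simpa only [one_mul] using Twist.mcmForce_quadratic_isBigO 1 h0 h1
  · intro ν₀ Φ α β k a b hβ hΦ ha hb ha2 h1
    have hs := Twist.sin_ne_zero_of_abs_lt ha ha2
    have hτ : -(Twist.sx1 ν₀ * β ^ 3 * k ^ 2) =
        Twist.twistRate 0 (Twist.mhB a b) a * Real.sin Φ ^ 3 * β / Real.pi := by
      have h := Twist.twistRate_quadratic_first (ν₀ := ν₀) b h1 (hΦ ▸ ha) (hΦ ▸ hs)
      rw [← hΦ] at h
      -- The factor sin² Φ is supplied by b² = (β k sin Φ)².
      refine mul_right_cancel₀ (pow_ne_zero 2 hs) ?_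
      rw [show Twist.twistRate 0 (Twist.mhB a b) a * Real.sin Φ ^ 3 * β / Real.pi *
        Real.sin Φ ^ 2 = β * (Twist.twistRate 0 (Twist.mhB a b) a * Real.sin Φ ^ 5 / Real.pi) by
          ring, h, hb]
      ring
    refine ⟨Twist.mcmLens_isBigO hβ.ne' hs ?_ hb,
      fun T hT => Twist.hasDetuning_lens hβ hs hΦ ha hT hτ⟩
    rw [← ha]
    exact Twist.mcmForce_quadratic_isBigO_cube b h1
  · intro ν₀ Φ α β k a b hβ hΦ ha hb ha2 h0 h1
    have hs := Twist.sin_ne_zero_of_abs_lt ha ha2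
    have hτ : -(Twist.sx2 ν₀ * β ^ 3 * k ^ 2) =
        Twist.twistRate (Twist.mhA a b 0) (Twist.mhB a b) a * Real.sin Φ ^ 3 * β / Real.pi := by
      have h := Twist.twistRate_quadratic_second (ν₀ := ν₀) b h0 h1 (hΦ ▸ ha) (hΦ ▸ hs)
      rw [← hΦ] at h
      refine mul_right_cancel₀ (pow_ne_zero 2 hs) ?_
      rw [show Twist.twistRate (Twist.mhA a b 0) (Twist.mhB a b) a * Real.sin Φ ^ 3 * β / Real.pi *
        Real.sin Φ ^ 2 = β * (Twist.twistRate (Twist.mhA a b 0) (Twist.mhB a b) a *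
          Real.sin Φ ^ 5 / Real.pi) by ring, h, hb]
      ring
    refine ⟨Twist.mcmLens_isBigO hβ.ne' hs ?_ hb,
      fun T hT => Twist.hasDetuning_lens hβ hs hΦ ha hT hτ,
      fun T hT => Twist.hasTwist_lens hβ hs hΦ ha (by fun_prop) (by simp)
        (Twist.matchesForce_quadratic b h0 h1 fun q => ?_) hT hτ⟩
    · rw [← ha]
      exact Twist.mcmForce_quadratic_isBigO b h0 h1
    · rw [ha, hb]
      ring
  · intro ν₀ Φ α β k σ a c hβ hΦ _ ha hc ha2 h0
    have hs := Twist.sin_ne_zero_of_abs_lt ha ha2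
    have hτ : -σ * (3 / (8 * Real.pi) * β ^ 2 * k) =
        Twist.twistRate (Twist.mhA a 0 c) 0 a * Real.sin Φ ^ 3 * β / Real.pi := by
      have h := Twist.twistRate_cubic c h0 ha hs
      refine mul_right_cancel₀ hs ?_
      rw [show Twist.twistRate (Twist.mhA a 0 c) 0 a * Real.sin Φ ^ 3 * β / Real.pi *
        Real.sin Φ = β * (Twist.twistRate (Twist.mhA a 0 c) 0 a * Real.sin Φ ^ 4) / Real.pi by
          ring, h, hc]
      field_simp
    refine ⟨Twist.mcmLens_isBigO hβ.ne' hs ?_ hc,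
      fun T hT => Twist.hasDetuning_lens hβ hs hΦ ha hT hτ,
      fun T hT => Twist.hasTwist_lens hβ hs hΦ ha (by fun_prop) (by simp)
        (Twist.matchesForce_cubic c h0 fun q => ?_) hT hτ⟩
    · rw [← ha]
      exact Twist.mcmForce_cubic_isBigO c h0
    · rw [ha, hc]
      ring
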